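/- **Setting.** Let $d,n\ge1$ and let $\Omega\subseteq\mathbb R^d$ be a bounded or unbounded domain. If $\partial\Omega\neq\emptyset$, assume that $\partial\Omega\in C^2$ and that for some $\tau_0>0$ the following holds, where $\nu$ is the inward unit normal: the map $(p,\tau)\mapsto p+\tau\nu(p)$ is a bijection of $\partial\Omega\times(0,\tau_0]$ onto $\{x\in\Omega:\operatorname{dist}(x,\partial\Omega)\le\tau_0\}$, and, for suitable $C^2$ local variables $s$ on $\partial\Omega$ and $0<\tau\le\tau_0$, the first derivatives of $x$ in $(\tau,s)$ are uniformly bounded and the Jacobians are uniformly bounded and uniformly separated from zero. Let $\mathfrak V$ be either $W_2^1(\Omega;\mathbb C^n)$ or its subspace $\mathring W_2^1(\Omega;\mathbb C^n)$ of functions with zero trace on $\partial\Omega$ (the closure of $C_c^\infty(\Omega;\mathbb C^n)$), with the norm of $W_2^1(\Omega;\mathbb C^n)$. For $V\in L_\infty(\Omega;\mathbb M_n)$, where $\mathbb M_n$ is the space of complex $n\times n$ matrices with $|A|=\sum_{i,j}|a_{ij}|$, put $$\|V\|_{\mathfrak M_{1,-1}}=\sup_{u,v\in\mathfrak V\setminus\{0\}}\frac{|(Vu,v)_{L_2(\Omega;\mathbb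 C^n)}|}{\|u\|_{\mathfrak V}\,\|v\|_{\mathfrak V}} .$$ Let $\Gamma\subset\mathbb R^d$ be a lattice generated by a basis $b_1,\dots,b_d$, with periodicity cell $\square=\{a+\sum_i t_ib_i:\ 0<t_i<1\}$ for some $a\in\mathbb R^d$. For $\eta>0$ let $\square_\gamma^\eta=\eta\square+\eta\gamma$ and $\Gamma_\eta=\{\gamma\in\Gamma:\ \square_\gamma^\eta\subset\Omega\}$. Let $\varepsilon$ be a parameter ranging over a set $S\subseteq\mathbb R^m$, let $V^\varepsilon\in L_\infty(\Omega;\mathbb M_n)$ be a family bounded in $L_\infty(\Omega;\mathbb M_n)$ uniformly in $\varepsilon\in S$, and let $V^0\in L_\infty(\Omega;\mathbb M_n)$. All limits $\varepsilon\to0$ are taken within $S$. Consider, for functions $\eta=\eta(\varepsilon)$ and $\rho_1=\rho_1(\varepsilon)$, the condition $$\Big|\int_{\square_\gamma^{\eta}}\eta^{-d}\big(V^\varepsilon(x)-V^0(x)\big)\,dx\Big|\le\rho_1(\varepsilon)\ \text{ for all }\varepsilon\in S,\ \gamma\in\Gamma_{\eta(\varepsilon)},\qquad \eta(\varepsilon)\to0,\quad\rho_1(\varepsilon)\to0\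 \text{ as }\varepsilon\to0. \tag{1}$$ **Theorem.** (a) There is a constant $C>0$, independent of $\varepsilon$, $\eta$ and $\rho_1$, such that whenever (1) holds with some functions $\eta>0$ and $\rho_1\ge0$, then $V^\varepsilon\to V^0$ in $\mathfrak M_{1,-1}$ as $\varepsilon\to0$ and, for all $\varepsilon\in S$, $$\|V^\varepsilon-V^0\|_{\mathfrak M_{1,-1}}\le C\big(\rho_1(\varepsilon)+\eta(\varepsilon)\big).$$ (b) Conversely, if $\|V^\varepsilon-V^0\|_{\mathfrak M_{1,-1}}\to0$ as $\varepsilon\to0$, then there is a constant $C>0$ independent of $\varepsilon$ such that (1) holds with $$\eta(\varepsilon)=\|V^\varepsilon-V^0\|_{\mathfrak M_{1,-1}}^{1/4},\qquad \rho_1(\varepsilon)=C\,\|V^\varepsilon-V^0\|_{\mathfrak M_{1,-1}}^{1/4},$$ where the inequality in (1) is claimed for those $\varepsilon\in S$ at which $\eta(\varepsilon)>0$; at the other $\varepsilon\in S$ one has $V^\varepsilon=V^0$ almost everywhere in $\Omega$. -/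

import Mathlib

open MeasureTheory Filter Topology Set
open scoped ENNReal ContDiff Matrix

noncomputable section

/-- The Euclidean space `ℝ^d`. -/
abbrev Rd (d : ℕ) : Type := EuclideanSpace ℝ (Fin d)

/-- The Hermitian space `ℂ^n`. -/
abbrev Cn (n : ℕ) : Type := EuclideanSpace ℂ (Fin n)

/-! ### Domains with a uniformly regular `C²` boundary -/

/-- `ψ` is a `C²` defining function of the open set `Ω` on the neighbourhood `W` of the boundary
point `p`: on `W` the set `Ω` is `{ψ > 0}`, and `∇ψ(p) ≠ 0`. -/
structure IsC2DefiningAt {d : ℕ} (Ω : Set (Rd d)) (p : Rd d) (W : Set (Rd d)) (ψ : Rd d → ℝ) :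
    Prop where
  isOpen : IsOpen W
  mem : p ∈ W
  contDiffOn : ContDiffOn ℝ 2 ψ W
  gradient_ne_zero : gradient ψ p ≠ 0
  inter_eq : Ω ∩ W = {x ∈ W | 0 < ψ x}

/-- `∂Ω ∈ C²`, and `ν` restricted to `∂Ω` is the inward unit normal field. -/
def IsC2WithInwardNormal {d : ℕ} (Ω : Set (Rd d)) (ν : Rd d → Rd d) : Prop :=
  ∀ p ∈ frontier Ω, ∃ (W : Set (Rd d)) (ψ : Rd d → ℝ), IsC2DefiningAt Ω p W ψ ∧
    ν p = ‖gradient ψ p‖⁻¹ • gradient ψ p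

/-- The layer `Π(τ₀) = {x ∈ Ω : dist (x, ∂Ω) ≤ τ₀}` (empty if `∂Ω` is empty). -/
def boundaryLayer {d : ℕ} (Ω : Set (Rd d)) (τ₀ : ℝ) : Set (Rd d) :=
  Ω ∩ Metric.cthickening τ₀ (frontier Ω)

/-- The space of the `d - 1` local variables `s` on `∂Ω`. A point `y` of `ℝ^d` is read as a pair
`(τ, s)`: the coordinate of index `0` is `τ`, the other ones form `s`. -/
abbrev LocalVar (d : ℕ) [NeZero d] : Type := EuclideanSpace ℝ {i : Fin d // i ≠ 0}

/-- The variables `s` of the point `y = (τ, s)`. -/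
def localVar {d : ℕ} [NeZero d] (y : Rd d) : LocalVar d := WithLp.toLp 2 fun i => y i.1

/-- The map `(τ, s) ↦ x = σ(s) + τ ν(σ(s))`, for a parametrization `σ` of a part of `∂Ω`. -/
def normalCoord {d : ℕ} [NeZero d] (ν : Rd d → Rd d) (σ : LocalVar d → Rd d) (y : Rd d) : Rd d :=
  σ (localVar y) + y 0 • ν (σ (localVar y))

/-- `σ` is a `C²` parametrization of a neighbourhood of `p` in `∂Ω` by the open set `U`, and on
`U × (0, τ₀]` the map `(τ, s) ↦ x` has first derivatives bounded by `M` and a Jacobian that lies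
between `M⁻¹` and `M` in absolute value. (That `(τ, s) ↦ x` is `C¹` also follows from
`∂Ω ∈ C²`.) -/
structure IsBoundaryChart {d : ℕ} [NeZero d] (Ω : Set (Rd d)) (ν : Rd d → Rd d) (τ₀ M : ℝ)
    (p : Rd d) (U : Set (LocalVar d)) (σ : LocalVar d → Rd d) : Prop where
  isOpen : IsOpen U
  contDiffOn : ContDiffOn ℝ 2 σ U
  injOn : InjOn σ U
  image_subset : σ '' U ⊆ frontier Ω
  mem : p ∈ σ '' U
  image_mem_nhds : σ '' U ∈ 𝓝[frontier Ω] p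
  contDiffOn_normalCoord : ContDiffOn ℝ 1 (normalCoord ν σ) {y | localVar y ∈ U}
  norm_fderiv_le : ∀ y : Rd d, localVar y ∈ U → y 0 ∈ Ioc 0 τ₀ →
    ‖fderiv ℝ (normalCoord ν σ) y‖ ≤ M
  abs_det_le : ∀ y : Rd d, localVar y ∈ U → y 0 ∈ Ioc 0 τ₀ →
    |(fderiv ℝ (normalCoord ν σ) y).det| ≤ M
  le_abs_det : ∀ y : Rd d, localVar y ∈ U → y 0 ∈ Ioc 0 τ₀ →
    M⁻¹ ≤ |(fderiv ℝ (normalCoord ν σ) y).det|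

/-- The standing assumptions on `Ω`: it is a domain (bounded or not) in `ℝ^d`; its boundary, if
not empty, is `C²`; for some `τ₀ > 0` the coordinates `(τ, s)`, with `τ` the distance along the
inward normal, are well defined on `Π(τ₀)`; and for suitable local variables `s` on `∂Ω` the first
derivatives of `x` in `(τ, s)` are uniformly bounded and the Jacobians are uniformly bounded and
separated from zero. -/
structure IsRegularDomain {d : ℕ} [NeZero d] (Ω : Set (Rd d)) : Prop where
  isOpen : IsOpen Ω
  isConnected : IsConnected Ω
  exists_collar : ∃ (ν : Rd d → Rd d) (τ₀ M : ℝ), 0 < τ₀ ∧ 0 < M ∧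
    IsC2WithInwardNormal Ω ν ∧
    BijOn (fun q : Rd d × ℝ => q.1 + q.2 • ν q.1) (frontier Ω ×ˢ Ioc 0 τ₀)
      (boundaryLayer Ω τ₀) ∧
    ∀ p ∈ frontier Ω, ∃ (U : Set (LocalVar d)) (σ : LocalVar d → Rd d),
      IsBoundaryChart Ω ν τ₀ M p U σ

/-! ### Sobolev spaces -/

/-- The partial derivative `∂φ/∂x_i`. -/
def partialDeriv {d : ℕ} {F : Type*} [NormedAddCommGroup F] [NormedSpace ℝ F] (i : Fin d)
    (φ : Rd d → F) (x : Rd d) : F :=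
  fderiv ℝ φ x (EuclideanSpace.single i 1)

/-- `φ` is infinitely differentiable with a compact support contained in `Ω`. -/
def IsTestFunction {d : ℕ} {F : Type*} [NormedAddCommGroup F] [NormedSpace ℝ F]
    (Ω : Set (Rd d)) (φ : Rd d → F) : Prop :=
  ContDiff ℝ ∞ φ ∧ HasCompactSupport φ ∧ tsupport φ ⊆ Ω

/-- `g` is the weak derivative of `u` with respect to `x_i` in `Ω`. -/
def IsWeakPartial {d n : ℕ} (Ω : Set (Rd d)) (i : Fin d) (u g : Rd d → Cn n) : Prop :=
  ∀ φ : Rd d → ℝ, IsTestFunction Ω φ →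
    ∫ x in Ω, partialDeriv i φ x • u x = -∫ x in Ω, φ x • g x

/-- A function of the Sobolev space `W_2^1(Ω; ℂ^n)`, given with its weak gradient. -/
structure W12 {d : ℕ} (Ω : Set (Rd d)) (n : ℕ) where
  toFun : Rd d → Cn n
  grad : Fin d → Rd d → Cn n
  memLp_toFun : MemLp toFun 2 (volume.restrict Ω)
  memLp_grad : ∀ i, MemLp (grad i) 2 (volume.restrict Ω)
  isWeakPartial : ∀ i, IsWeakPartial Ω i toFun (grad i)

/-- The norm of `W_2^1(Ω; ℂ^n)`. -/
def W12.norm {d n : ℕ} {Ω : Set (Rd d)} (u : W12 Ω n) : ℝ :=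
  Real.sqrt ((∫ x in Ω, ‖u.toFun x‖ ^ 2) + ∑ i, ∫ x in Ω, ‖u.grad i x‖ ^ 2)

/-- `u` belongs to the subspace of `W_2^1(Ω; ℂ^n)` of functions with zero trace on `∂Ω`, that is,
to the closure of the set of smooth functions with compact support in `Ω`. -/
def W12.HasZeroTrace {d n : ℕ} {Ω : Set (Rd d)} (u : W12 Ω n) : Prop :=
  ∀ δ : ℝ, 0 < δ → ∃ φ : Rd d → Cn n, IsTestFunction Ω φ ∧
    (∫ x in Ω, ‖u.toFun x - φ x‖ ^ 2) +
      ∑ i, ∫ x in Ω, ‖u.grad i x - partialDeriv i φ x‖ ^ 2 < δ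

/-- The two kinds of boundary conditions. -/
inductive BoundaryCondition where
  | dirichlet
  | robin

/-- The form domain `𝔙`: the functions of `W_2^1(Ω; ℂ^n)` with zero trace for the Dirichlet
condition, and the whole of `W_2^1(Ω; ℂ^n)` for the Robin condition. -/
def formDomain {d : ℕ} (Ω : Set (Rd d)) (n : ℕ) : BoundaryCondition → Set (W12 Ω n)
  | .dirichlet => {u | u.HasZeroTrace}
  | .robin => Set.univ

/-! ### Matrix functions and multipliers -/

/-- `|A| = ∑ |a_{ij}|`. -/
def matAbs {n : ℕ} (A : Matrix (Fin n) (Fin n) ℂ) : ℝ := ∑ i, ∑ j, ‖A i j‖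

/-- `A ∈ L_∞(Ω; 𝕄_n)`. -/
def MemLinf {d n : ℕ} (Ω : Set (Rd d)) (A : Rd d → Matrix (Fin n) (Fin n) ℂ) : Prop :=
  ∀ i j, MemLp (fun x => A x i j) ∞ (volume.restrict Ω)

/-- The norm `‖ |A| ‖` in `L_∞(Ω)`. -/
def linfNorm {d n : ℕ} (Ω : Set (Rd d)) (A : Rd d → Matrix (Fin n) (Fin n) ℂ) : ℝ≥0∞ :=
  eLpNorm (fun x => matAbs (A x)) ∞ (volume.restrict Ω)

/-- The action `⟨V u, v⟩ = (V u, v)` in `L_2(Ω; ℂ^n)` of the functional `V u` on `v`. -/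
def pairing {d n : ℕ} {Ω : Set (Rd d)} (V : Rd d → Matrix (Fin n) (Fin n) ℂ) (u v : W12 Ω n) :
    ℂ :=
  ∫ x in Ω, ∑ i, (V x *ᵥ (u.toFun x).ofLp) i * starRingEnd ℂ (v.toFun x i)

/-- The norm in `𝔐_{1,-1}` of a bounded matrix function `V`, as the supremum of
`|⟨V u, v⟩| / (‖u‖ ‖v‖)` over nonzero `u, v ∈ 𝔙`. -/
def multNorm {d n : ℕ} (Ω : Set (Rd d)) (bc : BoundaryCondition)
    (V : Rd d → Matrix (Fin n) (Fin n) ℂ) : ℝ≥0∞ :=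
  ⨆ (u ∈ formDomain Ω n bc) (v ∈ formDomain Ω n bc) (_ : u.norm ≠ 0) (_ : v.norm ≠ 0),
    ENNReal.ofReal (‖pairing V u v‖ / (u.norm * v.norm))

/-! ### Lattice cells -/

/-- The lattice `Γ` generated by the basis `b`. -/
def lattice {d : ℕ} (b : Module.Basis (Fin d) ℝ (Rd d)) : Set (Rd d) :=
  (Submodule.span ℤ (Set.range b) : Set (Rd d))

/-- The periodicity cell `□ = {a + ∑ t_i b_i : 0 < t_i < 1}` of the lattice generated by `b`. -/
def cell {d : ℕ} (b : Module.Basis (Fin d) ℝ (Rd d)) (a : Rd d) : Set (Rd d) :=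
  {x | ∀ i, b.repr (x - a) i ∈ Ioo (0 : ℝ) 1}

/-- The rescaled cell `□_γ^η = η□ + ηγ`, for `η > 0`. -/
def scaledCell {d : ℕ} (b : Module.Basis (Fin d) ℝ (Rd d)) (a : Rd d) (η : ℝ) (γ : Rd d) :
    Set (Rd d) :=
  {x | η⁻¹ • x - γ ∈ cell b a}

/-- The set `Γ_η` of the `γ ∈ Γ` with `□_γ^η ⊆ Ω`. -/
def innerLattice {d : ℕ} (b : Module.Basis (Fin d) ℝ (Rd d)) (a : Rd d) (Ω : Set (Rd d))
    (η : ℝ) : Set (Rd d) :=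
  {γ ∈ lattice b | scaledCell b a η γ ⊆ Ω}

/-- The matrix `∫ η^{-d} A(x) dx`, the integral being over `□_γ^η`. -/
def cellMean {d n : ℕ} (b : Module.Basis (Fin d) ℝ (Rd d)) (a : Rd d) (η : ℝ) (γ : Rd d)
    (A : Rd d → Matrix (Fin n) (Fin n) ℂ) : Matrix (Fin n) (Fin n) ℂ :=
  Matrix.of fun i j => ∫ x in scaledCell b a η γ, ((η : ℂ) ^ d)⁻¹ * A x i j

/-- The condition on the local means: `η(ε) → 0` and `ρ(ε) → 0` as `ε → 0` in the set `S` of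
parameters, and `|∫ η^{-d} (V^ε - V^0) dx| ≤ ρ(ε)`, the integral being over `□_γ^η`, for all
`ε ∈ S` and all `γ ∈ Γ_η`, `η = η(ε)`. It only speaks of cells with `η(ε) > 0`. -/
def MeanCondition {d n m : ℕ} (Ω : Set (Rd d)) (b : Module.Basis (Fin d) ℝ (Rd d)) (a : Rd d)
    (S : Set (Rd m)) (V : Rd m → Rd d → Matrix (Fin n) (Fin n) ℂ)
    (V₀ : Rd d → Matrix (Fin n) (Fin n) ℂ) (η ρ : Rd m → ℝ) : Prop :=
  Tendsto η (𝓝[S] 0) (𝓝 0) ∧ Tendsto ρ (𝓝[S] 0) (𝓝 0) ∧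
    ∀ ε ∈ S, 0 < η ε → ∀ γ ∈ innerLattice b a Ω (η ε),
      matAbs (cellMean b a (η ε) γ (V ε - V₀)) ≤ ρ ε

end

/-! ### Square-integrable functions -/

/-! Write `A` for the difference of the two potentials; `|A| ≤ K` almost everywhere with `K`
independent of the parameter.

Sufficiency. The form `∫ (A u, v)` is split over the union `G` (`deepRegion`) of the cells whose
`η`-neighbourhood lies in `Ω`, and over the rest. Every point of the rest is within a multiple of
`η` of the boundary. Integrating along inward normals, as in the trace theorem, shows that a layer
of width `τ` carries at most `C τ ‖u‖²` of the squared `L²` norm (`exists_boundaryLayer_estimate`).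
Each of `u`, `v` thus gains a factor of order `√η` there, so that the rest contributes `O(η)`. On a
cell `Q` of `G`, with `f = u_j conj v_i`, one has `|Q| ∫ A f = ∫ A(x) ∫ (f(x) - f(y)) dy dx + ∫ A ∫
f`. The first term is controlled by the `L¹` Poincaré inequality and gains the diameter of `Q`,
hence a factor `η`; the second contains the mean of `A` and gains `ρ` (`enorm_setIntegral_mul_le`).
The `L¹` norms of `f` and `∇f` are bounded by Cauchy–Schwarz, and the cells are summed. Smoothness
is supplied by mollifying the extension by zero; gradients are only estimated away from the
boundary, so no extension operator is needed (`exists_smooth_approx`).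

Necessity. The form is tested on `φ e_j`, `φ e_i`, with `φ` a cutoff of a cell that equals 1 outside
a boundary layer of relative width `θ`. Up to the factor `η^d`, the squared norms of these functions
are `O(1 + θ⁻¹ η⁻²)`, while replacing `φ²` by 1 costs `O(θ)`. If `κ` is the multiplier norm, the
mean is therefore `O(κ (1 + θ⁻¹ η⁻²) + θ)`, and `θ = η`, `κ = η⁴` make this `O(η)` for small `η`
(`exists_matAbs_cellMean_le`). When `κ = 0`, testing against all compactly supported smooth
functions gives `A = 0` (`ae_eq_zero_of_multNorm_eq_zero`). -/

theorem lintegral_mul_enorm_le_sqrt {α : Type*} [MeasurableSpace α] {μ : Measure α}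
    {f g : α → ℝ≥0∞} (hf : AEMeasurable f μ) (hg : AEMeasurable g μ) {a b : ℝ} (ha : 0 ≤ a)
    (hb : 0 ≤ b) (hfa : ∫⁻ x, f x ^ 2 ∂μ ≤ ENNReal.ofReal (a ^ 2))
    (hgb : ∫⁻ x, g x ^ 2 ∂μ ≤ ENNReal.ofReal (b ^ 2)) :
    ∫⁻ x, f x * g x ∂μ ≤ ENNReal.ofReal (a * b) := by
  have h := ENNReal.lintegral_mul_le_Lp_mul_Lq μ Real.HolderConjugate.two_two hf hg
  have key : ∀ {t : ℝ≥0∞} {c : ℝ}, 0 ≤ c → t ≤ ENNReal.ofReal (c ^ 2) →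
      t ^ (1 / (2 : ℝ)) ≤ ENNReal.ofReal c := by
    intro t c hc ht
    refine (ENNReal.rpow_le_rpow ht (by norm_num)).trans_eq ?_
    rw [ENNReal.ofReal_rpow_of_nonneg (by positivity) (by norm_num), ← Real.sqrt_eq_rpow,
      Real.sqrt_sq hc]
  rw [ENNReal.ofReal_mul ha]
  refine h.trans (mul_le_mul' (key ha ?_) (key hb ?_))
  · simpa using hfa
  · simpa using hgb

/-- Pointwise convergence becomes strong because the approximants have no larger norm than the
limit. Fatou's lemma is applied to the nonnegative functions `2|f_k|² + 2|g|² - |f_k - g|²`, whose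
limit has integral `4a`; since the first two terms integrate to at most `4a`, the subtracted one
must vanish in the limit. -/
theorem tendsto_lintegral_enorm_sub_sq {α F : Type*} [MeasurableSpace α] [NormedAddCommGroup F]
    {μ : Measure α} {f : ℕ → α → F} {g : α → F} (hf : ∀ k, AEStronglyMeasurable (f k) μ)
    (hg : AEStronglyMeasurable g μ) (hfin : ∫⁻ x, ‖g x‖ₑ ^ 2 ∂μ ≠ ⊤)
    (hle : ∀ k, ∫⁻ x, ‖f k x‖ₑ ^ 2 ∂μ ≤ ∫⁻ x, ‖g x‖ₑ ^ 2 ∂μ)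
    (hlim : ∀ᵐ x ∂μ, Tendsto (fun k => f k x) atTop (𝓝 (g x))) :
    Tendsto (fun k => ∫⁻ x, ‖f k x - g x‖ₑ ^ 2 ∂μ) atTop (𝓝 0) := by
  set a := ∫⁻ x, ‖g x‖ₑ ^ 2 ∂μ with ha
  have hgm : AEMeasurable (fun x => ‖g x‖ₑ ^ 2) μ := hg.enorm.pow_const 2
  have hfm : ∀ k, AEMeasurable (fun x => ‖f k x‖ₑ ^ 2) μ := fun k => (hf k).enorm.pow_const 2
  have hdm : ∀ k, AEMeasurable (fun x => ‖f k x - g x‖ₑ ^ 2) μ :=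
    fun k => ((hf k).sub hg).enorm.pow_const 2
  let A : ℕ → α → ℝ≥0∞ := fun k x => 2 * ‖f k x‖ₑ ^ 2 + 2 * ‖g x‖ₑ ^ 2
  have hpt : ∀ k x, ‖f k x - g x‖ₑ ^ 2 ≤ A k x := by
    intro k x
    have h1 : ‖f k x - g x‖ ^ 2 ≤ 2 * ‖f k x‖ ^ 2 + 2 * ‖g x‖ ^ 2 := by
      have := norm_sub_le (f k x) (g x)
      nlinarith [sq_nonneg (‖f k x‖ - ‖g x‖), norm_nonneg (f k x - g x)]
    have h2 := ENNReal.ofReal_le_ofReal h1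
    rw [ENNReal.ofReal_add (by positivity) (by positivity), ENNReal.ofReal_mul (by norm_num),
      ENNReal.ofReal_mul (by norm_num), ENNReal.ofReal_pow (norm_nonneg _),
      ENNReal.ofReal_pow (norm_nonneg _), ENNReal.ofReal_pow (norm_nonneg _)] at h2
    simpa [A, ofReal_norm] using h2
  have hAint : ∀ k, ∫⁻ x, A k x ∂μ ≤ 4 * a := by
    intro k
    simp only [A]
    rw [lintegral_add_left' ((hfm k).const_mul 2), lintegral_const_mul'' _ (hfm k),
      lintegral_const_mul'' _ hgm]
    calc _ ≤ 2 * a + 2 * a := by gcongr; exact hle k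
      _ = 4 * a := by ring
  have hsum : ∀ k, ∫⁻ x, (A k x - ‖f k x - g x‖ₑ ^ 2) ∂μ + ∫⁻ x, ‖f k x - g x‖ₑ ^ 2 ∂μ
      ≤ 4 * a := by
    intro k
    rw [← lintegral_add_right' _ (hdm k)]
    refine le_trans (lintegral_mono fun x => ?_) (hAint k)
    rw [tsub_add_cancel_of_le (hpt k x)]
  have hfatou : 4 * a ≤ liminf (fun k => ∫⁻ x, (A k x - ‖f k x - g x‖ₑ ^ 2) ∂μ) atTop := by
    refine le_trans ?_ (lintegral_liminf_le' fun k =>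
      (((hfm k).const_mul 2).add (hgm.const_mul 2)).sub (hdm k))
    rw [ha, ← lintegral_const_mul'' _ hgm]
    refine lintegral_mono_ae ?_
    filter_upwards [hlim] with x hx
    refine le_of_eq (Eq.symm (Tendsto.liminf_eq ?_))
    have h1 : Tendsto (fun k => A k x) atTop (𝓝 (2 * ‖g x‖ₑ ^ 2 + 2 * ‖g x‖ₑ ^ 2)) := by
      refine Tendsto.add (ENNReal.Tendsto.const_mul ?_ (Or.inr (by simp))) tendsto_const_nhds
      exact ((ENNReal.continuous_pow 2).tendsto _).comp ((continuous_enorm.tendsto _).comp hx)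
    have h2 : Tendsto (fun k => ‖f k x - g x‖ₑ ^ 2) atTop (𝓝 0) := by
      have : Tendsto (fun k => f k x - g x) atTop (𝓝 0) := by simpa using hx.sub_const (g x)
      simpa [Function.comp_def] using ((ENNReal.continuous_pow 2).tendsto _).comp
        ((continuous_enorm.tendsto _).comp this)
    have h3 := ENNReal.Tendsto.sub h1 h2 (Or.inr (by simp))
    convert h3 using 2
    rw [tsub_zero]; ring
  rw [ENNReal.tendsto_nhds_zero]
  intro δ hδ
  -- The strict inequality `4 * a - δ < 4 * a` used below fails when `a = 0`.
  rcases eq_or_ne a 0 with h0 | h0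
  · refine Eventually.of_forall fun k => ?_
    have := le_trans le_add_self (hsum k)
    rw [h0, mul_zero] at this
    exact this.trans zero_le
  · have h4a : 4 * a ≠ ⊤ := ENNReal.mul_ne_top (by norm_num) hfin
    have hlt : 4 * a - δ < 4 * a :=
      ENNReal.sub_lt_self h4a (mul_ne_zero (by norm_num) h0) hδ.ne'
    filter_upwards [eventually_lt_of_lt_liminf (hlt.trans_le hfatou)] with k hk
    have hb : ∫⁻ x, (A k x - ‖f k x - g x‖ₑ ^ 2) ∂μ ≠ ⊤ :=
      ne_top_of_le_ne_top h4a (le_trans le_self_add (hsum k))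
    have h5 := (hsum k).trans (tsub_le_iff_right.1 hk.le)
    exact (ENNReal.add_le_add_iff_left hb).1 h5

/-- The operator norm does not exceed the Hilbert–Schmidt norm. This converts bounds on the
components of the weak gradient into bounds on `fderiv`. -/
theorem norm_clm_sq_le_sum {d : ℕ} {F : Type*} [NormedAddCommGroup F] [NormedSpace ℝ F]
    (L : Rd d →L[ℝ] F) :
    ‖L‖ ^ 2 ≤ ∑ i, ‖L (EuclideanSpace.single i 1)‖ ^ 2 := by
  have h : ‖L‖ ≤ √(∑ i, ‖L (EuclideanSpace.single i 1)‖ ^ 2) := by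
    refine L.opNorm_le_bound (Real.sqrt_nonneg _) fun x => ?_
    have hx : x = ∑ i, x i • EuclideanSpace.single i (1 : ℝ) := by
      ext j; simp [Finset.sum_apply, Pi.single_apply]
    calc ‖L x‖ = ‖∑ i, x i • L (EuclideanSpace.single i 1)‖ := by
          conv_lhs => rw [hx]
          simp [map_sum]
      _ ≤ ∑ i, ‖L (EuclideanSpace.single i 1)‖ * ‖x i‖ := by
          refine (norm_sum_le _ _).trans (Finset.sum_le_sum fun i _ => ?_)
          rw [norm_smul, mul_comm]
      _ ≤ √(∑ i, ‖L (EuclideanSpace.single i 1)‖ ^ 2) * √(∑ i, ‖x i‖ ^ 2) :=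
          Real.sum_mul_le_sqrt_mul_sqrt _ _ _
      _ = _ := by rw [EuclideanSpace.norm_eq x]
  calc ‖L‖ ^ 2 ≤ √(∑ i, ‖L (EuclideanSpace.single i 1)‖ ^ 2) ^ 2 := by gcongr
    _ = _ := Real.sq_sqrt (Finset.sum_nonneg fun i _ => by positivity)

/-! ### Mollification -/

/-- The mollification of `f` by a normalized bump function. -/
noncomputable def mollify {d n : ℕ} (φ : ContDiffBump (0 : Rd d)) (f : Rd d → Cn n) :
    Rd d → Cn n :=
  convolution (φ.normed volume) f (ContinuousLinearMap.lsmul ℝ ℝ) volume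

theorem mollify_apply {d n : ℕ} (φ : ContDiffBump (0 : Rd d)) (f : Rd d → Cn n) (x : Rd d) :
    mollify φ f x = ∫ t, φ.normed volume t • f (x - t) := rfl

theorem contDiff_mollify {d n : ℕ} (φ : ContDiffBump (0 : Rd d)) {f : Rd d → Cn n}
    (hf : LocallyIntegrable f) : ContDiff ℝ ∞ (mollify φ f) :=
  HasCompactSupport.contDiff_convolution_left (n := ⊤) _ φ.hasCompactSupport_normed
    φ.contDiff_normed hf

/-- The kernel has total mass one, so the square of the average is at most the average of the
squares; Tonelli and translation invariance finish. -/
theorem lintegral_enorm_mollify_sq_le {d n : ℕ} (φ : ContDiffBump (0 : Rd d))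
    {f : Rd d → Cn n} (hf : AEStronglyMeasurable f) :
    ∫⁻ x, ‖mollify φ f x‖ₑ ^ 2 ≤ ∫⁻ x, ‖f x‖ₑ ^ 2 := by
  set p : Rd d → ℝ≥0∞ := fun t => ENNReal.ofReal (φ.normed volume t) with hp
  have hpm : Measurable p := φ.continuous_normed.measurable.ennreal_ofReal
  have hp1 : ∫⁻ t, p t = 1 := by
    rw [hp, ← ofReal_integral_eq_lintegral_ofReal φ.integrable_normed
      (Eventually.of_forall φ.nonneg_normed), φ.integral_normed, ENNReal.ofReal_one]
  have hF : AEMeasurable (fun z : Rd d × Rd d => ‖f (z.1 - z.2)‖ₑ ^ 2)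
      (volume.prod volume) :=
    (hf.comp_quasiMeasurePreserving
      (quasiMeasurePreserving_sub_of_right_invariant volume volume)).enorm.pow_const 2
  have hpt : ∀ x, ‖mollify φ f x‖ₑ ^ 2 ≤ ∫⁻ t, p t * ‖f (x - t)‖ₑ ^ 2 := by
    intro x
    have hfx : AEMeasurable (fun t => ‖f (x - t)‖ₑ) :=
      (hf.comp_quasiMeasurePreserving (quasiMeasurePreserving_sub_left volume x)).enorm
    have h1 : ‖mollify φ f x‖ₑ ≤ ∫⁻ t, p t * ‖f (x - t)‖ₑ := by
      rw [mollify_apply]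
      refine (enorm_integral_le_lintegral_enorm _).trans (lintegral_mono fun t => ?_)
      rw [enorm_smul, Real.enorm_of_nonneg (φ.nonneg_normed t)]
    -- Hölder for the product `p^(1/2) * (p |f|²)^(1/2)`, the first factor having unit `L²` norm.
    have h2 := ENNReal.lintegral_mul_norm_pow_le (μ := volume) (f := p)
      (g := fun t => p t * ‖f (x - t)‖ₑ ^ 2)
      hpm.aemeasurable (hpm.aemeasurable.mul (hfx.pow_const 2)) (p := 1 / 2) (q := 1 / 2)
      (by norm_num) (by norm_num) (by norm_num)
    rw [hp1, ENNReal.one_rpow, one_mul] at h2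
    have h3 : ∀ t, p t ^ (1 / 2 : ℝ) * (p t * ‖f (x - t)‖ₑ ^ 2) ^ (1 / 2 : ℝ)
        = p t * ‖f (x - t)‖ₑ := by
      intro t
      rw [ENNReal.mul_rpow_of_nonneg _ _ (by norm_num), ← mul_assoc,
        ← ENNReal.rpow_add_of_nonneg _ _ (by norm_num) (by norm_num), ← ENNReal.rpow_natCast,
        ← ENNReal.rpow_mul]
      norm_num
    simp only [h3] at h2
    calc ‖mollify φ f x‖ₑ ^ 2 ≤ ((∫⁻ t, p t * ‖f (x - t)‖ₑ ^ 2) ^ (1 / 2 : ℝ)) ^ 2 := by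
          gcongr; exact h1.trans h2
      _ = _ := by rw [← ENNReal.rpow_natCast, ← ENNReal.rpow_mul]; norm_num
  calc ∫⁻ x, ‖mollify φ f x‖ₑ ^ 2 ≤ ∫⁻ x, ∫⁻ t, p t * ‖f (x - t)‖ₑ ^ 2 := lintegral_mono hpt
    _ = ∫⁻ t, ∫⁻ x, p t * ‖f (x - t)‖ₑ ^ 2 :=
        lintegral_lintegral_swap ((hpm.comp measurable_snd).aemeasurable.mul hF)
    _ = ∫⁻ t, p t * ∫⁻ x, ‖f x‖ₑ ^ 2 := by
        refine lintegral_congr fun t => ?_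
        rw [lintegral_const_mul' _ _ ENNReal.ofReal_ne_top,
          lintegral_sub_right_eq_self (fun x => ‖f x‖ₑ ^ 2) t]
    _ = _ := by rw [lintegral_mul_const _ hpm, hp1, one_mul]

/-- When the ball lies in `Ω`, the reflected kernel `y ↦ ρ (x - y)` is an admissible test function
for the weak derivative. The sign from the reflection cancels the one from integration by parts, and
the jump of the zero extension across the boundary is never seen. -/
theorem partialDeriv_mollify {d n : ℕ} {Ω : Set (Rd d)} (hΩ : IsOpen Ω) {u g : Rd d → Cn n}
    (hu : LocallyIntegrable (Ω.indicator u)) {i : Fin d} (hg : IsWeakPartial Ω i u g)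
    (φ : ContDiffBump (0 : Rd d)) {x : Rd d} (hx : Metric.closedBall x φ.rOut ⊆ Ω) :
    partialDeriv i (mollify φ (Ω.indicator u)) x = mollify φ (Ω.indicator g) x := by
  set ρ := φ.normed volume with hρ
  have hρs : ContDiff ℝ ∞ ρ := φ.contDiff_normed
  have hder := φ.hasCompactSupport_normed.hasFDerivAt_convolution_left (μ := volume)
    (ContinuousLinearMap.lsmul ℝ ℝ) (hρs.of_le (by simp)) hu x
  have hex : ConvolutionExistsAt (fderiv ℝ ρ) (Ω.indicator u) x
      ((ContinuousLinearMap.lsmul ℝ ℝ).precompL (Rd d)) volume :=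
    HasCompactSupport.convolutionExists_left _ (φ.hasCompactSupport_normed.fderiv ℝ)
      (hρs.continuous_fderiv (by simp)) hu x
  let ψ : Rd d → ℝ := fun y => ρ (x - y)
  have hψd : ∀ y, partialDeriv i ψ y = -(fderiv ℝ ρ (x - y) (EuclideanSpace.single i 1)) := by
    intro y
    have h1 : HasFDerivAt ρ (fderiv ℝ ρ (x - y)) (x - y) :=
      (hρs.differentiable (by simp) _).hasFDerivAt
    have h2 : HasFDerivAt ψ ((fderiv ℝ ρ (x - y)).comp (-(ContinuousLinearMap.id ℝ (Rd d)))) y :=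
      h1.comp y ((hasFDerivAt_id y).const_sub x)
    simp [partialDeriv, h2.fderiv]
  have hψ : IsTestFunction Ω ψ := by
    have hK : tsupport ψ ⊆ Metric.closedBall x φ.rOut := by
      refine closure_minimal ?_ Metric.isClosed_closedBall
      intro y hy
      have hy' : x - y ∈ Function.support ρ := hy
      rw [hρ, φ.support_normed_eq] at hy'
      rw [mem_ball_zero_iff] at hy'
      rw [Metric.mem_closedBall, dist_comm, dist_eq_norm]
      exact hy'.le
    refine ⟨hρs.comp (contDiff_const.sub contDiff_id), ?_, hK.trans hx⟩
    exact (isCompact_closedBall x φ.rOut).of_isClosed_subset (isClosed_tsupport ψ) hK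
  have key : ∀ (f : Rd d → ℝ) (w : Rd d → Cn n),
      ∫ t, f t • Ω.indicator w (x - t) = ∫ y in Ω, f (x - y) • w y := by
    intro f w
    rw [← integral_sub_left_eq_self _ volume x, ← integral_indicator hΩ.measurableSet]
    refine integral_congr_ae (Eventually.of_forall fun y => ?_)
    by_cases hy : y ∈ Ω <;> simp [hy]
  calc partialDeriv i (mollify φ (Ω.indicator u)) x
      = ((convolution (fderiv ℝ ρ) (Ω.indicator u)
          ((ContinuousLinearMap.lsmul ℝ ℝ).precompL (Rd d)) volume) x)
          (EuclideanSpace.single i 1) := by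
        rw [partialDeriv, mollify, hder.fderiv]
    _ = ∫ t, fderiv ℝ ρ t (EuclideanSpace.single i 1) • Ω.indicator u (x - t) := by
        rw [convolution, ContinuousLinearMap.integral_apply hex]
        simp [ContinuousLinearMap.precompL_apply]
    _ = ∫ y in Ω, fderiv ℝ ρ (x - y) (EuclideanSpace.single i 1) • u y :=
        key (fun t => fderiv ℝ ρ t (EuclideanSpace.single i 1)) u
    _ = -∫ y in Ω, partialDeriv i ψ y • u y := by
        rw [← integral_neg]; simp [hψd]
    _ = ∫ y in Ω, ψ y • g y := by rw [hg ψ hψ, neg_neg]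
    _ = mollify φ (Ω.indicator g) x := by rw [mollify_apply, key]

/-! ### Smooth approximation in the interior of a domain -/

namespace W12

variable {d n : ℕ} {Ω : Set (Rd d)}

theorem norm_nonneg (u : W12 Ω n) : 0 ≤ u.norm := Real.sqrt_nonneg _

theorem ofReal_norm_sq (u : W12 Ω n) :
    ENNReal.ofReal (u.norm ^ 2) =
      (∫⁻ x in Ω, ‖u.toFun x‖ₑ ^ 2) + ∑ i, ∫⁻ x in Ω, ‖u.grad i x‖ₑ ^ 2 := by
  have key : ∀ f : Rd d → Cn n, MemLp f 2 (volume.restrict Ω) →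
      ENNReal.ofReal (∫ x in Ω, ‖f x‖ ^ 2) = ∫⁻ x in Ω, ‖f x‖ₑ ^ 2 := by
    intro f hf
    rw [ofReal_integral_eq_lintegral_ofReal (hf.integrable_norm_pow (by norm_num))
      (Eventually.of_forall fun x => by positivity)]
    refine lintegral_congr fun x => ?_
    rw [ENNReal.ofReal_pow (_root_.norm_nonneg _), ofReal_norm]
  have h0 : ∀ f : Rd d → Cn n, 0 ≤ ∫ x in Ω, ‖f x‖ ^ 2 :=
    fun f => integral_nonneg fun x => by positivity
  rw [norm, Real.sq_sqrt (add_nonneg (h0 _) (Finset.sum_nonneg fun i _ => h0 _)),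
    ENNReal.ofReal_add (h0 _) (Finset.sum_nonneg fun i _ => h0 _),
    ENNReal.ofReal_sum_of_nonneg fun i _ => h0 _, key _ u.memLp_toFun]
  simp only [key _ (u.memLp_grad _)]

theorem lintegral_toFun_sq_le (u : W12 Ω n) :
    ∫⁻ x in Ω, ‖u.toFun x‖ₑ ^ 2 ≤ ENNReal.ofReal (u.norm ^ 2) := by
  rw [ofReal_norm_sq]; exact le_self_add

end W12

/-- The approximants mollify the extension by zero, which need not be a Sobolev function. Hence the
gradient bound is restricted to points whose distance from the complement exceeds the mollification
radius, and the convergence is only in `L²`; this suffices because the form involves no derivatives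
of its arguments. -/
theorem exists_smooth_approx {d n : ℕ} {Ω : Set (Rd d)} (hΩ : IsOpen Ω) (u : W12 Ω n)
    {r : ℝ} (hr : 0 < r) :
    ∃ w : ℕ → Rd d → Cn n, (∀ k, ContDiff ℝ ∞ (w k)) ∧
      (∀ k, ∫⁻ x in Ω, ‖w k x‖ₑ ^ 2 ≤ ENNReal.ofReal (u.norm ^ 2)) ∧
      (∀ (k : ℕ) (A : Set (Rd d)), MeasurableSet A → (∀ x ∈ A, Metric.closedBall x (r / (k + 1)) ⊆ Ω) →
        ∫⁻ x in A, (‖w k x‖ₑ ^ 2 + ‖fderiv ℝ (w k) x‖ₑ ^ 2) ≤ ENNReal.ofReal (u.norm ^ 2)) ∧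
      (∀ᵐ x ∂volume.restrict Ω, Tendsto (fun k => w k x) atTop (𝓝 (u.toFun x))) ∧
      Tendsto (fun k => ∫⁻ x in Ω, ‖w k x - u.toFun x‖ₑ ^ 2) atTop (𝓝 0) := by
  have hrk : ∀ k : ℕ, 0 < r / ((k : ℝ) + 1) := fun k => by positivity
  -- The ratio 2 of outer to inner radius is kept fixed, as the almost everywhere convergence of
  -- mollifications requires.
  let φ : ℕ → ContDiffBump (0 : Rd d) := fun k =>
    ⟨r / (k + 1) / 2, r / (k + 1), half_pos (hrk k), half_lt_self (hrk k)⟩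
  let U := Ω.indicator u.toFun
  have hU : MemLp U 2 := (memLp_indicator_iff_restrict hΩ.measurableSet).2 u.memLp_toFun
  have hG : ∀ i, MemLp (Ω.indicator (u.grad i)) 2 :=
    fun i => (memLp_indicator_iff_restrict hΩ.measurableSet).2 (u.memLp_grad i)
  have hUl : LocallyIntegrable U := hU.locallyIntegrable (by norm_num)
  have hind : ∀ f : Rd d → Cn n, ∫⁻ x, ‖Ω.indicator f x‖ₑ ^ 2 = ∫⁻ x in Ω, ‖f x‖ₑ ^ 2 := by
    intro f
    rw [← lintegral_indicator hΩ.measurableSet]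
    refine lintegral_congr fun x => ?_
    by_cases hx : x ∈ Ω <;> simp [hx]
  have hsm : ∀ k, ContDiff ℝ ∞ (mollify (φ k) U) := fun k => contDiff_mollify _ hUl
  have hae : ∀ᵐ x, Tendsto (fun k => mollify (φ k) U x) atTop (𝓝 (U x)) := by
    refine ContDiffBump.ae_convolution_tendsto_right_of_locallyIntegrable (K := 2) ?_ ?_ hUl
    · exact tendsto_const_nhds.div_atTop
        (tendsto_atTop_add_const_right _ 1 tendsto_natCast_atTop_atTop)
    · refine Eventually.of_forall fun k => ?_
      simp only [φ]; linarith
  have hL2 : ∀ k, ∫⁻ x, ‖mollify (φ k) U x‖ₑ ^ 2 ≤ ∫⁻ x in Ω, ‖u.toFun x‖ₑ ^ 2 := fun k =>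
    (lintegral_enorm_mollify_sq_le _ hU.1).trans_eq (hind _)
  refine ⟨fun k => mollify (φ k) U, hsm, fun k => ?_, fun k A hA hAΩ => ?_, ?_, ?_⟩
  · exact (setLIntegral_le_lintegral _ _).trans ((hL2 k).trans u.lintegral_toFun_sq_le)
  · have hfd : ∀ x ∈ A, ‖fderiv ℝ (mollify (φ k) U) x‖ₑ ^ 2 ≤
        ∑ i, ‖mollify (φ k) (Ω.indicator (u.grad i)) x‖ₑ ^ 2 := by
      intro x hx
      have h1 := ENNReal.ofReal_le_ofReal (norm_clm_sq_le_sum (fderiv ℝ (mollify (φ k) U) x))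
      rw [ENNReal.ofReal_sum_of_nonneg fun i _ => by positivity,
        ENNReal.ofReal_pow (norm_nonneg _), ofReal_norm] at h1
      refine h1.trans_eq (Finset.sum_congr rfl fun i _ => ?_)
      rw [ENNReal.ofReal_pow (norm_nonneg _), ofReal_norm]
      rw [← partialDeriv_mollify hΩ hUl (u.isWeakPartial i) (φ k) (hAΩ x hx)]
      rfl
    rw [lintegral_add_left ((hsm k).continuous.enorm.measurable.pow_const 2), u.ofReal_norm_sq]
    refine add_le_add ((setLIntegral_le_lintegral _ _).trans (hL2 k)) ?_
    calc ∫⁻ x in A, ‖fderiv ℝ (mollify (φ k) U) x‖ₑ ^ 2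
        ≤ ∫⁻ x in A, ∑ i, ‖mollify (φ k) (Ω.indicator (u.grad i)) x‖ₑ ^ 2 :=
          setLIntegral_mono' hA hfd
      _ ≤ ∫⁻ x, ∑ i, ‖mollify (φ k) (Ω.indicator (u.grad i)) x‖ₑ ^ 2 :=
          setLIntegral_le_lintegral _ _
      _ = ∑ i, ∫⁻ x, ‖mollify (φ k) (Ω.indicator (u.grad i)) x‖ₑ ^ 2 := by
          refine lintegral_finsetSum _ fun i _ => ?_
          exact (contDiff_mollify (φ k) ((hG i).locallyIntegrable
            (by norm_num))).continuous.enorm.measurable.pow_const 2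
      _ ≤ _ := Finset.sum_le_sum fun i _ =>
          (lintegral_enorm_mollify_sq_le _ (hG i).1).trans_eq (hind _)
  · filter_upwards [ae_restrict_of_ae hae, ae_restrict_mem hΩ.measurableSet] with x hx hxΩ
    simpa [U, hxΩ] using hx
  · have hfin : ∫⁻ x, ‖U x‖ₑ ^ 2 ≠ ⊤ := by
      rw [hind]
      exact ne_top_of_le_ne_top ENNReal.ofReal_ne_top u.lintegral_toFun_sq_le
    have := tendsto_lintegral_enorm_sub_sq (fun k => (hsm k).continuous.aestronglyMeasurable)
      hU.1 hfin (fun k => (hL2 k).trans_eq (hind _).symm) hae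
    refine tendsto_of_tendsto_of_tendsto_of_le_of_le tendsto_const_nhds this
      (fun k => zero_le) (fun k => ?_)
    refine le_trans (le_of_eq ?_) (setLIntegral_le_lintegral Ω _)
    refine setLIntegral_congr_fun hΩ.measurableSet fun x hx => ?_
    simp [U, hx]

/-! ### Geometry of the boundary layer -/

/-- The ball is connected, meets `Ω` at its centre and misses the frontier, so it cannot leave `Ω`.
-/
theorem closedBall_subset_of_lt_infDist {d : ℕ} {Ω : Set (Rd d)} (hΩ : IsOpen Ω) {x : Rd d}
    (hx : x ∈ Ω) {r : ℝ} (hr : 0 ≤ r) (h : ∀ p ∈ frontier Ω, r < dist x p) :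
    Metric.closedBall x r ⊆ Ω := by
  have hpre : IsPreconnected (Metric.closedBall x r) := (convex_closedBall x r).isPreconnected
  refine hpre.subset_left_of_subset_union hΩ isClosed_closure.isOpen_compl
    (disjoint_compl_right_iff_subset.2 subset_closure) ?_ ⟨x, Metric.mem_closedBall_self hr, hx⟩
  intro y hy
  by_contra hcon
  rw [mem_union, not_or, notMem_compl_iff] at hcon
  have hyf : y ∈ frontier Ω := by
    rw [hΩ.frontier_eq]; exact ⟨hcon.2, hcon.1⟩
  have := h y hyf
  rw [Metric.mem_closedBall, dist_comm] at hy
  linarith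

theorem exists_frontier_dist_le {d : ℕ} {Ω : Set (Rd d)} (hΩ : IsOpen Ω) {x : Rd d}
    (hx : x ∈ Ω) {r : ℝ} (hr : 0 ≤ r) (h : ¬ Metric.closedBall x r ⊆ Ω) :
    ∃ p ∈ frontier Ω, dist x p ≤ r := by
  by_contra! hcon
  exact h (closedBall_subset_of_lt_infDist hΩ hx hr hcon)

theorem norm_inwardNormal {d : ℕ} {Ω : Set (Rd d)} {ν : Rd d → Rd d}
    (hν : IsC2WithInwardNormal Ω ν) {p : Rd d} (hp : p ∈ frontier Ω) : ‖ν p‖ = 1 := by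
  obtain ⟨W, ψ, hψ, h⟩ := hν p hp
  rw [h, norm_smul, norm_inv, norm_norm, inv_mul_cancel₀ (norm_ne_zero_iff.2 hψ.gradient_ne_zero)]

/-- A vector in the half-space dual to a half-space is a multiple of its normal. -/
theorem eq_smul_of_halfspace_subset {E : Type*} [NormedAddCommGroup E] [InnerProductSpace ℝ E]
    {e g : E} (he : ‖e‖ = 1) (h : ∀ w, 0 < inner ℝ e w → 0 ≤ inner ℝ g w) :
    g = ‖g‖ • e := by
  have hee : inner ℝ e e = 1 := by rw [real_inner_self_eq_norm_sq, he]; norm_num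
  have hge : 0 ≤ inner ℝ g e := h e (by rw [hee]; norm_num)
  set c : ℝ := inner ℝ g e with hc
  have hgg : inner ℝ g g = ‖g‖ ^ 2 := real_inner_self_eq_norm_sq g
  -- The test vector `(c + δ) e - g` has inner product exactly `δ > 0` with `e`. Letting `δ` tend to
  -- 0 forces equality in Cauchy–Schwarz.
  have key : ∀ δ : ℝ, 0 < δ → ‖g‖ ^ 2 ≤ c ^ 2 + δ * c := by
    intro δ hδ
    have h1 := h ((c + δ) • e - g) (by
      rw [inner_sub_right, inner_smul_right, hee, real_inner_comm, ← hc]; linarith)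
    rw [inner_sub_right, inner_smul_right, ← hc, hgg] at h1
    nlinarith
  have hle : ‖g‖ ^ 2 ≤ c ^ 2 := by
    refine le_of_forall_pos_le_add fun δ hδ => ?_
    refine (key (δ / (c + 1)) (by positivity)).trans ?_
    have : δ / (c + 1) * c ≤ δ := by
      rw [div_mul_eq_mul_div, div_le_iff₀ (by positivity)]; nlinarith
    linarith
  have hcs : c ≤ ‖g‖ := by
    have := real_inner_le_norm g e
    rwa [he, mul_one] at this
  have hcg : c = ‖g‖ := le_antisymm hcs ((sq_le_sq₀ (norm_nonneg g) hge).1 hle)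
  have h0 : ‖g - ‖g‖ • e‖ ^ 2 = 0 := by
    rw [norm_sub_sq_real, inner_smul_right, ← hc, hcg, norm_smul, he, norm_norm]; ring
  exact sub_eq_zero.1 (norm_eq_zero.1 (pow_eq_zero_iff two_ne_zero |>.1 h0))

/-- The ball touches the boundary from inside at `p`. Each direction `w` making an acute angle with
`e = (x - p)/|x - p|` enters the ball, so `ψ > 0` for a short while along it; as `ψ p ≤ 0`, the
derivative of `ψ` along `w` is nonnegative. The gradient is thus nonnegative on an open half-space
and must be a multiple of its normal `e`. -/
theorem inwardNormal_eq_of_ball_subset {d : ℕ} {Ω : Set (Rd d)} (hΩ : IsOpen Ω)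
    {ν : Rd d → Rd d} (hν : IsC2WithInwardNormal Ω ν) {p x : Rd d} (hp : p ∈ frontier Ω)
    (hpx : x ≠ p) (hball : Metric.ball x (dist x p) ⊆ Ω) :
    x = p + dist x p • ν p := by
  obtain ⟨W, ψ, hψ, hνp⟩ := hν p hp
  set t := dist x p with ht
  have ht0 : 0 < t := dist_pos.2 hpx
  set g := gradient ψ p with hg
  have hdiff : DifferentiableAt ℝ ψ p :=
    (hψ.contDiffOn.contDiffAt (hψ.isOpen.mem_nhds hψ.mem)).differentiableAt (by simp)
  have hder : ∀ w : Rd d, HasDerivAt (fun s : ℝ => ψ (p + s • w)) (inner ℝ g w) 0 := by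
    intro w
    have h1 : HasFDerivAt ψ (InnerProductSpace.toDual ℝ (Rd d) g) (p + (0 : ℝ) • w) := by
      have h0 := hasGradientAt_iff_hasFDerivAt.1 hdiff.hasGradientAt
      rwa [zero_smul, add_zero]
    have h2 : HasDerivAt (fun s : ℝ => p + s • w) w 0 := by
      simpa using ((hasDerivAt_id (0 : ℝ)).smul_const w).const_add p
    exact h1.comp_hasDerivAt (0 : ℝ) h2
  have hψp : ψ p ≤ 0 := by
    by_contra! hcon
    have : p ∈ Ω ∩ W := by rw [hψ.inter_eq]; exact ⟨hψ.mem, hcon⟩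
    rw [hΩ.frontier_eq] at hp
    exact hp.2 this.1
  let e : Rd d := t⁻¹ • (x - p)
  have he : ‖e‖ = 1 := by
    rw [norm_smul, norm_inv, ← dist_eq_norm, ← ht, Real.norm_of_nonneg ht0.le,
      inv_mul_cancel₀ ht0.ne']
  have hxp : x - p = t • e := by simp [e, smul_smul, ht0.ne']
  have hhalf : ∀ w, 0 < inner ℝ e w → 0 ≤ inner ℝ g w := by
    intro w hw
    have hev : ∀ᶠ s : ℝ in 𝓝[>] 0, 0 < ψ (p + s • w) := by
      have hc : Tendsto (fun s : ℝ => p + s • w) (𝓝[>] 0) (𝓝 p) := by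
        have : Continuous fun s : ℝ => p + s • w := by fun_prop
        simpa using (this.tendsto 0).mono_left nhdsWithin_le_nhds
      have hW : ∀ᶠ s : ℝ in 𝓝[>] 0, p + s • w ∈ W := hc (hψ.isOpen.mem_nhds hψ.mem)
      -- This is the expanded form of `|t e - s w|² < t²`, divided by `s`.
      have hs : ∀ᶠ s : ℝ in 𝓝[>] 0, s * ‖w‖ ^ 2 < 2 * t * inner ℝ e w := by
        have h3 : Tendsto (fun s : ℝ => s * ‖w‖ ^ 2) (𝓝[>] 0) (𝓝 0) := by
          have : Continuous fun s : ℝ => s * ‖w‖ ^ 2 := by fun_prop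
          simpa using (this.tendsto 0).mono_left nhdsWithin_le_nhds
        exact h3.eventually_lt_const (by positivity)
      filter_upwards [hW, hs, self_mem_nhdsWithin] with s h1 h2 h3
      have hs0 : 0 < s := h3
      have hin : p + s • w ∈ Metric.ball x t := by
        rw [Metric.mem_ball, dist_comm, dist_eq_norm]
        have : x - (p + s • w) = t • e - s • w := by rw [← hxp]; abel
        rw [this]
        refine lt_of_pow_lt_pow_left₀ 2 ht0.le ?_
        rw [norm_sub_sq_real, norm_smul t e, norm_smul s w, he, inner_smul_left, inner_smul_right,
          Real.norm_of_nonneg ht0.le, Real.norm_of_nonneg hs0.le]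
        simp only [conj_trivial]
        nlinarith
      have : p + s • w ∈ Ω ∩ W := ⟨hball hin, h1⟩
      rw [hψ.inter_eq] at this
      exact this.2
    have hslope := (hder w).tendsto_slope.mono_left
      (nhdsWithin_mono 0 (fun s (hs : s ∈ Ioi (0 : ℝ)) => ne_of_gt hs))
    refine ge_of_tendsto hslope ?_
    filter_upwards [hev, self_mem_nhdsWithin] with s h1 h2
    have hs0 : (0 : ℝ) < s := h2
    rw [slope_def_field]
    apply div_nonneg <;> simp
    · linarith
    · exact hs0.le
  have hge := eq_smul_of_halfspace_subset he hhalf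
  have hνe : ν p = e := by
    rw [hνp]
    nth_rewrite 2 [hge]
    rw [smul_smul, inv_mul_cancel₀ (norm_ne_zero_iff.2 hψ.gradient_ne_zero), one_smul]
  rw [hνe, ← hxp]; abel

/-- The points at distance `t ∈ (δ, τ]` from the boundary along the inward normal. -/
def collar {d : ℕ} (Ω : Set (Rd d)) (ν : Rd d → Rd d) (δ τ : ℝ) : Set (Rd d) :=
  (fun q : Rd d × ℝ => q.1 + q.2 • ν q.1) '' (frontier Ω ×ˢ Ioc δ τ)

/-- The nearest boundary point `p` serves: the open ball about `x` of radius `dist x p` lies in `Ω`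
and touches the boundary at `p`. -/
theorem mem_collar_of_mem_boundaryLayer {d : ℕ} {Ω : Set (Rd d)} (hΩ : IsOpen Ω)
    {ν : Rd d → Rd d} (hν : IsC2WithInwardNormal Ω ν) {x q : Rd d} (hx : x ∈ Ω)
    (hq : q ∈ frontier Ω) :
    ∃ p ∈ frontier Ω, 0 < dist x p ∧ dist x p ≤ dist x q ∧ (∀ q' ∈ frontier Ω, dist x p ≤ dist x q')
      ∧ x = p + dist x p • ν p := by
  obtain ⟨p, hp, hpd⟩ := isClosed_frontier.exists_infDist_eq_dist ⟨q, hq⟩ x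
  have hmin : ∀ q' ∈ frontier Ω, dist x p ≤ dist x q' := fun q' hq' => by
    rw [← hpd]; exact Metric.infDist_le_dist_of_mem hq'
  have hne : x ≠ p := by
    rintro rfl
    rw [hΩ.frontier_eq] at hp
    exact hp.2 hx
  refine ⟨p, hp, dist_pos.2 hne, hmin q hq, hmin, inwardNormal_eq_of_ball_subset hΩ hν hp hne ?_⟩
  intro y hy
  rw [Metric.mem_ball, dist_comm] at hy
  exact closedBall_subset_of_lt_infDist hΩ hx dist_nonneg
    (fun q' hq' => hy.trans_le (hmin q' hq')) (by rw [Metric.mem_closedBall, dist_comm])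

/-- The nearest boundary point yields a second normal representation of the same point, with the
distance to the boundary as its parameter. Injectivity of the normal map identifies the two, so `t`
is that distance. -/
theorem le_dist_of_normal {d : ℕ} {Ω : Set (Rd d)} (hΩ : IsOpen Ω)
    {ν : Rd d → Rd d} (hν : IsC2WithInwardNormal Ω ν) {T : ℝ}
    (hbij : BijOn (fun q : Rd d × ℝ => q.1 + q.2 • ν q.1) (frontier Ω ×ˢ Ioc 0 T)
      (boundaryLayer Ω T)) {p : Rd d} (hp : p ∈ frontier Ω) {t : ℝ} (ht : t ∈ Ioc 0 T)
    {q : Rd d} (hq : q ∈ frontier Ω) : t ≤ dist (p + t • ν p) q := by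
  have hx : p + t • ν p ∈ boundaryLayer Ω T := hbij.mapsTo (x := (p, t)) ⟨hp, ht⟩
  obtain ⟨p', hp', h0, -, hmin, heq⟩ := mem_collar_of_mem_boundaryLayer hΩ hν hx.1 hq
  have hle : dist (p + t • ν p) p' ≤ T := by
    refine (hmin p hp).trans ?_
    rw [dist_eq_norm, add_sub_cancel_left, norm_smul, norm_inwardNormal hν hp, mul_one,
      Real.norm_of_nonneg ht.1.le]
    exact ht.2
  have hinj := hbij.injOn (x₁ := (p, t)) (x₂ := (p', dist (p + t • ν p) p')) ⟨hp, ht⟩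
    ⟨hp', h0, hle⟩ heq
  have h2 : t = dist (p + t • ν p) p' := congrArg Prod.snd hinj
  exact h2.le.trans (hmin q hq)

theorem closedBall_subset_of_mem_collar {d : ℕ} {Ω : Set (Rd d)} (hΩ : IsOpen Ω)
    {ν : Rd d → Rd d} (hν : IsC2WithInwardNormal Ω ν) {T : ℝ}
    (hbij : BijOn (fun q : Rd d × ℝ => q.1 + q.2 • ν q.1) (frontier Ω ×ˢ Ioc 0 T)
      (boundaryLayer Ω T)) {δ : ℝ} (hδ : 0 ≤ δ) {x : Rd d} (hx : x ∈ collar Ω ν δ T) :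
    Metric.closedBall x δ ⊆ Ω := by
  obtain ⟨⟨p, t⟩, ⟨hp, ht⟩, rfl⟩ := hx
  have ht' : t ∈ Ioc 0 T := ⟨hδ.trans_lt ht.1, ht.2⟩
  exact closedBall_subset_of_lt_infDist hΩ (hbij.mapsTo (x := (p, t)) ⟨hp, ht'⟩).1 hδ
    fun q hq => ht.1.trans_le (le_dist_of_normal hΩ hν hbij hp ht' hq)

/-! ### The trace inequality along normals -/

/-- One has `g t ≤ g s + ∫ |g'|` for all `s`, `t`. Averaging over `s` in `(T/2, T]` bounds `g t`
uniformly, and integrating over `t` gains the factor `τ`. The averaging interval has length `T/2`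
whatever `δ` is, so the constant survives the limit `δ → 0`. -/
theorem lintegral_Ioc_le_of_contDiff {g : ℝ → ℝ} (hg : ContDiff ℝ 1 g)
    {δ τ T : ℝ} (hδ : 0 < δ) (hδT : δ ≤ T / 2) (hτ : 0 ≤ τ) (hτT : τ ≤ T) :
    ∫⁻ t in Ioc δ τ, ENNReal.ofReal (g t) ≤ ENNReal.ofReal (τ * (2 / T + 1)) *
      ∫⁻ t in Ioc δ T, (ENNReal.ofReal (g t) + ‖deriv g t‖ₑ) := by
  have hT : 0 < T := by linarith
  have hgm : Measurable fun t => ENNReal.ofReal (g t) := hg.continuous.measurable.ennreal_ofReal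
  set A := ∫⁻ t in Ioc δ T, ENNReal.ofReal (g t) with hA
  set B := ∫⁻ t in Ioc δ T, ‖deriv g t‖ₑ with hB
  have h1 : ∀ t ∈ Ioc δ T, ∀ s ∈ Ioc δ T, ENNReal.ofReal (g t) ≤ ENNReal.ofReal (g s) + B := by
    intro t ht s hs
    have hint : ∫ r in s..t, deriv g r = g t - g s :=
      intervalIntegral.integral_deriv_eq_sub (fun r _ => hg.differentiable (by simp) r)
        ((hg.continuous_deriv (by simp)).intervalIntegrable _ _)
    have h2 : ‖g t - g s‖ₑ ≤ B := by
      rw [← hint, ← ofReal_norm, intervalIntegral.norm_intervalIntegral_eq, ofReal_norm]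
      refine (enorm_integral_le_lintegral_enorm _).trans (lintegral_mono_set ?_)
      intro r hr
      rw [uIoc, mem_Ioc] at hr
      exact ⟨(le_inf hs.1.le ht.1.le).trans_lt hr.1, hr.2.trans (sup_le hs.2 ht.2)⟩
    calc ENNReal.ofReal (g t) ≤ ENNReal.ofReal (g s + |g t - g s|) :=
          ENNReal.ofReal_le_ofReal (by linarith [le_abs_self (g t - g s)])
      _ ≤ ENNReal.ofReal (g s) + ENNReal.ofReal |g t - g s| := ENNReal.ofReal_add_le
      _ ≤ _ := by
          gcongr
          rwa [← Real.norm_eq_abs, ofReal_norm]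
  have h2 : ∀ t ∈ Ioc δ T, ENNReal.ofReal (g t) ≤ ENNReal.ofReal (2 / T + 1) * (A + B) := by
    intro t ht
    have hsub : Ioc (T / 2) T ⊆ Ioc δ T := Ioc_subset_Ioc_left hδT
    have hvol : volume (Ioc (T / 2) T) = ENNReal.ofReal (T / 2) := by
      rw [Real.volume_Ioc]; congr 1; ring
    have h3 : ENNReal.ofReal (T / 2) * ENNReal.ofReal (g t) ≤ A + ENNReal.ofReal (T / 2) * B := by
      calc ENNReal.ofReal (T / 2) * ENNReal.ofReal (g t)
          = ∫⁻ _ in Ioc (T / 2) T, ENNReal.ofReal (g t) := by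
            rw [setLIntegral_const, hvol, mul_comm]
        _ ≤ ∫⁻ s in Ioc (T / 2) T, (ENNReal.ofReal (g s) + B) :=
            setLIntegral_mono' measurableSet_Ioc fun s hs => h1 t ht s (hsub hs)
        _ = (∫⁻ s in Ioc (T / 2) T, ENNReal.ofReal (g s)) + ENNReal.ofReal (T / 2) * B := by
            rw [lintegral_add_left hgm, setLIntegral_const, hvol, mul_comm B]
        _ ≤ _ := add_le_add (lintegral_mono_set hsub) le_rfl
    have h4 : ENNReal.ofReal (2 / T) * ENNReal.ofReal (T / 2) = 1 := by
      rw [← ENNReal.ofReal_mul (by positivity), ← ENNReal.ofReal_one]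
      congr 1; field_simp
    calc ENNReal.ofReal (g t)
        = ENNReal.ofReal (2 / T) * (ENNReal.ofReal (T / 2) * ENNReal.ofReal (g t)) := by
          rw [← mul_assoc, h4, one_mul]
      _ ≤ ENNReal.ofReal (2 / T) * (A + ENNReal.ofReal (T / 2) * B) := by gcongr
      _ = ENNReal.ofReal (2 / T) * A + B := by rw [mul_add, ← mul_assoc, h4, one_mul]
      _ ≤ ENNReal.ofReal (2 / T) * (A + B) + 1 * (A + B) := by
          rw [one_mul]
          gcongr
          · exact le_self_add
          · exact le_add_self
      _ = _ := by
          rw [ENNReal.ofReal_add (by positivity) (by norm_num), add_mul, ENNReal.ofReal_one]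
  calc ∫⁻ t in Ioc δ τ, ENNReal.ofReal (g t)
      ≤ ∫⁻ t in Ioc δ τ, ENNReal.ofReal (2 / T + 1) * (A + B) :=
        setLIntegral_mono' measurableSet_Ioc fun t ht => h2 t ⟨ht.1, ht.2.trans hτT⟩
    _ = ENNReal.ofReal (2 / T + 1) * (A + B) * ENNReal.ofReal (τ - δ) := by
        rw [setLIntegral_const, Real.volume_Ioc]
    _ ≤ ENNReal.ofReal (2 / T + 1) * (A + B) * ENNReal.ofReal τ := by
        gcongr; linarith
    _ = _ := by
        rw [lintegral_add_left hgm, ENNReal.ofReal_mul hτ, hA, hB]; ring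

/-! ### Splitting off the normal coordinate. -/

section Splitting

variable {d : ℕ} [NeZero d]

/-- The point `(τ, s)` of `ℝ^d`. -/
noncomputable def consCoord (s : LocalVar d) (t : ℝ) : Rd d :=
  WithLp.toLp 2 fun i => if h : i = 0 then t else s ⟨i, h⟩

@[simp] theorem consCoord_zero (s : LocalVar d) (t : ℝ) : consCoord s t 0 = t := by
  simp [consCoord]

@[simp] theorem localVar_consCoord (s : LocalVar d) (t : ℝ) :
    localVar (consCoord s t) = s := by
  ext i
  simp [localVar, consCoord, i.2]

@[simp] theorem consCoord_localVar (y : Rd d) : consCoord (localVar y) (y 0) = y := by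
  ext i
  by_cases h : i = 0
  · subst h; simp
  · simp [localVar, consCoord, h]

theorem continuous_localVar : Continuous (localVar : Rd d → LocalVar d) := by
  unfold localVar
  fun_prop

theorem continuous_consCoord :
    Continuous fun z : LocalVar d × ℝ => (consCoord z.1 z.2 : Rd d) := by
  unfold consCoord
  refine (PiLp.continuous_toLp 2 _).comp (continuous_pi fun i => ?_)
  by_cases h : i = 0
  · simpa [h] using continuous_snd
  · simp only [h, dite_false]
    fun_prop

/-- The splitting of `ℝ^d` into the first coordinate and the other ones. -/
noncomputable def splitCoord (d : ℕ) [NeZero d] : Rd d ≃ᵐ LocalVar d × ℝ where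
  toFun y := (localVar y, y 0)
  invFun z := consCoord z.1 z.2
  left_inv y := by simp
  right_inv z := by simp
  measurable_toFun := by
    have h : Continuous fun y : Rd d => (localVar y, y 0) :=
      continuous_localVar.prodMk (by fun_prop)
    exact h.measurable
  measurable_invFun := continuous_consCoord.measurable

theorem measurePreserving_splitCoord : MeasurePreserving (splitCoord d) := by
  have h1 : MeasurePreserving (WithLp.ofLp : Rd d → (Fin d → ℝ)) := PiLp.volume_preserving_ofLp _
  have h2 := volume_preserving_piEquivPiSubtypeProd (fun _ : Fin d => ℝ) (fun i => i = 0)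
  have h3 : MeasurePreserving (MeasurableEquiv.funUnique {i : Fin d // i = 0} ℝ) :=
    volume_preserving_funUnique _ _
  have h4 : MeasurePreserving (WithLp.toLp 2 : ({i : Fin d // ¬ i = 0} → ℝ) → LocalVar d) :=
    PiLp.volume_preserving_toLp _
  have h6 : MeasurePreserving (Prod.map (MeasurableEquiv.funUnique {i : Fin d // i = 0} ℝ)
      (WithLp.toLp 2 : ({i : Fin d // ¬ i = 0} → ℝ) → LocalVar d)) volume volume := h3.prod h4
  have h7 : MeasurePreserving (Prod.swap : ℝ × LocalVar d → LocalVar d × ℝ) volume volume :=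
    Measure.measurePreserving_swap
  have h8 : MeasurePreserving ((MeasurableEquiv.piEquivPiSubtypeProd (fun _ : Fin d => ℝ)
      fun i => i = 0) ∘ (WithLp.ofLp : Rd d → (Fin d → ℝ))) volume volume := by
    convert h2.comp h1 <;> rfl
  have h5 := (h7.comp h6).comp h8
  exact h5

/-- Measurability is required only over `E ×ˢ I`, since a boundary chart is controlled only over its
own domain. -/
theorem setLIntegral_splitCoord {E : Set (LocalVar d)} {I : Set ℝ}
    {f : Rd d → ℝ≥0∞} (hf : AEMeasurable (fun z : LocalVar d × ℝ => f (consCoord z.1 z.2))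
      (volume.restrict (E ×ˢ I))) :
    ∫⁻ y in {y | localVar y ∈ E ∧ y 0 ∈ I}, f y =
      ∫⁻ s in E, ∫⁻ t in I, f (consCoord s t) := by
  have h := measurePreserving_splitCoord (d := d).setLIntegral_comp_preimage_emb
    (splitCoord d).measurableEmbedding (fun z => f (consCoord z.1 z.2)) (E ×ˢ I)
  have h2 : ∀ y : Rd d, f (consCoord (splitCoord d y).1 (splitCoord d y).2) = f y := fun y => by
    simp [splitCoord]
  simp only [h2] at h
  have h3 : (splitCoord d) ⁻¹' (E ×ˢ I) = {y | localVar y ∈ E ∧ y 0 ∈ I} := rfl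
  rw [h3] at h
  rw [h]
  rw [Measure.volume_eq_prod, ← Measure.prod_restrict] at *
  rw [lintegral_prod _ hf]

end Splitting

/-! ### Integral estimates in the collar of the boundary. -/

section BoundaryLayer

variable {d : ℕ} [NeZero d] {Ω : Set (Rd d)} {ν : Rd d → Rd d} {T M : ℝ}

@[simp] theorem normalCoord_consCoord (ν : Rd d → Rd d) (σ : LocalVar d → Rd d) (s : LocalVar d)
    (t : ℝ) : normalCoord ν σ (consCoord s t) = σ s + t • ν (σ s) := by
  simp [normalCoord]

/-- The part of the collar over the boundary points in `A`, in a boundary chart. -/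
def chartCollar (ν : Rd d → Rd d) (U : Set (LocalVar d)) (σ : LocalVar d → Rd d)
    (A : Set (Rd d)) (I : Set ℝ) : Set (Rd d) :=
  normalCoord ν σ '' {y | localVar y ∈ {s | s ∈ U ∧ σ s ∈ A} ∧ y 0 ∈ I}

theorem mem_chartCollar {U : Set (LocalVar d)} {σ : LocalVar d → Rd d}
    {A : Set (Rd d)} {I : Set ℝ} {x : Rd d} :
    x ∈ chartCollar ν U σ A I ↔ ∃ q ∈ σ '' U ∩ A, ∃ t ∈ I, x = q + t • ν q := by
  constructor
  · rintro ⟨y, ⟨⟨hU, hA⟩, hI⟩, rfl⟩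
    exact ⟨σ (localVar y), ⟨⟨_, hU, rfl⟩, hA⟩, y 0, hI, rfl⟩
  · rintro ⟨_, ⟨⟨s, hs, rfl⟩, hA⟩, t, ht, rfl⟩
    exact ⟨consCoord s t, ⟨by simpa using ⟨hs, hA⟩, by simpa using ht⟩, by simp⟩

/-- In the coordinates `(τ, s)` the claim is the one-dimensional inequality on each normal line,
integrated over `s`. The derivative along the line is at most the full gradient because `ν` is a
unit vector. One factor `M` comes from the upper Jacobian bound on the left, the other from the
lower bound on the right. -/
theorem IsBoundaryChart.chartCollar_estimate {p : Rd d} {U : Set (LocalVar d)}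
    {σ : LocalVar d → Rd d} (h : IsBoundaryChart Ω ν T M p U σ)
    (hν : ∀ q ∈ frontier Ω, ‖ν q‖ = 1)
    (hinj : InjOn (fun q : Rd d × ℝ => q.1 + q.2 • ν q.1) (frontier Ω ×ˢ Ioc 0 T))
    {A : Set (Rd d)} (hA : MeasurableSet A) (hM : 0 < M) {F : Rd d → ℝ} (hF : ContDiff ℝ 1 F)
    {δ τ : ℝ} (hδ : 0 < δ) (hδT : δ ≤ T / 2) (hτ : 0 ≤ τ) (hτT : τ ≤ T) :
    MeasurableSet (chartCollar ν U σ A (Ioc δ τ)) ∧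
    MeasurableSet (chartCollar ν U σ A (Ioc δ T)) ∧
    ∫⁻ x in chartCollar ν U σ A (Ioc δ τ), ENNReal.ofReal (F x) ≤
      ENNReal.ofReal (M * M * (τ * (2 / T + 1))) *
        ∫⁻ x in chartCollar ν U σ A (Ioc δ T), (ENNReal.ofReal (F x) + ‖fderiv ℝ F x‖ₑ) := by
  set E : Set (LocalVar d) := {s | s ∈ U ∧ σ s ∈ A} with hE
  have hEm : MeasurableSet E := by
    -- As `σ` is continuous only on `U`, measurability is obtained in the subtype `U` and then
    -- carried back.
    have h1 : MeasurableSet ((U.domRestrict σ) ⁻¹' A) :=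
      (continuousOn_iff_continuous_domRestrict.1 h.contDiffOn.continuousOn).measurable hA
    have h2 := MeasurableSet.subtype_image h.isOpen.measurableSet h1
    convert h2 using 1
    ext s
    simp [hE, and_comm]
  let D : Set ℝ → Set (Rd d) := fun I => {y | localVar y ∈ E ∧ y 0 ∈ I}
  have hDm : ∀ I, MeasurableSet I → MeasurableSet (D I) := fun I hI =>
    (continuous_localVar.measurable hEm).inter
      ((by fun_prop : Continuous fun y : Rd d => y 0).measurable hI)
  have hOpen : IsOpen {y : Rd d | localVar y ∈ U} := h.isOpen.preimage continuous_localVar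
  have hdiff : ∀ y : Rd d, localVar y ∈ U →
      HasFDerivAt (normalCoord ν σ) (fderiv ℝ (normalCoord ν σ) y) y := fun y hy =>
    ((h.contDiffOn_normalCoord.contDiffAt (hOpen.mem_nhds hy)).differentiableAt
      (by simp)).hasFDerivAt
  have hinjD : InjOn (normalCoord ν σ) (D (Ioc 0 T)) := by
    intro y hy z hz hyz
    have h1 := hinj (x₁ := (σ (localVar y), y 0)) (x₂ := (σ (localVar z), z 0))
      ⟨h.image_subset ⟨_, hy.1.1, rfl⟩, hy.2⟩ ⟨h.image_subset ⟨_, hz.1.1, rfl⟩, hz.2⟩ hyz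
    rw [Prod.mk.injEq] at h1
    rw [← consCoord_localVar y, ← consCoord_localVar z, h.injOn hy.1.1 hz.1.1 h1.1, h1.2]
  have hsub : ∀ {r}, r ≤ T → D (Ioc δ r) ⊆ D (Ioc 0 T) := fun hr y hy =>
    ⟨hy.1, Ioc_subset_Ioc hδ.le hr hy.2⟩
  have hchange : ∀ {r} (_ : r ≤ T) (g : Rd d → ℝ≥0∞),
      ∫⁻ x in chartCollar ν U σ A (Ioc δ r), g x = ∫⁻ y in D (Ioc δ r),
        ENNReal.ofReal |(fderiv ℝ (normalCoord ν σ) y).det| * g (normalCoord ν σ y) :=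
    fun hr g => lintegral_image_eq_lintegral_abs_det_fderiv_mul volume (hDm _ measurableSet_Ioc)
      (fun y hy => (hdiff y hy.1.1).hasFDerivWithinAt) (hinjD.mono (hsub hr)) g
  have hcont : ContinuousOn (fun z : LocalVar d × ℝ => σ z.1 + z.2 • ν (σ z.1)) (U ×ˢ univ) := by
    have h1 : ContinuousOn (fun z : LocalVar d × ℝ => normalCoord ν σ (consCoord z.1 z.2))
        (U ×ˢ univ) :=
      h.contDiffOn_normalCoord.continuousOn.comp continuous_consCoord.continuousOn
        fun z hz => by simpa using hz.1
    simpa using h1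
  have hmeas : ∀ {g : Rd d → ℝ≥0∞}, Measurable g → ∀ I, MeasurableSet I →
      AEMeasurable (fun z : LocalVar d × ℝ => g (normalCoord ν σ (consCoord z.1 z.2)))
      (volume.restrict (E ×ˢ I)) := by
    intro g hg I hI
    simp only [normalCoord_consCoord]
    exact hg.comp_aemeasurable
      ((hcont.mono (prod_mono (fun s hs => hs.1) (subset_univ I))).aemeasurable (hEm.prod hI))
  have hFm : Measurable fun x => ENNReal.ofReal (F x) := hF.continuous.measurable.ennreal_ofReal
  have hHm : Measurable fun x => ENNReal.ofReal (F x) + ‖fderiv ℝ F x‖ₑ :=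
    hFm.add (hF.continuous_fderiv (by simp)).enorm.measurable
  have himg : ∀ {r}, r ≤ T → MeasurableSet (chartCollar ν U σ A (Ioc δ r)) := fun hr =>
    measurable_image_of_fderivWithin (hDm _ measurableSet_Ioc)
      (fun y hy => (hdiff y hy.1.1).hasFDerivWithinAt) (hinjD.mono (hsub hr))
  refine ⟨himg hτT, himg le_rfl, ?_⟩
  have hline : ∀ s ∈ E, ∫⁻ t in Ioc δ τ, ENNReal.ofReal (F (normalCoord ν σ (consCoord s t))) ≤
      ENNReal.ofReal (τ * (2 / T + 1)) *
        ∫⁻ t in Ioc δ T, (ENNReal.ofReal (F (normalCoord ν σ (consCoord s t))) +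
          ‖fderiv ℝ F (normalCoord ν σ (consCoord s t))‖ₑ) := by
    intro s hs
    simp only [normalCoord_consCoord]
    set q := σ s
    have hline : ContDiff ℝ 1 fun t : ℝ => q + t • ν q := by fun_prop
    refine (lintegral_Ioc_le_of_contDiff (hF.comp hline) hδ hδT hτ hτT).trans ?_
    gcongr with t
    · simp
    · have h1 : HasDerivAt (fun t : ℝ => q + t • ν q) (ν q) t := by
        simpa using ((hasDerivAt_id t).smul_const (ν q)).const_add q
      have h2 : HasFDerivAt F (fderiv ℝ F (q + t • ν q)) (q + t • ν q) :=
        (hF.differentiable (by simp) _).hasFDerivAt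
      rw [(h2.comp_hasDerivAt t h1).deriv, ← ofReal_norm, ← ofReal_norm]
      refine ENNReal.ofReal_le_ofReal ((ContinuousLinearMap.le_opNorm _ _).trans_eq ?_)
      rw [hν q (h.image_subset ⟨s, hs.1, rfl⟩), mul_one]
  calc ∫⁻ x in chartCollar ν U σ A (Ioc δ τ), ENNReal.ofReal (F x)
      = ∫⁻ y in D (Ioc δ τ), ENNReal.ofReal |(fderiv ℝ (normalCoord ν σ) y).det| *
          ENNReal.ofReal (F (normalCoord ν σ y)) := hchange hτT _
    _ ≤ ∫⁻ y in D (Ioc δ τ), ENNReal.ofReal M * ENNReal.ofReal (F (normalCoord ν σ y)) := by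
        refine setLIntegral_mono' (hDm _ measurableSet_Ioc) fun y hy => ?_
        gcongr
        exact h.abs_det_le y hy.1.1 (hsub hτT hy).2
    _ = ENNReal.ofReal M * ∫⁻ s in E, ∫⁻ t in Ioc δ τ,
          ENNReal.ofReal (F (normalCoord ν σ (consCoord s t))) := by
        rw [lintegral_const_mul' _ _ ENNReal.ofReal_ne_top,
          ← setLIntegral_splitCoord (f := fun y => ENNReal.ofReal (F (normalCoord ν σ y)))
            (hmeas hFm _ measurableSet_Ioc)]
    _ ≤ ENNReal.ofReal M * ∫⁻ s in E, ENNReal.ofReal (τ * (2 / T + 1)) *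
        ∫⁻ t in Ioc δ T, (ENNReal.ofReal (F (normalCoord ν σ (consCoord s t))) +
          ‖fderiv ℝ F (normalCoord ν σ (consCoord s t))‖ₑ) := by
        gcongr ENNReal.ofReal M * ?_
        exact setLIntegral_mono' hEm hline
    _ = ENNReal.ofReal M * (ENNReal.ofReal (τ * (2 / T + 1)) *
        ∫⁻ y in D (Ioc δ T), (ENNReal.ofReal (F (normalCoord ν σ y)) +
          ‖fderiv ℝ F (normalCoord ν σ y)‖ₑ)) := by
        rw [lintegral_const_mul' _ _ ENNReal.ofReal_ne_top,
          ← setLIntegral_splitCoord (f := fun y => ENNReal.ofReal (F (normalCoord ν σ y)) +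
          ‖fderiv ℝ F (normalCoord ν σ y)‖ₑ) (hmeas hHm _ measurableSet_Ioc)]
    _ ≤ ENNReal.ofReal M * (ENNReal.ofReal (τ * (2 / T + 1)) *
        ∫⁻ y in D (Ioc δ T), ENNReal.ofReal M *
          (ENNReal.ofReal |(fderiv ℝ (normalCoord ν σ) y).det| *
            (ENNReal.ofReal (F (normalCoord ν σ y)) +
              ‖fderiv ℝ F (normalCoord ν σ y)‖ₑ))) := by
        gcongr ENNReal.ofReal M * (ENNReal.ofReal (τ * (2 / T + 1)) * ?_)
        refine setLIntegral_mono' (hDm _ measurableSet_Ioc) fun y hy => ?_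
        rw [← mul_assoc, ← ENNReal.ofReal_mul hM.le]
        refine le_mul_of_one_le_left' ?_
        rw [← ENNReal.ofReal_one]
        refine ENNReal.ofReal_le_ofReal ?_
        calc 1 = M * M⁻¹ := (mul_inv_cancel₀ hM.ne').symm
          _ ≤ _ := mul_le_mul_of_nonneg_left (h.le_abs_det y hy.1.1 (hsub le_rfl hy).2) hM.le
    _ = _ := by
        have h2T : 0 ≤ τ * (2 / T + 1) := by
          have : 0 ≤ T := hτ.trans hτT
          positivity
        rw [lintegral_const_mul' _ _ ENNReal.ofReal_ne_top, hchange le_rfl,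
          ENNReal.ofReal_mul (p := M * M) (by positivity), ENNReal.ofReal_mul hM.le]
        ring

/-- Countably many charts cover the boundary. Making their traces on it disjoint makes the
corresponding pieces of the collar disjoint, by injectivity of the normal map; the chart estimates
then add up with no overlap constant. -/
theorem collar_estimate (hν : ∀ q ∈ frontier Ω, ‖ν q‖ = 1)
    (hinj : InjOn (fun q : Rd d × ℝ => q.1 + q.2 • ν q.1) (frontier Ω ×ˢ Ioc 0 T)) (hM : 0 < M)
    (hchart : ∀ p ∈ frontier Ω, ∃ (U : Set (LocalVar d)) (σ : LocalVar d → Rd d),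
      IsBoundaryChart Ω ν T M p U σ) {F : Rd d → ℝ} (hF : ContDiff ℝ 1 F)
    {δ τ : ℝ} (hδ : 0 < δ) (hδT : δ ≤ T / 2) (hτ : 0 ≤ τ) (hτT : τ ≤ T) :
    MeasurableSet (collar Ω ν δ τ) ∧ MeasurableSet (collar Ω ν δ T) ∧
    ∫⁻ x in collar Ω ν δ τ, ENNReal.ofReal (F x) ≤
      ENNReal.ofReal (M * M * (τ * (2 / T + 1))) *
        ∫⁻ x in collar Ω ν δ T, (ENNReal.ofReal (F x) + ‖fderiv ℝ F x‖ₑ) := by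
  rcases (frontier Ω).eq_empty_or_nonempty with he | hne
  · simp [collar, he]
  choose! U σ hUσ using hchart
  have hO : ∀ p ∈ frontier Ω, ∃ O, IsOpen O ∧ p ∈ O ∧ O ∩ frontier Ω ⊆ σ p '' U p :=
    fun p hp => mem_nhdsWithin.1 (hUσ p hp).image_mem_nhds
  choose! O hOo hpO hOs using hO
  obtain ⟨c, hcf, hcc, hcov⟩ := TopologicalSpace.countable_cover_nhdsWithin
    (f := O) (s := frontier Ω)
    (fun p hp => mem_nhdsWithin_of_mem_nhds ((hOo p hp).mem_nhds (hpO p hp)))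
  have hcne : c.Nonempty := by
    obtain ⟨q, hq⟩ := hne
    obtain ⟨p, hp, -⟩ := mem_iUnion₂.1 (hcov hq)
    exact ⟨p, hp⟩
  obtain ⟨e, rfl⟩ := hcc.exists_eq_range hcne
  have hef : ∀ k, e k ∈ frontier Ω := fun k => hcf ⟨k, rfl⟩
  let A : ℕ → Set (Rd d) := disjointed fun k => O (e k)
  have hAm : ∀ k, MeasurableSet (A k) :=
    MeasurableSet.disjointed fun k => (hOo _ (hef k)).measurableSet
  let P : ℝ → ℕ → Set (Rd d) := fun r k => chartCollar ν (U (e k)) (σ (e k)) (A k) (Ioc δ r)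
  have hP : ∀ r, collar Ω ν δ r = ⋃ k, P r k := by
    intro r
    ext x
    rw [mem_iUnion]
    constructor
    · rintro ⟨⟨q, t⟩, ⟨hq, ht⟩, rfl⟩
      have : q ∈ ⋃ k, A k := by
        rw [iUnion_disjointed]
        simpa using hcov hq
      obtain ⟨k, hk⟩ := mem_iUnion.1 this
      exact ⟨k, mem_chartCollar.2 ⟨q, ⟨hOs _ (hef k) ⟨disjointed_subset (fun k => O (e k)) k hk, hq⟩, hk⟩,
        t, ht, rfl⟩⟩
    · rintro ⟨k, hk⟩
      obtain ⟨q, hq, t, ht, rfl⟩ := mem_chartCollar.1 hk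
      exact ⟨(q, t), ⟨(hUσ _ (hef k)).image_subset hq.1, ht⟩, rfl⟩
  have hest := fun k => (hUσ _ (hef k)).chartCollar_estimate hν hinj (hAm k) hM hF hδ hδT hτ hτT
  have hdisj : Pairwise (Function.onFun Disjoint (P T)) := by
    intro j k hjk
    refine disjoint_left.2 fun x hxj hxk => ?_
    obtain ⟨q, hq, t, ht, rfl⟩ := mem_chartCollar.1 hxj
    obtain ⟨q', hq', t', ht', heq⟩ := mem_chartCollar.1 hxk
    have h1 := hinj (x₁ := (q, t)) (x₂ := (q', t'))
      ⟨(hUσ _ (hef j)).image_subset hq.1, Ioc_subset_Ioc_left hδ.le ht⟩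
      ⟨(hUσ _ (hef k)).image_subset hq'.1, Ioc_subset_Ioc_left hδ.le ht'⟩ heq
    rw [Prod.mk.injEq] at h1
    exact disjoint_left.1 (disjoint_disjointed (fun k => O (e k)) hjk) hq.2 (h1.1 ▸ hq'.2)
  rw [hP, hP]
  refine ⟨MeasurableSet.iUnion fun k => (hest k).1, MeasurableSet.iUnion fun k => (hest k).2.1, ?_⟩
  rw [lintegral_iUnion (fun k => (hest k).2.1) hdisj, ← ENNReal.tsum_mul_left]
  exact (lintegral_iUnion_le _ _).trans (ENNReal.tsum_le_tsum fun k => (hest k).2.2)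

theorem enorm_fderiv_norm_sq_le {F : Type*} [NormedAddCommGroup F] [InnerProductSpace ℝ F]
    {E : Type*} [NormedAddCommGroup E] [NormedSpace ℝ E] {w : E → F} {x : E}
    (hw : DifferentiableAt ℝ w x) :
    ‖fderiv ℝ (fun x => ‖w x‖ ^ 2) x‖ₑ ≤ ‖w x‖ₑ ^ 2 + ‖fderiv ℝ w x‖ₑ ^ 2 := by
  have h : ‖fderiv ℝ (fun x => ‖w x‖ ^ 2) x‖ ≤ ‖w x‖ ^ 2 + ‖fderiv ℝ w x‖ ^ 2 := by
    refine ContinuousLinearMap.opNorm_le_bound _ (by positivity) fun v => ?_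
    rw [hw.hasFDerivAt.norm_sq.fderiv]
    simp only [smul_apply, ContinuousLinearMap.comp_apply,
      innerSL_apply_apply, nsmul_eq_mul, Nat.cast_ofNat]
    calc ‖(2 : ℝ) * inner ℝ (w x) (fderiv ℝ w x v)‖
        ≤ 2 * (‖w x‖ * (‖fderiv ℝ w x‖ * ‖v‖)) := by
          rw [norm_mul, Real.norm_of_nonneg (by norm_num : (0 : ℝ) ≤ 2)]
          gcongr
          exact (norm_inner_le_norm _ _).trans
            (by gcongr; exact ContinuousLinearMap.le_opNorm _ _)
      _ = (2 * ‖w x‖ * ‖fderiv ℝ w x‖) * ‖v‖ := by ring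
      _ ≤ _ := by
          gcongr
          exact two_mul_le_add_sq _ _
  rw [← ofReal_norm, ← ofReal_norm, ← ofReal_norm, ← ENNReal.ofReal_pow (norm_nonneg _),
    ← ENNReal.ofReal_pow (norm_nonneg _), ← ENNReal.ofReal_add (by positivity) (by positivity)]
  exact ENNReal.ofReal_le_ofReal h

/-- The part of a regular domain within the distance `τ` of its boundary contributes at most
`O(τ)` to the `L²` norm of a Sobolev function. -/
theorem IsRegularDomain.exists_boundaryLayer_estimate (hΩ : IsRegularDomain Ω) (n : ℕ) :
    ∃ T C : ℝ, 0 < T ∧ 0 < C ∧ ∀ (u : W12 Ω n) (τ : ℝ), 0 < τ → τ ≤ T →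
      ∫⁻ x in {x | x ∈ Ω ∧ ∃ p ∈ frontier Ω, dist x p ≤ τ}, ‖u.toFun x‖ₑ ^ 2 ≤
        ENNReal.ofReal (C * τ * u.norm ^ 2) := by
  obtain ⟨ν, T, M, hT, hM, hν, hbij, hchart⟩ := hΩ.exists_collar
  have hν1 : ∀ q ∈ frontier Ω, ‖ν q‖ = 1 := fun q hq => norm_inwardNormal hν hq
  refine ⟨T, 2 * (M * M * (2 / T + 1)), hT, by positivity, fun u τ hτ hτT => ?_⟩
  obtain ⟨w, hws, -, hwA, hwae, -⟩ := exists_smooth_approx hΩ.isOpen u (half_pos hT)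
  -- This is the mollification radius of `w k`; removing the boundary layer of depth `δ k` keeps the
  -- mollification balls inside `Ω`.
  let δ : ℕ → ℝ := fun k => T / 2 / (k + 1)
  have hδ0 : ∀ k, 0 < δ k := fun k => by simp only [δ]; positivity
  have hδT : ∀ k, δ k ≤ T / 2 := fun k => div_le_self (by positivity) (by simp)
  have hδlim : Tendsto δ atTop (𝓝 0) := tendsto_const_nhds.div_atTop
    (tendsto_atTop_add_const_right _ 1 tendsto_natCast_atTop_atTop)
  have hFs : ∀ k, ContDiff ℝ 1 fun x => ‖w k x‖ ^ 2 := fun k =>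
    ((hws k).of_le (by simp)).norm_sq ℝ
  have hcol : ∀ k r, 0 ≤ r → r ≤ T → _ := fun k r h0 hr =>
    collar_estimate hν1 hbij.injOn hM hchart (hFs k) (hδ0 k) (hδT k) h0 hr
  have hofReal : ∀ k x, ENNReal.ofReal (‖w k x‖ ^ 2) = ‖w k x‖ₑ ^ 2 := fun k x => by
    rw [ENNReal.ofReal_pow (norm_nonneg _), ofReal_norm]
  have hest : ∀ k, ∫⁻ x in collar Ω ν (δ k) τ, ‖w k x‖ₑ ^ 2 ≤
      ENNReal.ofReal (2 * (M * M * (2 / T + 1)) * τ * u.norm ^ 2) := by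
    intro k
    have h1 := (hcol k τ hτ.le hτT).2.2
    simp only [hofReal] at h1
    refine h1.trans ?_
    have h2 : ∫⁻ x in collar Ω ν (δ k) T, (‖w k x‖ₑ ^ 2 + ‖fderiv ℝ (fun x => ‖w k x‖ ^ 2) x‖ₑ)
        ≤ 2 * ENNReal.ofReal (u.norm ^ 2) := by
      calc _ ≤ ∫⁻ x in collar Ω ν (δ k) T, 2 * (‖w k x‖ₑ ^ 2 + ‖fderiv ℝ (w k) x‖ₑ ^ 2) := by
            refine lintegral_mono fun x => ?_
            rw [two_mul]
            exact add_le_add le_self_add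
              (enorm_fderiv_norm_sq_le ((hws k).differentiable (by simp) x))
        _ = 2 * ∫⁻ x in collar Ω ν (δ k) T, (‖w k x‖ₑ ^ 2 + ‖fderiv ℝ (w k) x‖ₑ ^ 2) :=
            lintegral_const_mul' _ _ (by norm_num)
        _ ≤ _ := by
            gcongr
            exact hwA k _ (hcol k τ hτ.le hτT).2.1 fun x hx =>
              closedBall_subset_of_mem_collar hΩ.isOpen hν hbij (hδ0 k).le hx
    calc _ ≤ ENNReal.ofReal (M * M * (τ * (2 / T + 1))) * (2 * ENNReal.ofReal (u.norm ^ 2)) := by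
          gcongr
      _ = _ := by
          rw [← ENNReal.ofReal_ofNat, ← ENNReal.ofReal_mul (by norm_num),
            ← ENNReal.ofReal_mul (by positivity)]
          congr 1; ring
  have hsub : ∀ k, collar Ω ν (δ k) τ ⊆ Ω := by
    rintro k _ ⟨⟨p, t⟩, ⟨hp, ht⟩, rfl⟩
    exact (hbij.mapsTo (x := (p, t)) ⟨hp, (hδ0 k).trans ht.1, ht.2.trans hτT⟩).1
  have hmem : ∀ x ∈ {x | x ∈ Ω ∧ ∃ p ∈ frontier Ω, dist x p ≤ τ},
      ∀ᶠ k in atTop, x ∈ collar Ω ν (δ k) τ := by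
    rintro x ⟨hx, q, hq, hd⟩
    obtain ⟨p, hp, h0, hle, -, heq⟩ := mem_collar_of_mem_boundaryLayer hΩ.isOpen hν hx hq
    filter_upwards [hδlim.eventually_lt_const h0] with k hk
    exact ⟨(p, dist x p), ⟨hp, hk, hle.trans hd⟩, heq.symm⟩
  have hind : ∀ k, ∫⁻ x in Ω, (collar Ω ν (δ k) τ).indicator (fun x => ‖w k x‖ₑ ^ 2) x ≤
      ENNReal.ofReal (2 * (M * M * (2 / T + 1)) * τ * u.norm ^ 2) := fun k => by
    rw [setLIntegral_indicator (hcol k τ hτ.le hτT).1, inter_eq_left.2 (hsub k)]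
    exact hest k
  -- The union of the collars is measurable by construction and replaces the layer.
  have hBsub : {x | x ∈ Ω ∧ ∃ p ∈ frontier Ω, dist x p ≤ τ} ⊆ ⋃ k, collar Ω ν (δ k) τ :=
    fun x hx => mem_iUnion.2 (hmem x hx).exists
  have hBm : MeasurableSet (⋃ k, collar Ω ν (δ k) τ) :=
    MeasurableSet.iUnion fun k => (hcol k τ hτ.le hτT).1
  have hmem' : ∀ x ∈ ⋃ k, collar Ω ν (δ k) τ, ∀ᶠ k in atTop, x ∈ collar Ω ν (δ k) τ := by
    intro x hx
    obtain ⟨k, hk⟩ := mem_iUnion.1 hx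
    refine hmem x ⟨hsub k hk, ?_⟩
    obtain ⟨⟨p, t⟩, ⟨hp, ht⟩, rfl⟩ := hk
    refine ⟨p, hp, ?_⟩
    rw [dist_eq_norm, add_sub_cancel_left, norm_smul, hν1 p hp, mul_one,
      Real.norm_of_nonneg ((hδ0 k).trans ht.1).le]
    exact ht.2
  -- The bounds for `w k` do not depend on `k`; Fatou's lemma transfers them to `u` while the
  -- collars exhaust the layer.
  calc _ ≤ ∫⁻ x in ⋃ k, collar Ω ν (δ k) τ, ‖u.toFun x‖ₑ ^ 2 := lintegral_mono_set hBsub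
    _ = ∫⁻ x in Ω, (⋃ k, collar Ω ν (δ k) τ).indicator (fun x => ‖u.toFun x‖ₑ ^ 2) x := by
        rw [setLIntegral_indicator hBm, inter_eq_left.2 (iUnion_subset hsub)]
    _ ≤ ∫⁻ x in Ω, liminf (fun k => (collar Ω ν (δ k) τ).indicator
          (fun x => ‖w k x‖ₑ ^ 2) x) atTop := by
        refine lintegral_mono_ae ?_
        filter_upwards [hwae] with x hx
        by_cases hxB : x ∈ ⋃ k, collar Ω ν (δ k) τ
        · rw [indicator_of_mem hxB]
          refine le_of_eq (Tendsto.liminf_eq ?_).symm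
          have h1 : Tendsto (fun k => ‖w k x‖ₑ ^ 2) atTop (𝓝 (‖u.toFun x‖ₑ ^ 2)) :=
            ((ENNReal.continuous_pow 2).tendsto _).comp ((continuous_enorm.tendsto _).comp hx)
          refine h1.congr' ?_
          filter_upwards [hmem' x hxB] with k hk
          rw [indicator_of_mem hk]
        · rw [indicator_of_notMem hxB]; exact zero_le
    _ ≤ liminf (fun k => ∫⁻ x in Ω, (collar Ω ν (δ k) τ).indicator
          (fun x => ‖w k x‖ₑ ^ 2) x) atTop :=
        lintegral_liminf_le fun k =>
          ((hws k).continuous.enorm.measurable.pow_const 2).indicator (hcol k τ hτ.le hτT).1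
    _ ≤ _ := liminf_le_of_le (by isBoundedDefault) fun b hb => by
        obtain ⟨k, hk⟩ := hb.exists
        exact hk.trans (hind k)

end BoundaryLayer

/-! ### The Poincaré inequality on convex sets -/

section Poincare

variable {d : ℕ} {Q : Set (Rd d)}

/-- The contraction towards `x` maps the convex set into itself, with Jacobian `t ^ d ≥ 2⁻ᵈ`. -/
theorem lintegral_homothety_le (hQ : Convex ℝ Q) (hQm : MeasurableSet Q)
    (h : Rd d → ℝ≥0∞) {x : Rd d} (hx : x ∈ Q) {t : ℝ} (ht : 1 / 2 ≤ t) (ht1 : t ≤ 1) :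
    ∫⁻ y in Q, h (x + t • (y - x)) ≤ 2 ^ d * ∫⁻ y in Q, h y := by
  have ht0 : 0 < t := by linarith
  let f : Rd d → Rd d := fun y => x + t • (y - x)
  have hf : ∀ y, HasFDerivAt f (t • ContinuousLinearMap.id ℝ (Rd d)) y := fun y => by
    exact (((hasFDerivAt_id y).sub_const x).const_smul t).const_add x
  have hinj : InjOn f Q := by
    intro y _ z _ hyz
    have h1 : t • (y - x) = t • (z - x) := add_left_cancel hyz
    simpa using smul_right_injective (Rd d) ht0.ne' h1
  have hdet : (t • ContinuousLinearMap.id ℝ (Rd d)).det = t ^ d := by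
    have : ((t • ContinuousLinearMap.id ℝ (Rd d) : Rd d →L[ℝ] Rd d) : Rd d →ₗ[ℝ] Rd d)
        = t • LinearMap.id := rfl
    rw [ContinuousLinearMap.det, this, LinearMap.det_smul]
    simp
  have hcv := lintegral_image_eq_lintegral_abs_det_fderiv_mul volume hQm
    (fun y _ => (hf y).hasFDerivWithinAt) hinj h
  rw [hdet, lintegral_const_mul' _ _ ENNReal.ofReal_ne_top, abs_of_pos (by positivity)] at hcv
  have hsub : f '' Q ⊆ Q := by
    rintro _ ⟨y, hy, rfl⟩
    exact hQ.add_smul_sub_mem hx hy ⟨ht0.le, ht1⟩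
  have h1 : (1 : ℝ≥0∞) ≤ 2 ^ d * ENNReal.ofReal (t ^ d) := by
    rw [← ENNReal.ofReal_ofNat, ← ENNReal.ofReal_pow (by norm_num),
      ← ENNReal.ofReal_mul (by positivity), ← mul_pow, ← ENNReal.ofReal_one]
    exact ENNReal.ofReal_le_ofReal (one_le_pow₀ (by linarith))
  calc ∫⁻ y in Q, h (f y) ≤ 2 ^ d * ENNReal.ofReal (t ^ d) * ∫⁻ y in Q, h (f y) :=
        le_mul_of_one_le_left' h1
    _ = 2 ^ d * ∫⁻ y in f '' Q, h y := by rw [mul_assoc, ← hcv]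
    _ ≤ _ := by gcongr

/-- For `t < 1/2` the contraction towards `x` degenerates, but exchanging `x` and `y` replaces `t`
by `1 - t`. -/
theorem lintegral_lintegral_segment_le (hQ : Convex ℝ Q) (hQm : MeasurableSet Q)
    {h : Rd d → ℝ≥0∞} (hh : Measurable h) {t : ℝ} (ht : t ∈ Icc (0 : ℝ) 1) :
    ∫⁻ x in Q, ∫⁻ y in Q, h (x + t • (y - x)) ≤ 2 ^ d * volume Q * ∫⁻ y in Q, h y := by
  have key : ∀ s : ℝ, 1 / 2 ≤ s → s ≤ 1 →
      ∫⁻ x in Q, ∫⁻ y in Q, h (x + s • (y - x)) ≤ 2 ^ d * volume Q * ∫⁻ y in Q, h y := by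
    intro s hs hs1
    calc ∫⁻ x in Q, ∫⁻ y in Q, h (x + s • (y - x)) ≤ ∫⁻ x in Q, 2 ^ d * ∫⁻ y in Q, h y :=
          setLIntegral_mono' hQm fun x hx => lintegral_homothety_le hQ hQm h hx hs hs1
      _ = _ := by rw [setLIntegral_const]; ring
  rcases le_total (1 / 2) t with h1 | h1
  · exact key t h1 ht.2
  · rw [lintegral_lintegral_swap]
    · refine le_trans (le_of_eq ?_) (key (1 - t) (by linarith) (by linarith [ht.1]))
      refine lintegral_congr fun y => lintegral_congr fun x => ?_
      congr 1
      module
    · have : Continuous fun z : Rd d × Rd d => z.1 + t • (z.2 - z.1) := by fun_prop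
      exact (hh.comp this.measurable).aemeasurable

theorem enorm_sub_le_lintegral_segment {F : Type*} [NormedAddCommGroup F] [NormedSpace ℝ F]
    [CompleteSpace F] {f : Rd d → F} (hf : ContDiff ℝ 1 f) (x y : Rd d) :
    ‖f x - f y‖ₑ ≤ ‖x - y‖ₑ * ∫⁻ t in Ioc (0 : ℝ) 1, ‖fderiv ℝ f (x + t • (y - x))‖ₑ := by
  have hder : ∀ t : ℝ, HasDerivAt (fun t : ℝ => f (x + t • (y - x)))
      (fderiv ℝ f (x + t • (y - x)) (y - x)) t := by
    intro t
    have h1 : HasDerivAt (fun t : ℝ => x + t • (y - x)) (y - x) t := by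
      simpa using ((hasDerivAt_id t).smul_const (y - x)).const_add x
    exact (hf.differentiable (by simp) _).hasFDerivAt.comp_hasDerivAt t h1
  have hcont : Continuous fun t : ℝ => fderiv ℝ f (x + t • (y - x)) (y - x) :=
    ((hf.continuous_fderiv (by simp)).comp (by fun_prop)).clm_apply continuous_const
  have hint := intervalIntegral.integral_eq_sub_of_hasDerivAt (a := 0) (b := 1)
    (fun t _ => hder t) (hcont.intervalIntegrable _ _)
  have h2 : f y - f x = ∫ t in Ioc (0 : ℝ) 1, fderiv ℝ f (x + t • (y - x)) (y - x) := by
    rw [← intervalIntegral.integral_of_le zero_le_one, hint]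
    simp
  rw [← enorm_neg, neg_sub, h2, ← enorm_neg (x - y), neg_sub, ← lintegral_const_mul']
  · refine (enorm_integral_le_lintegral_enorm _).trans (lintegral_mono fun t => ?_)
    rw [mul_comm]
    exact ContinuousLinearMap.le_opENorm _ _
  · exact enorm_ne_top

/-- An `L¹` Poincaré inequality: the difference is the integral of the gradient along the segment,
and for each `t` the segment points are redistributed over `Q` with bounded density. Apart from the
volume factor, only the diameter and the dimension enter, so it is uniform over all cells. -/
theorem lintegral_lintegral_enorm_sub_le {F : Type*} [NormedAddCommGroup F] [NormedSpace ℝ F]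
    [CompleteSpace F] (hQ : Convex ℝ Q) (hQm : MeasurableSet Q) {D : ℝ}
    (hD : ∀ x ∈ Q, ∀ y ∈ Q, ‖x - y‖ ≤ D) {f : Rd d → F} (hf : ContDiff ℝ 1 f) :
    ∫⁻ x in Q, ∫⁻ y in Q, ‖f x - f y‖ₑ ≤
      ENNReal.ofReal D * (2 ^ d * volume Q * ∫⁻ y in Q, ‖fderiv ℝ f y‖ₑ) := by
  set h : Rd d → ℝ≥0∞ := fun x => ‖fderiv ℝ f x‖ₑ with hdef
  have hh : Continuous h := (hf.continuous_fderiv (by simp)).enorm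
  have hm : Measurable fun z : (Rd d × ℝ) × Rd d => h (z.1.1 + z.1.2 • (z.2 - z.1.1)) := by
    have : Continuous fun z : (Rd d × ℝ) × Rd d => z.1.1 + z.1.2 • (z.2 - z.1.1) := by fun_prop
    exact (hh.comp this).measurable
  calc ∫⁻ x in Q, ∫⁻ y in Q, ‖f x - f y‖ₑ
      ≤ ∫⁻ x in Q, ∫⁻ y in Q, ENNReal.ofReal D * ∫⁻ t in Ioc (0 : ℝ) 1, h (x + t • (y - x)) := by
        refine setLIntegral_mono' hQm fun x hx => setLIntegral_mono' hQm fun y hy => ?_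
        refine (enorm_sub_le_lintegral_segment hf x y).trans ?_
        gcongr
        rw [← ofReal_norm]
        exact ENNReal.ofReal_le_ofReal (hD x hx y hy)
    _ = ENNReal.ofReal D * ∫⁻ x in Q, ∫⁻ y in Q, ∫⁻ t in Ioc (0 : ℝ) 1, h (x + t • (y - x)) := by
        simp_rw [lintegral_const_mul' _ _ ENNReal.ofReal_ne_top]
    _ = ENNReal.ofReal D * ∫⁻ x in Q, ∫⁻ t in Ioc (0 : ℝ) 1, ∫⁻ y in Q, h (x + t • (y - x)) := by
        congr 1
        refine lintegral_congr fun x => lintegral_lintegral_swap ?_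
        have : Continuous fun z : Rd d × ℝ => x + z.2 • (z.1 - x) := by fun_prop
        exact (hh.comp this).measurable.aemeasurable
    _ = ENNReal.ofReal D * ∫⁻ t in Ioc (0 : ℝ) 1, ∫⁻ x in Q, ∫⁻ y in Q, h (x + t • (y - x)) := by
        congr 1
        exact lintegral_lintegral_swap (hm.lintegral_prod_right').aemeasurable
    _ ≤ ENNReal.ofReal D * ∫⁻ _ in Ioc (0 : ℝ) 1, 2 ^ d * volume Q * ∫⁻ y in Q, h y := by
        gcongr ENNReal.ofReal D * ?_
        exact setLIntegral_mono' measurableSet_Ioc fun t ht =>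
          lintegral_lintegral_segment_le hQ hQm hh.measurable ⟨ht.1.le, ht.2⟩
    _ = _ := by simp

/-- Subtracting from `f` its mean isolates the mean of `A`; the identity `hid` is this decomposition
multiplied by `|Q|`. The `L¹` form is the one needed, as `f` will be a product of two `L²`
functions. -/
theorem enorm_setIntegral_mul_le (hQ : Convex ℝ Q) (hQm : MeasurableSet Q)
    (hQb : Bornology.IsBounded Q) (hQ0 : volume Q ≠ 0) {D : ℝ}
    (hD : ∀ x ∈ Q, ∀ y ∈ Q, ‖x - y‖ ≤ D) {f : Rd d → ℂ} (hf : ContDiff ℝ 1 f)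
    {A : Rd d → ℂ} {K : ℝ} (hA : AEStronglyMeasurable A (volume.restrict Q))
    (hAK : ∀ᵐ x ∂volume.restrict Q, ‖A x‖ ≤ K) :
    ‖∫ x in Q, A x * f x‖ₑ ≤
      ENNReal.ofReal K * ENNReal.ofReal D * 2 ^ d * (∫⁻ x in Q, ‖fderiv ℝ f x‖ₑ) +
        (volume Q)⁻¹ * ‖∫ x in Q, A x‖ₑ * ∫⁻ x in Q, ‖f x‖ₑ := by
  have hQf : volume Q ≠ ⊤ := hQb.measure_lt_top.ne
  have : IsFiniteMeasure (volume.restrict Q) := ⟨by simpa using hQb.measure_lt_top⟩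
  have hfi : IntegrableOn f Q :=
    (hf.continuous.continuousOn.integrableOn_compact hQb.isCompact_closure).mono_set subset_closure
  have hAi : IntegrableOn A Q := Integrable.of_bound hA K hAK
  set q : ℂ := ((volume Q).toReal : ℂ) with hq
  have hid : q * ∫ x in Q, A x * f x =
      (∫ x in Q, A x * ∫ y in Q, (f x - f y)) + (∫ x in Q, A x) * ∫ y in Q, f y := by
    have h1 : ∀ x, ∫ y in Q, (f x - f y) = q * f x - ∫ y in Q, f y := fun x => by
      rw [integral_sub (integrable_const _) hfi, setIntegral_const, measureReal_def,
        Complex.real_smul]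
    have h2 : IntegrableOn (fun x => A x * f x) Q := hfi.bdd_mul hA hAK
    simp_rw [h1, mul_sub]
    rw [integral_sub, integral_mul_const, sub_add_cancel, ← integral_const_mul]
    · refine integral_congr_ae (Eventually.of_forall fun x => ?_)
      simp only; ring
    · refine (h2.const_mul q).congr (Eventually.of_forall fun x => ?_)
      simp only; ring
    · exact hAi.mul_const _
  have hqe : ‖q‖ₑ = volume Q := by
    rw [hq, ← ofReal_norm, Complex.norm_real, Real.norm_of_nonneg ENNReal.toReal_nonneg,
      ENNReal.ofReal_toReal hQf]
  have h3 : ‖∫ x in Q, A x * ∫ y in Q, (f x - f y)‖ₑ ≤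
      ENNReal.ofReal K * (ENNReal.ofReal D * (2 ^ d * volume Q * ∫⁻ y in Q, ‖fderiv ℝ f y‖ₑ)) := by
    calc ‖∫ x in Q, A x * ∫ y in Q, (f x - f y)‖ₑ
        ≤ ∫⁻ x in Q, ‖A x * ∫ y in Q, (f x - f y)‖ₑ := enorm_integral_le_lintegral_enorm _
      _ ≤ ∫⁻ x in Q, ENNReal.ofReal K * ∫⁻ y in Q, ‖f x - f y‖ₑ := by
          refine lintegral_mono_ae ?_
          filter_upwards [hAK] with x hx
          rw [enorm_mul]
          gcongr
          · rw [← ofReal_norm]; exact ENNReal.ofReal_le_ofReal hx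
          · exact enorm_integral_le_lintegral_enorm _
      _ = ENNReal.ofReal K * ∫⁻ x in Q, ∫⁻ y in Q, ‖f x - f y‖ₑ :=
          lintegral_const_mul' _ _ ENNReal.ofReal_ne_top
      _ ≤ _ := by
          gcongr
          exact lintegral_lintegral_enorm_sub_le hQ hQm hD hf
  have h4 : volume Q * ‖∫ x in Q, A x * f x‖ₑ ≤
      ENNReal.ofReal K * (ENNReal.ofReal D * (2 ^ d * volume Q * ∫⁻ y in Q, ‖fderiv ℝ f y‖ₑ)) +
        ‖∫ x in Q, A x‖ₑ * ∫⁻ x in Q, ‖f x‖ₑ := by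
    rw [← hqe, ← enorm_mul, hid, hqe]
    refine (enorm_add_le _ _).trans (add_le_add h3 ?_)
    rw [enorm_mul]
    gcongr
    exact enorm_integral_le_lintegral_enorm _
  calc ‖∫ x in Q, A x * f x‖ₑ = (volume Q)⁻¹ * (volume Q * ‖∫ x in Q, A x * f x‖ₑ) := by
        rw [← mul_assoc, ENNReal.inv_mul_cancel hQ0 hQf, one_mul]
    _ ≤ (volume Q)⁻¹ * (ENNReal.ofReal K *
          (ENNReal.ofReal D * (2 ^ d * volume Q * ∫⁻ y in Q, ‖fderiv ℝ f y‖ₑ)) +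
        ‖∫ x in Q, A x‖ₑ * ∫⁻ x in Q, ‖f x‖ₑ) := by gcongr
    _ = ((volume Q)⁻¹ * volume Q) * (ENNReal.ofReal K * ENNReal.ofReal D * 2 ^ d *
          ∫⁻ x in Q, ‖fderiv ℝ f x‖ₑ) +
        (volume Q)⁻¹ * ‖∫ x in Q, A x‖ₑ * ∫⁻ x in Q, ‖f x‖ₑ := by ring
    _ = _ := by rw [ENNReal.inv_mul_cancel hQ0 hQf, one_mul]

end Poincare

/-! ### Half-open cells -/

section Cells

variable {d : ℕ} (b : Module.Basis (Fin d) ℝ (Rd d)) (a : Rd d)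

/-- The half-open cell with the same closure as `□_γ^η`. -/
def halfCell (η : ℝ) (γ : Rd d) : Set (Rd d) :=
  (fun x => η⁻¹ • x - (γ + a)) ⁻¹' ZSpan.fundamentalDomain b

variable {b a} {η : ℝ} {γ : Rd d}

theorem mem_scaledCell {x : Rd d} :
    x ∈ scaledCell b a η γ ↔ ∀ i, b.repr (η⁻¹ • x - (γ + a)) i ∈ Ioo (0 : ℝ) 1 := by
  rw [← sub_sub]; rfl

theorem volume_preimage_rescale (hη : 0 < η) (c : Rd d) (s : Set (Rd d)) :
    volume ((fun x => η⁻¹ • x - c) ⁻¹' s) = ENNReal.ofReal (η ^ d) * volume s := by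
  have h : (fun x : Rd d => η⁻¹ • x - c) ⁻¹' s = (η⁻¹ • ·) ⁻¹' ((fun x => x - c) ⁻¹' s) := rfl
  rw [h, Measure.addHaar_preimage_smul _ (inv_pos.2 hη).ne', show (fun x : Rd d => x - c) ⁻¹' s = (fun x => x + -c) ⁻¹' s by simp only [sub_eq_add_neg],
    measure_preimage_add_right]
  simp [abs_of_pos (pow_pos hη d)]

theorem mem_halfCell {x : Rd d} :
    x ∈ halfCell b a η γ ↔ ∀ i, b.repr (η⁻¹ • x - (γ + a)) i ∈ Ico (0 : ℝ) 1 :=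
  ZSpan.mem_fundamentalDomain b

theorem scaledCell_subset_halfCell : scaledCell b a η γ ⊆ halfCell b a η γ := by
  intro x hx
  rw [mem_scaledCell] at hx
  exact mem_halfCell.2 fun i => Ioo_subset_Ico_self (hx i)

/-- The two cells differ within finitely many hyperplanes. Half-open cells tile the space exactly,
whereas the condition on the means is stated for open ones. -/
theorem scaledCell_ae_eq_halfCell (hη : 0 < η) :
    scaledCell b a η γ =ᵐ[volume] halfCell b a η γ := by
  refine scaledCell_subset_halfCell.eventuallyLE.antisymm ?_
  rw [ae_le_set]
  have hsub : halfCell b a η γ \ scaledCell b a η γ ⊆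
      ⋃ i, (fun x => η⁻¹ • x - (γ + a)) ⁻¹' (LinearMap.ker (b.coord i) : Set (Rd d)) := by
    rintro x ⟨hx, hx'⟩
    rw [mem_scaledCell] at hx'
    push Not at hx'
    obtain ⟨i, hi⟩ := hx'
    have hxi := mem_halfCell.1 hx i
    refine mem_iUnion.2 ⟨i, ?_⟩
    by_contra hcon
    refine hi ⟨lt_of_le_of_ne hxi.1 fun h0 => hcon ?_, hxi.2⟩
    simpa using h0.symm
  refine measure_mono_null hsub (measure_iUnion_null fun i => ?_)
  rw [volume_preimage_rescale hη, Measure.addHaar_submodule, mul_zero]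
  intro htop
  have : b i ∈ LinearMap.ker (b.coord i) := htop ▸ Submodule.mem_top
  simp at this

theorem measurableSet_halfCell : MeasurableSet (halfCell b a η γ) :=
  (by fun_prop : Continuous fun x : Rd d => η⁻¹ • x - (γ + a)).measurable
    (ZSpan.fundamentalDomain_measurableSet b)

theorem convex_halfCell : Convex ℝ (halfCell b a η γ) := by
  intro x hx y hy s t hs ht hst
  refine mem_halfCell.2 fun i => ?_
  have hx' := mem_halfCell.1 hx i
  have hy' := mem_halfCell.1 hy i
  have h : η⁻¹ • (s • x + t • y) - (γ + a) =
      s • (η⁻¹ • x - (γ + a)) + t • (η⁻¹ • y - (γ + a)) := by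
    obtain rfl : s = 1 - t := by linarith
    module
  rw [h]
  simpa using convex_Ico (0 : ℝ) 1 hx' hy' hs ht hst

theorem norm_sub_le_of_mem_halfCell (hη : 0 < η) {x y : Rd d} (hx : x ∈ halfCell b a η γ)
    (hy : y ∈ halfCell b a η γ) : ‖x - y‖ ≤ (∑ i, ‖b i‖) * η := by
  have hx' := mem_halfCell.1 hx
  have hy' := mem_halfCell.1 hy
  have h : x - y = η • ((η⁻¹ • x - (γ + a)) - (η⁻¹ • y - (γ + a))) := by
    rw [sub_sub_sub_cancel_right, ← smul_sub, smul_smul, mul_inv_cancel₀ hη.ne', one_smul]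
  rw [h, norm_smul, Real.norm_of_nonneg hη.le, mul_comm]
  gcongr
  rw [← b.sum_repr ((η⁻¹ • x - (γ + a)) - (η⁻¹ • y - (γ + a)))]
  refine (norm_sum_le _ _).trans (Finset.sum_le_sum fun i _ => ?_)
  rw [norm_smul]
  refine mul_le_of_le_one_left (norm_nonneg _) ?_
  rw [map_sub, Finsupp.sub_apply, Real.norm_eq_abs, abs_le]
  constructor <;> linarith [(hx' i).1, (hx' i).2, (hy' i).1, (hy' i).2]

theorem isBounded_halfCell (hη : 0 < η) : Bornology.IsBounded (halfCell b a η γ) :=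
  Metric.isBounded_iff.2 ⟨_, fun x hx y hy => by
    rw [dist_eq_norm]; exact norm_sub_le_of_mem_halfCell hη hx hy⟩

theorem volume_halfCell (hη : 0 < η) :
    volume (halfCell b a η γ) = ENNReal.ofReal (η ^ d) * volume (ZSpan.fundamentalDomain b) :=
  volume_preimage_rescale hη _ _

theorem exists_mem_halfCell (x : Rd d) : ∃ γ ∈ lattice b, x ∈ halfCell b a η γ := by
  refine ⟨ZSpan.floor b (η⁻¹ • x - a), (ZSpan.floor b (η⁻¹ • x - a)).2, ?_⟩
  have h : η⁻¹ • x - (ZSpan.floor b (η⁻¹ • x - a) + a) = ZSpan.fract b (η⁻¹ • x - a) := by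
    rw [ZSpan.fract]; abel
  change η⁻¹ • x - (ZSpan.floor b (η⁻¹ • x - a) + a) ∈ ZSpan.fundamentalDomain b
  rw [h]
  exact ZSpan.fract_mem_fundamentalDomain b _

theorem disjoint_halfCell {γ' : Rd d} (hγ : γ ∈ lattice b) (hγ' : γ' ∈ lattice b)
    (hne : γ ≠ γ') : Disjoint (halfCell b a η γ) (halfCell b a η γ') := by
  refine disjoint_left.2 fun x hx hx' => hne ?_
  have key : ∀ g ∈ lattice b, x ∈ halfCell b a η g →
      η⁻¹ • x - (g + a) = ZSpan.fract b (η⁻¹ • x - a) := by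
    intro g hg hxg
    have h1 : ZSpan.fract b (η⁻¹ • x - (g + a)) = η⁻¹ • x - (g + a) := ZSpan.fract_eq_self.2 hxg
    have h2 : η⁻¹ • x - a = g + (η⁻¹ • x - (g + a)) := by abel
    rw [← h1, h2, ZSpan.fract_zSpan_add b _ hg]
  have h := (key γ hγ hx).trans (key γ' hγ' hx').symm
  simpa using h

end Cells

/-! ### Cells deep inside the domain. -/

section InnerCells

variable {d : ℕ} {b : Module.Basis (Fin d) ℝ (Rd d)} {a : Rd d} {Ω : Set (Rd d)} {η : ℝ}

/-- The lattice points whose cell stays at a distance `η` from the complement of `Ω`. -/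
def deepLattice (b : Module.Basis (Fin d) ℝ (Rd d)) (a : Rd d) (Ω : Set (Rd d)) (η : ℝ) :
    Set (Rd d) :=
  {γ ∈ lattice b | ∀ x ∈ halfCell b a η γ, Metric.closedBall x η ⊆ Ω}

/-- The union of the cells that stay at a distance `η` from the complement of `Ω`. -/
def deepRegion (b : Module.Basis (Fin d) ℝ (Rd d)) (a : Rd d) (Ω : Set (Rd d)) (η : ℝ) :
    Set (Rd d) :=
  ⋃ γ : deepLattice b a Ω η, halfCell b a η γ

instance countable_deepLattice : Countable (deepLattice b a Ω η) := by
  have : Countable (Submodule.span ℤ (Set.range b)) := inferInstance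
  have h : (lattice b).Countable := this
  exact (h.mono fun γ hγ => hγ.1).to_subtype

theorem measurableSet_deepRegion : MeasurableSet (deepRegion b a Ω η) :=
  MeasurableSet.iUnion fun _ => measurableSet_halfCell

theorem closedBall_subset_of_mem_deepRegion {x : Rd d} (hx : x ∈ deepRegion b a Ω η) :
    Metric.closedBall x η ⊆ Ω := by
  obtain ⟨γ, hγ⟩ := mem_iUnion.1 hx
  exact γ.2.2 x hγ

theorem deepRegion_subset (hη : 0 < η) : deepRegion b a Ω η ⊆ Ω := fun _ hx =>
  closedBall_subset_of_mem_deepRegion hx (Metric.mem_closedBall_self hη.le)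

theorem deepLattice_subset_innerLattice (hη : 0 < η) :
    deepLattice b a Ω η ⊆ innerLattice b a Ω η := fun _ hγ =>
  ⟨hγ.1, fun x hx => hγ.2 x (scaledCell_subset_halfCell hx) (Metric.mem_closedBall_self hη.le)⟩

/-- The cell of `x` contains some `y` whose ball of radius `η` leaves `Ω`. The ball about `x` whose
radius is larger by the diameter bound `(∑ i, ‖b i‖) * η` contains it, hence leaves `Ω` too. -/
theorem exists_frontier_dist_le_of_notMem_deepRegion (hΩ : IsOpen Ω) (hη : 0 < η) {x : Rd d}
    (hx : x ∈ Ω) (hxG : x ∉ deepRegion b a Ω η) :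
    ∃ p ∈ frontier Ω, dist x p ≤ (∑ i, ‖b i‖ + 1) * η := by
  obtain ⟨γ, hγ, hxγ⟩ := exists_mem_halfCell (b := b) (a := a) (η := η) x
  have h1 : γ ∉ deepLattice b a Ω η := fun h => hxG (mem_iUnion.2 ⟨⟨γ, h⟩, hxγ⟩)
  have h2 : ∃ y ∈ halfCell b a η γ, ¬ Metric.closedBall y η ⊆ Ω := by
    by_contra! hcon
    exact h1 ⟨hγ, hcon⟩
  obtain ⟨y, hy, hyΩ⟩ := h2
  have hnn : 0 ≤ ∑ i, ‖b i‖ := Finset.sum_nonneg fun i _ => norm_nonneg _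
  refine exists_frontier_dist_le hΩ hx (by positivity) fun hsub => hyΩ (Subset.trans ?_ hsub)
  refine Metric.closedBall_subset_closedBall' ?_
  have := norm_sub_le_of_mem_halfCell hη hy hxγ
  rw [dist_eq_norm]
  linarith

/-- The cell estimates are summed over disjoint cells. The means are normalized by `η ^ d` and not
by the volume of the cell, whence the inverse volume of the fundamental domain. -/
theorem enorm_setIntegral_deepRegion_mul_le (hη : 0 < η) {A : Rd d → ℂ} {K ρ : ℝ}
    (hA : AEStronglyMeasurable A (volume.restrict Ω))
    (hAK : ∀ᵐ x ∂volume.restrict Ω, ‖A x‖ ≤ K)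
    (hmean : ∀ γ ∈ innerLattice b a Ω η,
      ‖∫ x in scaledCell b a η γ, ((η : ℂ) ^ d)⁻¹ * A x‖ ≤ ρ)
    {f : Rd d → ℂ} (hf : ContDiff ℝ 1 f) :
    ‖∫ x in deepRegion b a Ω η, A x * f x‖ₑ ≤
      ENNReal.ofReal K * ENNReal.ofReal ((∑ i, ‖b i‖) * η) * 2 ^ d *
        (∫⁻ x in deepRegion b a Ω η, ‖fderiv ℝ f x‖ₑ) +
      (volume (ZSpan.fundamentalDomain b))⁻¹ * ENNReal.ofReal ρ *
        ∫⁻ x in deepRegion b a Ω η, ‖f x‖ₑ := by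
  set G := deepRegion b a Ω η with hG
  -- Without integrability the Bochner integral is 0 and the bound is trivial.
  by_cases hint : IntegrableOn (fun x => A x * f x) G
  swap
  · rw [integral_undef hint]; simp
  have hdisj : Pairwise (Function.onFun Disjoint
      fun γ : deepLattice b a Ω η => halfCell b a η (γ : Rd d)) := fun γ γ' hne =>
    disjoint_halfCell γ.2.1 γ'.2.1 fun h => hne (Subtype.ext h)
  have hsum : ∀ g : Rd d → ℝ≥0∞,
      ∫⁻ x in G, g x = ∑' γ : deepLattice b a Ω η, ∫⁻ x in halfCell b a η γ, g x := fun g =>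
    lintegral_iUnion (fun _ => measurableSet_halfCell) hdisj g
  have hisum : ∫ x in G, A x * f x =
      ∑' γ : deepLattice b a Ω η, ∫ x in halfCell b a η γ, A x * f x :=
    integral_iUnion (fun _ => measurableSet_halfCell) hdisj hint
  rw [hisum, hsum, hsum,
    ← ENNReal.tsum_mul_left, ← ENNReal.tsum_mul_left, ← ENNReal.tsum_add]
  refine enorm_tsum_le_tsum_enorm.trans (ENNReal.tsum_le_tsum fun γ => ?_)
  have hsub : halfCell b a η γ ⊆ Ω := fun x hx =>
    γ.2.2 x hx (Metric.mem_closedBall_self hη.le)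
  have hηd : 0 < η ^ d := pow_pos hη d
  have hq0 : volume (ZSpan.fundamentalDomain b) ≠ 0 := ZSpan.measure_fundamentalDomain_ne_zero b
  have hv0 : volume (halfCell b a η γ) ≠ 0 := by
    rw [volume_halfCell hη]
    exact mul_ne_zero (by simpa using hηd) hq0
  have hmeanA : ‖∫ x in halfCell b a η γ, A x‖ₑ ≤ ENNReal.ofReal (η ^ d) * ENNReal.ofReal ρ := by
    have h1 := hmean γ (deepLattice_subset_innerLattice hη γ.2)
    rw [setIntegral_congr_set (scaledCell_ae_eq_halfCell hη), integral_const_mul, norm_mul,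
      norm_inv, norm_pow, Complex.norm_real, Real.norm_of_nonneg hη.le, inv_mul_le_iff₀ hηd] at h1
    rw [← ENNReal.ofReal_mul hηd.le, ← ofReal_norm]
    exact ENNReal.ofReal_le_ofReal h1
  refine (enorm_setIntegral_mul_le convex_halfCell measurableSet_halfCell (isBounded_halfCell hη)
    hv0 (fun x hx y hy => norm_sub_le_of_mem_halfCell hη hx hy) hf
    (hA.mono_set hsub) (ae_restrict_of_ae_restrict_of_subset hsub hAK)).trans ?_
  refine add_le_add le_rfl (mul_le_mul' ?_ le_rfl)
  calc (volume (halfCell b a η γ))⁻¹ * ‖∫ x in halfCell b a η γ, A x‖ₑ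
      ≤ (volume (halfCell b a η γ))⁻¹ * (ENNReal.ofReal (η ^ d) * ENNReal.ofReal ρ) := by gcongr
    _ = (ENNReal.ofReal (η ^ d))⁻¹ * ENNReal.ofReal (η ^ d) *
        ((volume (ZSpan.fundamentalDomain b))⁻¹ * ENNReal.ofReal ρ) := by
        rw [volume_halfCell hη, ENNReal.mul_inv (Or.inl (by simpa using hηd)) (Or.inl (by simp))]
        ring
    _ = _ := by rw [ENNReal.inv_mul_cancel (by simpa using hηd) (by simp), one_mul]

end InnerCells

/-! ### The sesquilinear form of a matrix -/

section Sesq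

variable {n : ℕ}

/-- The sesquilinear form `(A w, z)` of a matrix. -/
def matForm (A : Matrix (Fin n) (Fin n) ℂ) (w z : Cn n) : ℂ :=
  ∑ i, (A *ᵥ w.ofLp) i * starRingEnd ℂ (z i)

theorem matForm_eq_sum (A : Matrix (Fin n) (Fin n) ℂ) (w z : Cn n) :
    matForm A w z = ∑ i, ∑ j, A i j * (w j * starRingEnd ℂ (z i)) := by
  simp only [matForm, Matrix.mulVec, dotProduct, Finset.sum_mul, mul_assoc]

theorem norm_matForm_le (A : Matrix (Fin n) (Fin n) ℂ) (w z : Cn n) :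
    ‖matForm A w z‖ ≤ matAbs A * (‖w‖ * ‖z‖) := by
  rw [matForm_eq_sum, matAbs, Finset.sum_mul]
  refine (norm_sum_le _ _).trans (Finset.sum_le_sum fun i _ => ?_)
  rw [Finset.sum_mul]
  refine (norm_sum_le _ _).trans (Finset.sum_le_sum fun j _ => ?_)
  rw [norm_mul, norm_mul, RCLike.norm_conj]
  gcongr
  · exact PiLp.norm_apply_le w j
  · exact PiLp.norm_apply_le z i

theorem matForm_sub_left (A : Matrix (Fin n) (Fin n) ℂ) (w w' z : Cn n) :
    matForm A (w - w') z = matForm A w z - matForm A w' z := by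
  simp [matForm_eq_sum, sub_mul, mul_sub, Finset.sum_sub_distrib]

theorem matForm_sub_right (A : Matrix (Fin n) (Fin n) ℂ) (w z z' : Cn n) :
    matForm A w (z - z') = matForm A w z - matForm A w z' := by
  simp [matForm_eq_sum, mul_sub, Finset.sum_sub_distrib]

theorem norm_entry_le_matAbs (A : Matrix (Fin n) (Fin n) ℂ) (i j : Fin n) :
    ‖A i j‖ ≤ matAbs A :=
  (Finset.single_le_sum (f := fun j => ‖A i j‖) (fun _ _ => norm_nonneg _)
    (Finset.mem_univ j)).trans
    (Finset.single_le_sum (f := fun i => ∑ j, ‖A i j‖)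
      (fun _ _ => Finset.sum_nonneg fun _ _ => norm_nonneg _) (Finset.mem_univ i))

theorem aestronglyMeasurable_matForm {α : Type*} [MeasurableSpace α] {μ : Measure α}
    {A : α → Matrix (Fin n) (Fin n) ℂ} {w z : α → Cn n}
    (hA : ∀ i j, AEStronglyMeasurable (fun x => A x i j) μ)
    (hw : AEStronglyMeasurable w μ) (hz : AEStronglyMeasurable z μ) :
    AEStronglyMeasurable (fun x => matForm (A x) (w x) (z x)) μ := by
  have hc : ∀ {w : α → Cn n}, AEStronglyMeasurable w μ → ∀ j,
      AEStronglyMeasurable (fun x => w x j) μ := fun hw j =>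
    (by fun_prop : Continuous fun v : Cn n => v j).comp_aestronglyMeasurable hw
  simp only [matForm_eq_sum]
  refine Finset.aestronglyMeasurable_fun_sum _ fun i _ =>
    Finset.aestronglyMeasurable_fun_sum _ fun j _ => (hA i j).mul ((hc hw j).mul ?_)
  exact Complex.continuous_conj.comp_aestronglyMeasurable (hc hz i)

theorem contDiff_mul_conj {E : Type*} [NormedAddCommGroup E] [NormedSpace ℝ E] {w z : E → Cn n}
    (hw : ContDiff ℝ 1 w) (hz : ContDiff ℝ 1 z) (i j : Fin n) :
    ContDiff ℝ 1 (fun x => w x j * starRingEnd ℂ (z x i)) := by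
  have hp : ∀ k : Fin n, ContDiff ℝ 1 fun v : Cn n => v k := fun k =>
    ((EuclideanSpace.proj k : Cn n →L[ℂ] ℂ).restrictScalars ℝ).contDiff
  exact ((hp j).comp hw).mul (Complex.conjCLE.contDiff.comp ((hp i).comp hz))

theorem norm_fderiv_mul_conj_le {E : Type*} [NormedAddCommGroup E] [NormedSpace ℝ E]
    {w z : E → Cn n} {x : E} (hw : DifferentiableAt ℝ w x) (hz : DifferentiableAt ℝ z x)
    (i j : Fin n) :
    ‖fderiv ℝ (fun x => w x j * starRingEnd ℂ (z x i)) x‖ ≤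
      ‖w x‖ * ‖fderiv ℝ z x‖ + ‖z x‖ * ‖fderiv ℝ w x‖ := by
  have h1 : HasFDerivAt (fun x => w x j)
      (((EuclideanSpace.proj j : Cn n →L[ℂ] ℂ).restrictScalars ℝ).comp (fderiv ℝ w x)) x :=
    ((EuclideanSpace.proj j : Cn n →L[ℂ] ℂ).restrictScalars ℝ).hasFDerivAt.comp x hw.hasFDerivAt
  have h2 : HasFDerivAt (fun x => starRingEnd ℂ (z x i))
      ((Complex.conjCLE : ℂ →L[ℝ] ℂ).comp
        (((EuclideanSpace.proj i : Cn n →L[ℂ] ℂ).restrictScalars ℝ).comp (fderiv ℝ z x))) x :=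
    (Complex.conjCLE : ℂ →L[ℝ] ℂ).hasFDerivAt.comp x
      (((EuclideanSpace.proj i : Cn n →L[ℂ] ℂ).restrictScalars ℝ).hasFDerivAt.comp x
        hz.hasFDerivAt)
  rw [(h1.fun_mul h2).fderiv]
  refine ContinuousLinearMap.opNorm_le_bound _ (by positivity) fun v => ?_
  have h3 : ‖(fderiv ℝ w x v) j‖ ≤ ‖fderiv ℝ w x‖ * ‖v‖ :=
    (PiLp.norm_apply_le _ j).trans (ContinuousLinearMap.le_opNorm _ _)
  have h4 : ‖(fderiv ℝ z x v) i‖ ≤ ‖fderiv ℝ z x‖ * ‖v‖ :=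
    (PiLp.norm_apply_le _ i).trans (ContinuousLinearMap.le_opNorm _ _)
  calc _ = ‖w x j * starRingEnd ℂ ((fderiv ℝ z x v) i) +
        starRingEnd ℂ (z x i) * (fderiv ℝ w x v) j‖ := by simp
    _ ≤ ‖w x j‖ * ‖(fderiv ℝ z x v) i‖ + ‖z x i‖ * ‖(fderiv ℝ w x v) j‖ := by
        refine (norm_add_le _ _).trans_eq ?_
        rw [norm_mul, norm_mul, RCLike.norm_conj, RCLike.norm_conj]
    _ ≤ ‖w x‖ * (‖fderiv ℝ z x‖ * ‖v‖) + ‖z x‖ * (‖fderiv ℝ w x‖ * ‖v‖) := by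
        gcongr
        · exact PiLp.norm_apply_le _ j
        · exact PiLp.norm_apply_le _ i
    _ = _ := by ring

end Sesq

/-! ### Sufficiency of the condition on the means -/

section Sufficiency

variable {d n : ℕ} {b : Module.Basis (Fin d) ℝ (Rd d)} {a : Rd d} {Ω : Set (Rd d)} {η : ℝ}

theorem norm_setIntegral_le_of_lintegral_le {s : Set (Rd d)} {g : Rd d → ℂ} {c : ℝ}
    (hc : 0 ≤ c) (hg : ∫⁻ x in s, ‖g x‖ₑ ≤ ENNReal.ofReal c) : ‖∫ x in s, g x‖ ≤ c := by
  have := (enorm_integral_le_lintegral_enorm g).trans hg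
  rw [← ofReal_norm] at this
  exact (ENNReal.ofReal_le_ofReal_iff hc).1 this

theorem lintegral_enorm_mul_enorm_le {α F : Type*} [MeasurableSpace α] {μ : Measure α}
    [NormedAddCommGroup F] {G : Type*} [NormedAddCommGroup G] {f : α → F} {g : α → G}
    (hf : AEStronglyMeasurable f μ) (hg : AEStronglyMeasurable g μ) {α' β : ℝ} (hα : 0 ≤ α')
    (hβ : 0 ≤ β) (hfa : ∫⁻ x, ‖f x‖ₑ ^ 2 ∂μ ≤ ENNReal.ofReal (α' ^ 2))
    (hgb : ∫⁻ x, ‖g x‖ₑ ^ 2 ∂μ ≤ ENNReal.ofReal (β ^ 2)) :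
    ∫⁻ x, ‖f x‖ₑ * ‖g x‖ₑ ∂μ ≤ ENNReal.ofReal (α' * β) :=
  lintegral_mul_enorm_le_sqrt hf.enorm hg.enorm hα hβ hfa hgb

theorem lintegral_enorm_matForm_le {α : Type*} [MeasurableSpace α] {μ : Measure α}
    {A : α → Matrix (Fin n) (Fin n) ℂ} {K : ℝ} (hK : 0 ≤ K) (hAK : ∀ᵐ x ∂μ, matAbs (A x) ≤ K)
    {w z : α → Cn n} (hw : AEStronglyMeasurable w μ) (hz : AEStronglyMeasurable z μ)
    {α' β : ℝ} (hα : 0 ≤ α') (hβ : 0 ≤ β)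
    (hwa : ∫⁻ x, ‖w x‖ₑ ^ 2 ∂μ ≤ ENNReal.ofReal (α' ^ 2))
    (hzb : ∫⁻ x, ‖z x‖ₑ ^ 2 ∂μ ≤ ENNReal.ofReal (β ^ 2)) :
    ∫⁻ x, ‖matForm (A x) (w x) (z x)‖ₑ ∂μ ≤ ENNReal.ofReal (K * (α' * β)) := by
  calc ∫⁻ x, ‖matForm (A x) (w x) (z x)‖ₑ ∂μ
      ≤ ∫⁻ x, ENNReal.ofReal K * (‖w x‖ₑ * ‖z x‖ₑ) ∂μ := by
        refine lintegral_mono_ae ?_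
        filter_upwards [hAK] with x hx
        rw [← ofReal_norm, ← ofReal_norm, ← ofReal_norm, ← ENNReal.ofReal_mul (norm_nonneg _),
          ← ENNReal.ofReal_mul hK]
        refine ENNReal.ofReal_le_ofReal ((norm_matForm_le _ _ _).trans ?_)
        gcongr
    _ = ENNReal.ofReal K * ∫⁻ x, ‖w x‖ₑ * ‖z x‖ₑ ∂μ :=
        lintegral_const_mul' _ _ ENNReal.ofReal_ne_top
    _ ≤ ENNReal.ofReal K * ENNReal.ofReal (α' * β) := by
        gcongr
        exact lintegral_enorm_mul_enorm_le hw hz hα hβ hwa hzb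
    _ = _ := (ENNReal.ofReal_mul hK).symm

theorem integrable_matForm {α : Type*} [MeasurableSpace α] {μ : Measure α}
    {A : α → Matrix (Fin n) (Fin n) ℂ} {K : ℝ} (hK : 0 ≤ K)
    (hA : ∀ i j, AEStronglyMeasurable (fun x => A x i j) μ)
    (hAK : ∀ᵐ x ∂μ, matAbs (A x) ≤ K)
    {w z : α → Cn n} (hw : AEStronglyMeasurable w μ) (hz : AEStronglyMeasurable z μ)
    {α' β : ℝ} (hα : 0 ≤ α') (hβ : 0 ≤ β)
    (hwa : ∫⁻ x, ‖w x‖ₑ ^ 2 ∂μ ≤ ENNReal.ofReal (α' ^ 2))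
    (hzb : ∫⁻ x, ‖z x‖ₑ ^ 2 ∂μ ≤ ENNReal.ofReal (β ^ 2)) :
    Integrable (fun x => matForm (A x) (w x) (z x)) μ :=
  ⟨aestronglyMeasurable_matForm hA hw hz,
    (lintegral_enorm_matForm_le hK hAK hw hz hα hβ hwa hzb).trans_lt ENNReal.ofReal_lt_top⟩

/-- The constant in the estimate on the cells inside the domain. -/
noncomputable def cellConst (b : Module.Basis (Fin d) ℝ (Rd d)) (K η ρ : ℝ) : ℝ :=
  2 * (K * ((∑ i, ‖b i‖) * η) * 2 ^ d) + (volume (ZSpan.fundamentalDomain b)).toReal⁻¹ * ρ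

theorem norm_setIntegral_deepRegion_matForm_le_of_contDiff (hη : 0 < η) {K ρ : ℝ} (hK : 0 ≤ K)
    (hρ : 0 ≤ ρ) {A : Rd d → Matrix (Fin n) (Fin n) ℂ}
    (hA : ∀ i j, AEStronglyMeasurable (fun x => A x i j) (volume.restrict Ω))
    (hAK : ∀ᵐ x ∂volume.restrict Ω, matAbs (A x) ≤ K)
    (hmean : ∀ γ ∈ innerLattice b a Ω η, matAbs (cellMean b a η γ A) ≤ ρ)
    {w z : Rd d → Cn n} (hw : ContDiff ℝ ∞ w) (hz : ContDiff ℝ ∞ z) {α β : ℝ} (hα : 0 ≤ α)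
    (hβ : 0 ≤ β)
    (hwα : ∫⁻ x in deepRegion b a Ω η, (‖w x‖ₑ ^ 2 + ‖fderiv ℝ w x‖ₑ ^ 2) ≤
      ENNReal.ofReal (α ^ 2))
    (hzβ : ∫⁻ x in deepRegion b a Ω η, (‖z x‖ₑ ^ 2 + ‖fderiv ℝ z x‖ₑ ^ 2) ≤
      ENNReal.ofReal (β ^ 2)) :
    ‖∫ x in deepRegion b a Ω η, matForm (A x) (w x) (z x)‖ ≤
      n ^ 2 * (cellConst b K η ρ * (α * β)) := by
  set G := deepRegion b a Ω η
  have hGΩ : G ⊆ Ω := deepRegion_subset hη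
  have hAG : ∀ i j, AEStronglyMeasurable (fun x => A x i j) (volume.restrict G) :=
    fun i j => (hA i j).mono_set hGΩ
  have hAKΩ : ∀ i j, ∀ᵐ x ∂volume.restrict Ω, ‖A x i j‖ ≤ K := fun i j => by
    filter_upwards [hAK] with x hx
    exact (norm_entry_le_matAbs _ i j).trans hx
  have hw1 : ∫⁻ x in G, ‖w x‖ₑ ^ 2 ≤ ENNReal.ofReal (α ^ 2) :=
    (lintegral_mono fun x => le_self_add).trans hwα
  have hw2 : ∫⁻ x in G, ‖fderiv ℝ w x‖ₑ ^ 2 ≤ ENNReal.ofReal (α ^ 2) :=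
    (lintegral_mono fun x => le_add_self).trans hwα
  have hz1 : ∫⁻ x in G, ‖z x‖ₑ ^ 2 ≤ ENNReal.ofReal (β ^ 2) :=
    (lintegral_mono fun x => le_self_add).trans hzβ
  have hz2 : ∫⁻ x in G, ‖fderiv ℝ z x‖ₑ ^ 2 ≤ ENNReal.ofReal (β ^ 2) :=
    (lintegral_mono fun x => le_add_self).trans hzβ
  have hwm : ∀ {μ : Measure (Rd d)}, AEStronglyMeasurable w μ :=
    hw.continuous.aestronglyMeasurable
  have hzm : ∀ {μ : Measure (Rd d)}, AEStronglyMeasurable z μ :=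
    hz.continuous.aestronglyMeasurable
  have hwdm : ∀ {μ : Measure (Rd d)}, AEStronglyMeasurable (fderiv ℝ w) μ :=
    (hw.continuous_fderiv (by simp)).aestronglyMeasurable
  have hzdm : ∀ {μ : Measure (Rd d)}, AEStronglyMeasurable (fderiv ℝ z) μ :=
    (hz.continuous_fderiv (by simp)).aestronglyMeasurable
  let f : Fin n → Fin n → Rd d → ℂ := fun i j x => w x j * starRingEnd ℂ (z x i)
  have hfs : ∀ i j, ContDiff ℝ 1 (f i j) := fun i j =>
    contDiff_mul_conj (hw.of_le (by simp)) (hz.of_le (by simp)) i j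
  have hf0 : ∀ i j, ∫⁻ x in G, ‖f i j x‖ₑ ≤ ENNReal.ofReal (α * β) := by
    intro i j
    refine le_trans (lintegral_mono fun x => ?_)
      (lintegral_enorm_mul_enorm_le hwm hzm hα hβ hw1 hz1)
    rw [← ofReal_norm, ← ofReal_norm, ← ofReal_norm, ← ENNReal.ofReal_mul (norm_nonneg _)]
    refine ENNReal.ofReal_le_ofReal ?_
    rw [norm_mul, RCLike.norm_conj]
    gcongr
    · exact PiLp.norm_apply_le _ j
    · exact PiLp.norm_apply_le _ i
  -- The two terms of the Leibniz rule account for the factor 2 in `cellConst`.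
  have hf1 : ∀ i j, ∫⁻ x in G, ‖fderiv ℝ (f i j) x‖ₑ ≤ ENNReal.ofReal (2 * (α * β)) := by
    intro i j
    calc ∫⁻ x in G, ‖fderiv ℝ (f i j) x‖ₑ
        ≤ ∫⁻ x in G, (‖w x‖ₑ * ‖fderiv ℝ z x‖ₑ + ‖z x‖ₑ * ‖fderiv ℝ w x‖ₑ) := by
          refine lintegral_mono fun x => ?_
          have := ENNReal.ofReal_le_ofReal (norm_fderiv_mul_conj_le
            (hw.differentiable (by simp) x) (hz.differentiable (by simp) x) i j)
          rw [ENNReal.ofReal_add (by positivity) (by positivity),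
            ENNReal.ofReal_mul (norm_nonneg _), ENNReal.ofReal_mul (norm_nonneg _)] at this
          simpa only [ofReal_norm] using this
      _ = (∫⁻ x in G, ‖w x‖ₑ * ‖fderiv ℝ z x‖ₑ) + ∫⁻ x in G, ‖z x‖ₑ * ‖fderiv ℝ w x‖ₑ :=
          lintegral_add_left' (hwm.enorm.mul hzdm.enorm) _
      _ ≤ ENNReal.ofReal (α * β) + ENNReal.ofReal (β * α) :=
          add_le_add (lintegral_enorm_mul_enorm_le hwm hzdm hα hβ hw1 hz2)
            (lintegral_enorm_mul_enorm_le hzm hwdm hβ hα hz1 hw2)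
      _ = _ := by
          rw [← ENNReal.ofReal_add (by positivity) (by positivity)]; congr 1; ring
  have hq0 : volume (ZSpan.fundamentalDomain b) ≠ 0 := ZSpan.measure_fundamentalDomain_ne_zero b
  have hqt : volume (ZSpan.fundamentalDomain b) ≠ ⊤ :=
    (ZSpan.fundamentalDomain_isBounded b).measure_lt_top.ne
  have hbn : 0 ≤ ∑ i, ‖b i‖ := Finset.sum_nonneg fun i _ => norm_nonneg _
  have hc0 : 0 ≤ cellConst b K η ρ := by unfold cellConst; positivity
  have h2d : (2 : ℝ≥0∞) ^ d = ENNReal.ofReal (2 ^ d) := by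
    rw [ENNReal.ofReal_pow (by norm_num), ENNReal.ofReal_ofNat]
  have hterm : ∀ i j, ‖∫ x in G, A x i j * f i j x‖ ≤ cellConst b K η ρ * (α * β) := by
    intro i j
    have h1 := enorm_setIntegral_deepRegion_mul_le (b := b) (a := a) hη (hA i j) (hAKΩ i j)
      (fun γ hγ => (norm_entry_le_matAbs (cellMean b a η γ A) i j).trans (hmean γ hγ)) (hfs i j)
    have h2 : ‖∫ x in G, A x i j * f i j x‖ₑ ≤ ENNReal.ofReal (cellConst b K η ρ * (α * β)) := by
      refine h1.trans ((add_le_add (mul_le_mul' le_rfl (hf1 i j))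
        (mul_le_mul' le_rfl (hf0 i j))).trans_eq ?_)
      rw [← ENNReal.ofReal_toReal hqt, ← ENNReal.ofReal_inv_of_pos
        (ENNReal.toReal_pos hq0 hqt), h2d, ← ENNReal.ofReal_mul hK,
        ← ENNReal.ofReal_mul (by positivity), ← ENNReal.ofReal_mul (by positivity),
        ← ENNReal.ofReal_mul (by positivity), ← ENNReal.ofReal_mul (by positivity),
        ← ENNReal.ofReal_add (by positivity) (by positivity), cellConst]
      congr 1; ring
    rw [← ofReal_norm] at h2
    exact (ENNReal.ofReal_le_ofReal_iff (by positivity)).1 h2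
  have hint : ∀ i j, IntegrableOn (fun x => A x i j * f i j x) G := by
    intro i j
    refine Integrable.bdd_mul (c := K) ⟨(hfs i j).continuous.aestronglyMeasurable, ?_⟩ (hAG i j)
      (ae_restrict_of_ae_restrict_of_subset hGΩ (hAKΩ i j))
    exact (hf0 i j).trans_lt ENNReal.ofReal_lt_top
  simp only [matForm_eq_sum]
  rw [integral_finsetSum _ fun i _ => integrable_finsetSum _ fun j _ => hint i j]
  calc _ ≤ ∑ i : Fin n, ∑ j : Fin n, cellConst b K η ρ * (α * β) := by
        refine (norm_sum_le _ _).trans (Finset.sum_le_sum fun i _ => ?_)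
        rw [integral_finsetSum _ fun j _ => hint i j]
        exact (norm_sum_le _ _).trans (Finset.sum_le_sum fun j _ => hterm i j)
    _ = _ := by simp; ring

theorem norm_setIntegral_deepRegion_matForm_le (hΩ : IsOpen Ω) (hη : 0 < η) {K ρ : ℝ}
    (hK : 0 ≤ K) (hρ : 0 ≤ ρ) {A : Rd d → Matrix (Fin n) (Fin n) ℂ}
    (hA : ∀ i j, AEStronglyMeasurable (fun x => A x i j) (volume.restrict Ω))
    (hAK : ∀ᵐ x ∂volume.restrict Ω, matAbs (A x) ≤ K)
    (hmean : ∀ γ ∈ innerLattice b a Ω η, matAbs (cellMean b a η γ A) ≤ ρ) (u v : W12 Ω n) :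
    ‖∫ x in deepRegion b a Ω η, matForm (A x) (u.toFun x) (v.toFun x)‖ ≤
      n ^ 2 * (cellConst b K η ρ * (u.norm * v.norm)) := by
  set G := deepRegion b a Ω η with hG
  have hGΩ : G ⊆ Ω := deepRegion_subset hη
  -- The radii `η / (k + 1)` do not exceed the depth `η` of `G`, so the gradient bound holds on all
  -- of `G`.
  obtain ⟨w, hws, hwL, hwA, -, hwlim⟩ := exists_smooth_approx hΩ u hη
  obtain ⟨z, hzs, hzL, hzA, -, hzlim⟩ := exists_smooth_approx hΩ v hη
  have hAG : ∀ i j, AEStronglyMeasurable (fun x => A x i j) (volume.restrict G) :=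
    fun i j => (hA i j).mono_set hGΩ
  have hAKG : ∀ᵐ x ∂volume.restrict G, matAbs (A x) ≤ K :=
    ae_restrict_of_ae_restrict_of_subset hGΩ hAK
  have hmono : ∀ g : Rd d → ℝ≥0∞, ∫⁻ x in G, g x ≤ ∫⁻ x in Ω, g x := fun g =>
    lintegral_mono_set hGΩ
  have hum : AEStronglyMeasurable u.toFun (volume.restrict G) := u.memLp_toFun.1.mono_set hGΩ
  have hvm : AEStronglyMeasurable v.toFun (volume.restrict G) := v.memLp_toFun.1.mono_set hGΩ
  have hwm : ∀ k, AEStronglyMeasurable (w k) (volume.restrict G) :=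
    fun k => (hws k).continuous.aestronglyMeasurable
  have hzm : ∀ k, AEStronglyMeasurable (z k) (volume.restrict G) :=
    fun k => (hzs k).continuous.aestronglyMeasurable
  have hu2 := (hmono _).trans u.lintegral_toFun_sq_le
  have hv2 := (hmono _).trans v.lintegral_toFun_sq_le
  have hball : ∀ (k : ℕ), ∀ x ∈ G, Metric.closedBall x (η / (k + 1)) ⊆ Ω := fun k x hx =>
    (Metric.closedBall_subset_closedBall (div_le_self hη.le (by simp))).trans
      (closedBall_subset_of_mem_deepRegion hx)
  have hkey : ∀ δ : ℝ, 0 < δ →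
      ‖∫ x in G, matForm (A x) (u.toFun x) (v.toFun x)‖ ≤
      n ^ 2 * (cellConst b K η ρ * (u.norm * v.norm)) + K * (u.norm + v.norm) * δ := by
    intro δ hδ
    have hδ2 : 0 < ENNReal.ofReal (δ ^ 2) := ENNReal.ofReal_pos.2 (by positivity)
    obtain ⟨k, hk1, hk2⟩ := ((ENNReal.tendsto_nhds_zero.1 hwlim _ hδ2).and
      (ENNReal.tendsto_nhds_zero.1 hzlim _ hδ2)).exists
    have hdu : ∫⁻ x in G, ‖(u.toFun - w k) x‖ₑ ^ 2 ≤ ENNReal.ofReal (δ ^ 2) := by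
      refine ((hmono _).trans_eq ?_).trans hk1
      refine lintegral_congr fun x => ?_
      rw [Pi.sub_apply, ← enorm_neg, neg_sub]
    have hdv : ∫⁻ x in G, ‖(v.toFun - z k) x‖ₑ ^ 2 ≤ ENNReal.ofReal (δ ^ 2) := by
      refine ((hmono _).trans_eq ?_).trans hk2
      refine lintegral_congr fun x => ?_
      rw [Pi.sub_apply, ← enorm_neg, neg_sub]
    have hw2 := (hmono _).trans (hwL k)
    have h0 := norm_setIntegral_deepRegion_matForm_le_of_contDiff hη hK hρ hA hAK hmean
      (hws k) (hzs k) u.norm_nonneg v.norm_nonneg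
      (hwA k G measurableSet_deepRegion (hball k)) (hzA k G measurableSet_deepRegion (hball k))
    have hz2 := (hmono _).trans (hzL k)
    have i0 := integrable_matForm hK hAG hAKG (hwm k) (hzm k) u.norm_nonneg v.norm_nonneg hw2 hz2
    have i1 := integrable_matForm hK hAG hAKG (hum.sub (hwm k)) hvm hδ.le v.norm_nonneg hdu hv2
    have i2 := integrable_matForm hK hAG hAKG (hwm k) (hvm.sub (hzm k)) u.norm_nonneg hδ.le hw2 hdv
    have l1 := lintegral_enorm_matForm_le hK hAKG (hum.sub (hwm k)) hvm hδ.le v.norm_nonneg hdu hv2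
    have l2 := lintegral_enorm_matForm_le hK hAKG (hwm k) (hvm.sub (hzm k)) u.norm_nonneg hδ.le
      hw2 hdv
    have n1 := norm_setIntegral_le_of_lintegral_le (by have := v.norm_nonneg; positivity) l1
    have n2 := norm_setIntegral_le_of_lintegral_le (by have := u.norm_nonneg; positivity) l2
    have hsplit : ∫ x in G, matForm (A x) (u.toFun x) (v.toFun x) =
        (∫ x in G, matForm (A x) (w k x) (z k x)) +
        ((∫ x in G, matForm (A x) ((u.toFun - w k) x) (v.toFun x)) +
        ∫ x in G, matForm (A x) (w k x) ((v.toFun - z k) x)) := by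
      have i12 := i1.add i2
      simp only [Pi.add_def] at i12
      rw [← integral_add i1 i2, ← integral_add i0 i12]
      refine integral_congr_ae (Eventually.of_forall fun x => ?_)
      simp only [Pi.sub_apply, matForm_sub_left, matForm_sub_right]
      ring
    rw [hsplit]
    refine (norm_add_le _ _).trans ((add_le_add h0 ((norm_add_le _ _).trans
      (add_le_add n1 n2))).trans_eq ?_)
    ring
  refine le_of_forall_pos_le_add fun ε hε => ?_
  have hc : 0 ≤ K * (u.norm + v.norm) := by
    have := u.norm_nonneg; have := v.norm_nonneg; positivity
  refine (hkey (ε / (K * (u.norm + v.norm) + 1)) (by positivity)).trans ?_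
  gcongr
  rw [mul_div_assoc', div_le_iff₀ (by positivity)]
  nlinarith

/-- The cells inside and the boundary layer are combined here; `C` depends on `A` only through `K`.
-/
theorem IsRegularDomain.exists_pairing_bound [NeZero d] (hΩ : IsRegularDomain Ω) (n : ℕ)
    (b : Module.Basis (Fin d) ℝ (Rd d)) (a : Rd d) {K : ℝ} (hK : 0 ≤ K) :
    ∃ C : ℝ, 0 < C ∧ ∀ (A : Rd d → Matrix (Fin n) (Fin n) ℂ) (η ρ : ℝ), 0 < η → 0 ≤ ρ →
      (∀ i j, AEStronglyMeasurable (fun x => A x i j) (volume.restrict Ω)) →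
      (∀ᵐ x ∂volume.restrict Ω, matAbs (A x) ≤ K) →
      (∀ γ ∈ innerLattice b a Ω η, matAbs (cellMean b a η γ A) ≤ ρ) →
      ∀ u v : W12 Ω n, ‖pairing A u v‖ ≤ C * (ρ + η) * (u.norm * v.norm) := by
  obtain ⟨T, C₁, hT, hC₁, hlayer⟩ := hΩ.exists_boundaryLayer_estimate n
  set D : ℝ := ∑ i, ‖b i‖ with hD
  have hD0 : 0 ≤ D := Finset.sum_nonneg fun i _ => norm_nonneg _
  set q : ℝ := (volume (ZSpan.fundamentalDomain b)).toReal⁻¹ with hq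
  have hq0 : 0 ≤ q := inv_nonneg.2 ENNReal.toReal_nonneg
  refine ⟨K * (D + 1) / T + n ^ 2 * (2 * (K * D * 2 ^ d)) + n ^ 2 * q + K * (C₁ * (D + 1)) + 1,
    by positivity, fun A η ρ hη hρ hA hAK hmean u v => ?_⟩
  have hun := u.norm_nonneg
  have hvn := v.norm_nonneg
  have hpair : pairing A u v = ∫ x in Ω, matForm (A x) (u.toFun x) (v.toFun x) := rfl
  have hu2 := u.lintegral_toFun_sq_le
  have hv2 := v.lintegral_toFun_sq_le
  set R := (D + 1) * η with hR
  have hR0 : 0 < R := by positivity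
  set X := u.norm * v.norm with hX
  have hX0 : 0 ≤ X := by positivity
  -- If the layer is wider than the collar, `η` is bounded below and the trivial bound `K` is itself
  -- `O(η)`.
  rcases lt_or_ge T R with hTR | hRT
  · have h1 : ‖pairing A u v‖ ≤ K * X := by
      rw [hpair]
      exact norm_setIntegral_le_of_lintegral_le (by positivity) (lintegral_enorm_matForm_le hK hAK u.memLp_toFun.1
        v.memLp_toFun.1 hun hvn hu2 hv2)
    have h2 : K ≤ K * (D + 1) / T * η := by
      rw [div_mul_eq_mul_div, le_div_iff₀ hT, mul_assoc]
      exact mul_le_mul_of_nonneg_left hTR.le hK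
    refine h1.trans (mul_le_mul_of_nonneg_right (h2.trans ?_) hX0)
    refine mul_le_mul ?_ (by linarith) hη.le (by positivity)
    have : 0 ≤ n ^ 2 * (2 * (K * D * 2 ^ d)) + n ^ 2 * q + K * (C₁ * (D + 1)) + 1 := by positivity
    linarith
  · set G := deepRegion b a Ω η with hG
    have hGΩ : G ⊆ Ω := deepRegion_subset hη
    have hint := integrable_matForm hK hA hAK u.memLp_toFun.1 v.memLp_toFun.1 hun hvn hu2 hv2
    have hsplit : pairing A u v = (∫ x in G, matForm (A x) (u.toFun x) (v.toFun x)) +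
        ∫ x in Ω \ G, matForm (A x) (u.toFun x) (v.toFun x) := by
      rw [hpair, ← integral_inter_add_sdiff measurableSet_deepRegion hint, inter_eq_right.2 hGΩ]
    have h1 := norm_setIntegral_deepRegion_matForm_le (b := b) (a := a) hΩ.isOpen hη hK hρ hA hAK
      hmean u v
    have hsub : Ω \ G ⊆ {x | x ∈ Ω ∧ ∃ p ∈ frontier Ω, dist x p ≤ R} := fun x hx =>
      ⟨hx.1, exists_frontier_dist_le_of_notMem_deepRegion hΩ.isOpen hη hx.1 hx.2⟩
    -- Each argument contributes the square root of the layer width, so their product is linear in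
    -- `η`.
    have hlay : ∀ w : W12 Ω n, ∫⁻ x in Ω \ G, ‖w.toFun x‖ₑ ^ 2 ≤
        ENNReal.ofReal ((√(C₁ * R) * w.norm) ^ 2) := by
      intro w
      refine (lintegral_mono_set hsub).trans ((hlayer w R hR0 hRT).trans_eq ?_)
      rw [mul_pow, Real.sq_sqrt (by positivity)]
    have h2 : ‖∫ x in Ω \ G, matForm (A x) (u.toFun x) (v.toFun x)‖ ≤ K * (C₁ * R * X) := by
      refine norm_setIntegral_le_of_lintegral_le (by positivity) ((lintegral_enorm_matForm_le hK
        (ae_restrict_of_ae_restrict_of_subset sdiff_subset hAK)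
        (u.memLp_toFun.1.mono_set sdiff_subset) (v.memLp_toFun.1.mono_set sdiff_subset)
        (by positivity) (by positivity) (hlay u) (hlay v)).trans_eq ?_)
      congr 2
      have := Real.mul_self_sqrt (show 0 ≤ C₁ * R by positivity)
      calc _ = (√(C₁ * R) * √(C₁ * R)) * X := by rw [hX]; ring
        _ = _ := by rw [this]
    rw [hsplit]
    refine (norm_add_le _ _).trans ((add_le_add h1 h2).trans ?_)
    have e1 : (n : ℝ) ^ 2 * (cellConst b K η ρ * X) + K * (C₁ * R * X) =
        (n ^ 2 * (2 * (K * D * 2 ^ d)) * η + n ^ 2 * q * ρ + K * (C₁ * (D + 1)) * η) * X := by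
      rw [cellConst, hR]; ring
    rw [e1]
    refine mul_le_mul_of_nonneg_right ?_ hX0
    have a1 : 0 ≤ K * (D + 1) / T := by positivity
    have a2 : 0 ≤ n ^ 2 * (2 * (K * D * 2 ^ d)) := by positivity
    have a3 : 0 ≤ n ^ 2 * q := by positivity
    have a4 : 0 ≤ K * (C₁ * (D + 1)) := by positivity
    nlinarith [mul_nonneg a1 hρ, mul_nonneg a1 hη.le, mul_nonneg a2 hρ, mul_nonneg a3 hη.le,
      mul_nonneg a4 hρ]

end Sufficiency

/-! ### Cutoff functions of cells -/

theorem exists_interval_cutoff : ∃ L : ℝ, 0 ≤ L ∧ ∀ θ : ℝ, 0 < θ → ∃ h : ℝ → ℝ,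
    ContDiff ℝ ∞ h ∧ (∀ t, 0 ≤ h t) ∧ (∀ t, h t ≤ 1) ∧ (∀ t ∈ Icc θ (1 - θ), h t = 1) ∧
      (∀ t, t ∉ Icc (θ / 2) (1 - θ / 2) → h t = 0) ∧ ∀ t, |deriv h t| ≤ L / θ := by
  have hS : ContDiff ℝ ∞ Real.smoothTransition := Real.smoothTransition.contDiff
  -- Outside `[0, 1]` the transition function takes an extreme value, so its derivative vanishes; on
  -- `[0, 1]` compactness applies.
  obtain ⟨L, hL⟩ : ∃ L : ℝ, ∀ t, |deriv Real.smoothTransition t| ≤ L := by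
    obtain ⟨L, hL⟩ := (isCompact_Icc (a := (0 : ℝ)) (b := 1)).exists_bound_of_continuousOn
      (hS.continuous_deriv (by simp)).continuousOn
    refine ⟨L, fun t => ?_⟩
    have h0 : 0 ≤ L := (norm_nonneg _).trans (hL 0 (by simp))
    by_cases ht : t ∈ Icc (0 : ℝ) 1
    · exact hL t ht
    · suffices h : deriv Real.smoothTransition t = 0 by simpa [h]
      rw [mem_Icc, not_and_or, not_le, not_le] at ht
      rcases ht with ht | ht
      · refine IsLocalMin.deriv_eq_zero (Eventually.of_forall fun s => ?_)
        rw [Real.smoothTransition.zero_of_nonpos ht.le]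
        exact Real.smoothTransition.nonneg s
      · refine IsLocalMax.deriv_eq_zero (Eventually.of_forall fun s => ?_)
        rw [Real.smoothTransition.one_of_one_le ht.le]
        exact Real.smoothTransition.le_one s
  have hL0 : 0 ≤ L := (abs_nonneg _).trans (hL 0)
  refine ⟨4 * L, by positivity, fun θ hθ => ⟨fun t => Real.smoothTransition ((2 / θ) * t - 1) *
    Real.smoothTransition ((2 / θ) * (1 - t) - 1), ?_, ?_, ?_, ?_, ?_, ?_⟩⟩
  · exact (hS.comp (by fun_prop)).mul (hS.comp (by fun_prop))
  · exact fun t => mul_nonneg (Real.smoothTransition.nonneg _) (Real.smoothTransition.nonneg _)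
  · exact fun t => mul_le_one₀ (Real.smoothTransition.le_one _) (Real.smoothTransition.nonneg _)
      (Real.smoothTransition.le_one _)
  · rintro t ⟨h1, h2⟩
    have key : ∀ s, θ ≤ s → 1 ≤ 2 / θ * s - 1 := fun s hs => by
      have : 2 ≤ 2 / θ * s := by
        rw [div_mul_eq_mul_div, le_div_iff₀ hθ]; linarith
      linarith
    simp only
    rw [Real.smoothTransition.one_of_one_le (key _ h1),
      Real.smoothTransition.one_of_one_le (key _ (by linarith)), mul_one]
  · intro t ht
    have key : ∀ s, s ≤ θ / 2 → 2 / θ * s - 1 ≤ 0 := fun s hs => by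
      have : 2 / θ * s ≤ 1 := by
        rw [div_mul_eq_mul_div, div_le_iff₀ hθ]; linarith
      linarith
    rw [mem_Icc, not_and_or, not_le, not_le] at ht
    rcases ht with ht | ht
    · simp only
      rw [Real.smoothTransition.zero_of_nonpos (key _ ht.le), zero_mul]
    · simp only
      rw [Real.smoothTransition.zero_of_nonpos (key (1 - t) (by linarith)), mul_zero]
  · intro t
    have hd : ∀ s, HasDerivAt Real.smoothTransition (deriv Real.smoothTransition s) s := fun s =>
      (hS.differentiable (by simp) s).hasDerivAt
    have h1 : HasDerivAt (fun t : ℝ => (2 / θ) * t - 1) (2 / θ) t := by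
      simpa using ((hasDerivAt_id t).const_mul (2 / θ)).sub_const 1
    have h2 : HasDerivAt (fun t : ℝ => (2 / θ) * (1 - t) - 1) (-(2 / θ)) t := by
      simpa using (((hasDerivAt_id t).const_sub 1).const_mul (2 / θ)).sub_const 1
    have h3 := (HasDerivAt.comp t (hd _) h1).fun_mul (HasDerivAt.comp t (hd _) h2)
    simp only [Function.comp_apply] at h3
    rw [h3.deriv]
    set p := deriv Real.smoothTransition (2 / θ * t - 1)
    set q := deriv Real.smoothTransition (2 / θ * (1 - t) - 1)
    have hθ2 : 0 < 2 / θ := by positivity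
    have e1 : |p * (2 / θ) * Real.smoothTransition (2 / θ * (1 - t) - 1)| ≤ L * (2 / θ) * 1 := by
      rw [abs_mul, abs_mul, abs_of_pos hθ2, abs_of_nonneg (Real.smoothTransition.nonneg _)]
      gcongr
      · exact Real.smoothTransition.nonneg _
      · exact hL _
      · exact Real.smoothTransition.le_one _
    have e2 : |Real.smoothTransition (2 / θ * t - 1) * (q * -(2 / θ))| ≤ 1 * (L * (2 / θ)) := by
      rw [abs_mul, abs_mul, abs_neg, abs_of_pos hθ2, abs_of_nonneg (Real.smoothTransition.nonneg _)]
      gcongr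
      · exact Real.smoothTransition.le_one _
      · exact hL _
    refine (abs_add_le _ _).trans ((add_le_add e1 e2).trans_eq ?_)
    ring

section Cutoff

variable {d : ℕ} {b : Module.Basis (Fin d) ℝ (Rd d)} {a : Rd d} {η θ : ℝ} {γ : Rd d}

/-- The cell `□_γ^η` without the layer of relative width `θ` along its boundary. -/
def shrunkCell (b : Module.Basis (Fin d) ℝ (Rd d)) (a : Rd d) (η θ : ℝ) (γ : Rd d) :
    Set (Rd d) :=
  {x | ∀ i, b.repr (η⁻¹ • x - (γ + a)) i ∈ Ioo θ (1 - θ)}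

theorem continuous_cellCoord (b : Module.Basis (Fin d) ℝ (Rd d)) (c : Rd d) (η : ℝ) (i : Fin d) :
    Continuous fun x : Rd d => b.repr (η⁻¹ • x - c) i := by
  have h : Continuous fun z : Rd d => b.repr z i :=
    LinearMap.continuous_of_finiteDimensional (b.coord i)
  exact h.comp (by fun_prop)

theorem isOpen_shrunkCell : IsOpen (shrunkCell b a η θ γ) := by
  have h : shrunkCell b a η θ γ =
      ⋂ i, (fun x : Rd d => b.repr (η⁻¹ • x - (γ + a)) i) ⁻¹' Ioo θ (1 - θ) := by
    ext x; simp [shrunkCell]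
  rw [h]
  exact isOpen_iInter_of_finite fun i => isOpen_Ioo.preimage (continuous_cellCoord b _ η i)

theorem scaledCell_eq_shrunkCell : scaledCell b a η γ = shrunkCell b a η 0 γ := by
  ext x
  rw [mem_scaledCell]
  simp [shrunkCell]

theorem isOpen_scaledCell : IsOpen (scaledCell b a η γ) := by
  rw [scaledCell_eq_shrunkCell]; exact isOpen_shrunkCell

theorem shrunkCell_subset_scaledCell (hθ : 0 ≤ θ) :
    shrunkCell b a η θ γ ⊆ scaledCell b a η γ := by
  intro x hx
  rw [mem_scaledCell]
  exact fun i => Ioo_subset_Ioo hθ (by linarith) (hx i)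

theorem volume_scaledCell (hη : 0 < η) : volume (scaledCell b a η γ) =
    ENNReal.ofReal (η ^ d) * volume (ZSpan.fundamentalDomain b) := by
  rw [measure_congr (scaledCell_ae_eq_halfCell hη), volume_halfCell hη]

/-- The shrunk cell is itself a rescaled cell, of size `(1 - 2 * θ) * η` and with a shift that need
not be a lattice vector. -/
theorem volume_shrunkCell (hη : 0 < η) (hθ : θ < 1 / 2) : volume (shrunkCell b a η θ γ) =
    ENNReal.ofReal (((1 - 2 * θ) * η) ^ d) * volume (ZSpan.fundamentalDomain b) := by
  have h0 : 0 < 1 - 2 * θ := by linarith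
  have h : shrunkCell b a η θ γ = scaledCell b a ((1 - 2 * θ) * η)
      ((1 - 2 * θ)⁻¹ • (γ + a + θ • ∑ i, b i) - a) := by
    ext x
    rw [mem_scaledCell]
    refine forall_congr' fun i => ?_
    have h1 : ((1 - 2 * θ) * η)⁻¹ • x - ((1 - 2 * θ)⁻¹ • (γ + a + θ • ∑ i, b i) - a + a) =
        (1 - 2 * θ)⁻¹ • ((η⁻¹ • x - (γ + a)) - θ • ∑ i, b i) := by
      rw [mul_inv]; module
    have h2 : b.repr (∑ i, b i) i = 1 := by simp [Finsupp.single_apply]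
    rw [h1]
    generalize η⁻¹ • x - (γ + a) = z
    rw [map_smul, map_sub, map_smul, Finsupp.smul_apply, Finsupp.sub_apply, Finsupp.smul_apply, h2,
      smul_eq_mul, smul_eq_mul, mul_one, mem_Ioo, mem_Ioo, inv_mul_lt_iff₀ h0, mul_one,
      ← div_eq_inv_mul, lt_div_iff₀ h0, zero_mul]
    constructor <;> rintro ⟨h3, h4⟩ <;> constructor <;> linarith
  rw [h, volume_scaledCell (by positivity)]

/-- Bernoulli's inequality: `1 - (1 - 2θ)^d ≤ 2dθ`. -/
theorem measureReal_scaledCell_diff_le (hη : 0 < η) (hθ : 0 ≤ θ) (hθ' : θ < 1 / 2) :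
    volume.real (scaledCell b a η γ \ shrunkCell b a η θ γ) ≤
      2 * d * θ * (η ^ d * volume.real (ZSpan.fundamentalDomain b)) := by
  have hfin : volume (shrunkCell b a η θ γ) ≠ ⊤ := by
    rw [volume_shrunkCell hη hθ']
    exact ENNReal.mul_ne_top ENNReal.ofReal_ne_top
      (ZSpan.fundamentalDomain_isBounded b).measure_lt_top.ne
  have h0 : 0 < 1 - 2 * θ := by linarith
  have hfin' : volume (scaledCell b a η γ) ≠ ⊤ := by
    rw [volume_scaledCell hη]
    exact ENNReal.mul_ne_top ENNReal.ofReal_ne_top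
      (ZSpan.fundamentalDomain_isBounded b).measure_lt_top.ne
  rw [measureReal_sdiff (shrunkCell_subset_scaledCell hθ) isOpen_shrunkCell.measurableSet hfin',
    measureReal_def, measureReal_def, volume_shrunkCell hη hθ', volume_scaledCell hη,
    ENNReal.toReal_mul, ENNReal.toReal_mul, ENNReal.toReal_ofReal (by positivity),
    ENNReal.toReal_ofReal (by positivity), mul_pow, measureReal_def]
  have hB : 1 + d * (-2 * θ) ≤ (1 + (-2 * θ)) ^ d :=
    one_add_mul_le_pow (by linarith) d
  have e : (1 + (-2 * θ)) = 1 - 2 * θ := by ring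
  rw [e] at hB
  have hX : 0 ≤ η ^ d * (volume (ZSpan.fundamentalDomain b)).toReal := by positivity
  nlinarith [mul_nonneg (sub_nonneg.2 hB) hX]

/-- A product of interval cutoffs in the cell coordinates; these vary at rate `η⁻¹`, which turns the
slope `L / θ` into `L / (θ * η)`. -/
theorem exists_cell_cutoff (b : Module.Basis (Fin d) ℝ (Rd d)) (a : Rd d) :
    ∃ L : ℝ, 0 ≤ L ∧ ∀ (η θ : ℝ) (γ : Rd d), 0 < η → 0 < θ → ∃ φ : Rd d → ℝ,
      IsTestFunction (scaledCell b a η γ) φ ∧ (∀ x, 0 ≤ φ x) ∧ (∀ x, φ x ≤ 1) ∧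
      (∀ x ∈ shrunkCell b a η θ γ, φ x = 1) ∧ ∀ x, ‖fderiv ℝ φ x‖ ≤ L / (θ * η) := by
  obtain ⟨L, hL0, hL⟩ := exists_interval_cutoff
  let ℓ : Fin d → Rd d →L[ℝ] ℝ := fun i => LinearMap.toContinuousLinearMap (b.coord i)
  refine ⟨L * ∑ i, ‖ℓ i‖, mul_nonneg hL0 (Finset.sum_nonneg fun i _ => norm_nonneg _),
    fun η θ γ hη hθ => ?_⟩
  obtain ⟨h, hs, h0, h1, hone, hzero, hder⟩ := hL θ hθ
  set c := γ + a with hc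
  let t : Fin d → Rd d → ℝ := fun i x => ℓ i (η⁻¹ • x - c)
  have htr : ∀ i x, t i x = b.repr (η⁻¹ • x - c) i := fun i x => rfl
  have ht : ∀ i x, HasFDerivAt (t i) (η⁻¹ • ℓ i) x := by
    intro i x
    have h2 : HasFDerivAt (fun x : Rd d => η⁻¹ • x - c) (η⁻¹ • ContinuousLinearMap.id ℝ (Rd d)) x :=
      ((hasFDerivAt_id x).const_smul η⁻¹).sub_const c
    have h3 := (ℓ i).hasFDerivAt.comp x h2
    refine h3.congr_fderiv ?_
    ext v
    simp
  have htc : ∀ i, ContDiff ℝ ∞ (t i) := fun i => (ℓ i).contDiff.comp (by fun_prop)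
  let φ : Rd d → ℝ := fun x => ∏ i, h (t i x)
  have hφ0 : ∀ x, 0 ≤ φ x := fun x => Finset.prod_nonneg fun i _ => h0 _
  have hφ1 : ∀ x, φ x ≤ 1 := fun x => Finset.prod_le_one (fun i _ => h0 _) fun i _ => h1 _
  have hφs : ContDiff ℝ ∞ φ := contDiff_prod fun i _ => hs.comp (htc i)
  have hcl : IsClosed {x | ∀ i, t i x ∈ Icc (θ / 2) (1 - θ / 2)} := by
    have : {x | ∀ i, t i x ∈ Icc (θ / 2) (1 - θ / 2)} =
        ⋂ i, t i ⁻¹' Icc (θ / 2) (1 - θ / 2) := by ext x; simp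
    rw [this]
    exact isClosed_iInter fun i => isClosed_Icc.preimage (htc i).continuous
  have hts : tsupport φ ⊆ {x | ∀ i, t i x ∈ Icc (θ / 2) (1 - θ / 2)} := by
    refine closure_minimal (fun x hx i => ?_) hcl
    by_contra hcon
    exact hx (Finset.prod_eq_zero (Finset.mem_univ i) (hzero _ hcon))
  have hsub : tsupport φ ⊆ scaledCell b a η γ := by
    intro x hx
    rw [mem_scaledCell]
    intro i
    have := hts hx i
    rw [htr] at this
    exact ⟨by linarith [this.1], by linarith [this.2]⟩
  refine ⟨φ, ⟨hφs, ?_, hsub⟩, hφ0, hφ1, ?_, ?_⟩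
  · exact Metric.isCompact_of_isClosed_isBounded (isClosed_tsupport φ)
      ((isBounded_halfCell hη).subset (hsub.trans scaledCell_subset_halfCell))
  · exact fun x hx => Finset.prod_eq_one fun i _ => hone _ (Ioo_subset_Icc_self (hx i))
  · intro x
    have hd : ∀ i, HasFDerivAt (fun x => h (t i x)) (deriv h (t i x) • (η⁻¹ • ℓ i)) x := fun i =>
      ((hs.differentiable (by simp) _).hasDerivAt).comp_hasFDerivAt x (ht i x)
    have hp : HasFDerivAt φ _ x := HasFDerivAt.finsetProd (u := Finset.univ) fun i _ => hd i
    rw [hp.fderiv]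
    calc _ ≤ ∑ i, L / (θ * η) * ‖ℓ i‖ := by
          refine (norm_sum_le _ _).trans (Finset.sum_le_sum fun i _ => ?_)
          rw [norm_smul, norm_smul, norm_smul, Real.norm_eq_abs, Real.norm_eq_abs, norm_inv,
            Real.norm_of_nonneg hη.le, abs_of_nonneg (Finset.prod_nonneg fun j _ => h0 _)]
          have e1 : ∏ j ∈ Finset.univ.erase i, h (t j x) ≤ 1 :=
            Finset.prod_le_one (fun j _ => h0 _) fun j _ => h1 _
          calc _ ≤ 1 * (L / θ * (η⁻¹ * ‖ℓ i‖)) := by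
                gcongr
                exact hder _
            _ = _ := by rw [← div_div]; ring
      _ = _ := by rw [← Finset.mul_sum]; ring

end Cutoff

/-! ### Test functions as elements of the form domain -/

section TestFunctions

variable {d n : ℕ} {Ω : Set (Rd d)}

theorem IsTestFunction.eq_zero_of_notMem {F : Type*} [NormedAddCommGroup F] [NormedSpace ℝ F]
    {φ : Rd d → F} (h : IsTestFunction Ω φ) {x : Rd d} (hx : x ∉ Ω) : φ x = 0 :=
  image_eq_zero_of_notMem_tsupport fun hx' => hx (h.2.2 hx')

theorem IsTestFunction.partialDeriv_eq_zero {F : Type*} [NormedAddCommGroup F] [NormedSpace ℝ F]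
    {φ : Rd d → F} (h : IsTestFunction Ω φ) (i : Fin d) {x : Rd d} (hx : x ∉ Ω) :
    partialDeriv i φ x = 0 := by
  have : fderiv ℝ φ x = 0 :=
    image_eq_zero_of_notMem_tsupport fun hx' => hx (h.2.2 (tsupport_fderiv_subset ℝ hx'))
  rw [partialDeriv, this, zero_apply]

theorem IsTestFunction.continuous_partialDeriv {F : Type*} [NormedAddCommGroup F]
    [NormedSpace ℝ F] {φ : Rd d → F} (h : IsTestFunction Ω φ) (i : Fin d) :
    Continuous (partialDeriv i φ) :=
  (h.1.continuous_fderiv (by simp)).clm_apply continuous_const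

theorem IsTestFunction.hasCompactSupport_partialDeriv {F : Type*} [NormedAddCommGroup F]
    [NormedSpace ℝ F] {φ : Rd d → F} (h : IsTestFunction Ω φ) (i : Fin d) :
    HasCompactSupport (partialDeriv i φ) :=
  h.2.1.fderiv_apply ℝ (EuclideanSpace.single i 1)

/-- A test function as an element of the Sobolev space. -/
noncomputable def IsTestFunction.toW12 {Φ : Rd d → Cn n} (h : IsTestFunction Ω Φ) : W12 Ω n where
  toFun := Φ
  grad i := partialDeriv i Φ
  memLp_toFun := (h.1.continuous.memLp_of_hasCompactSupport h.2.1).restrict Ω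
  memLp_grad i := ((h.continuous_partialDeriv i).memLp_of_hasCompactSupport
    (h.hasCompactSupport_partialDeriv i)).restrict Ω
  isWeakPartial i ψ hψ := by
    have e1 : ∫ x in Ω, partialDeriv i ψ x • Φ x = ∫ x, partialDeriv i ψ x • Φ x :=
      setIntegral_eq_integral_of_forall_compl_eq_zero fun x hx => by
        rw [h.eq_zero_of_notMem hx, smul_zero]
    have e2 : ∫ x in Ω, ψ x • partialDeriv i Φ x = ∫ x, ψ x • partialDeriv i Φ x :=
      setIntegral_eq_integral_of_forall_compl_eq_zero fun x hx => by
        rw [hψ.eq_zero_of_notMem hx, zero_smul]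
    rw [e1, e2]
    have h3 := integral_smul_fderiv_eq_neg_fderiv_smul_of_integrable (μ := volume)
      (f := ψ) (g := Φ) (v := EuclideanSpace.single i (1 : ℝ))
      (((hψ.continuous_partialDeriv i).smul h.1.continuous).integrable_of_hasCompactSupport
        h.2.1.smul_left)
      ((hψ.1.continuous.smul (h.continuous_partialDeriv i)).integrable_of_hasCompactSupport
        hψ.2.1.smul_right)
      ((hψ.1.continuous.smul h.1.continuous).integrable_of_hasCompactSupport hψ.2.1.smul_right)
      (fun x _ => hψ.1.differentiable (by simp) x) (fun x _ => h.1.differentiable (by simp) x)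
    unfold partialDeriv
    rw [h3, neg_neg]

theorem IsTestFunction.toW12_mem_formDomain {Φ : Rd d → Cn n} (h : IsTestFunction Ω Φ)
    (bc : BoundaryCondition) : h.toW12 ∈ formDomain Ω n bc := by
  cases bc
  · exact fun δ hδ => ⟨Φ, h, by simpa [IsTestFunction.toW12] using hδ⟩
  · trivial

theorem IsTestFunction.mono {F : Type*} [NormedAddCommGroup F] [NormedSpace ℝ F] {φ : Rd d → F}
    {Ω' : Set (Rd d)} (h : IsTestFunction Ω φ) (hsub : Ω ⊆ Ω') : IsTestFunction Ω' φ :=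
  ⟨h.1, h.2.1, h.2.2.trans hsub⟩

theorem IsTestFunction.smul_single {φ : Rd d → ℝ} (h : IsTestFunction Ω φ) (j : Fin n) :
    IsTestFunction Ω fun x => φ x • (EuclideanSpace.single j 1 : Cn n) :=
  ⟨h.1.smul contDiff_const, h.2.1.smul_right, (tsupport_smul_subset_left _ _).trans h.2.2⟩

theorem partialDeriv_smul_single {φ : Rd d → ℝ} (h : IsTestFunction Ω φ) (j : Fin n)
    (i : Fin d) (x : Rd d) :
    partialDeriv i (fun x => φ x • (EuclideanSpace.single j 1 : Cn n)) x =
      partialDeriv i φ x • EuclideanSpace.single j 1 := by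
  have := ((h.1.differentiable (by simp) x).hasFDerivAt.smul_const
    (EuclideanSpace.single j 1 : Cn n)).fderiv
  rw [partialDeriv, this]
  simp [partialDeriv]

theorem pairing_smul_single (A : Rd d → Matrix (Fin n) (Fin n) ℂ) {φ χ : Rd d → ℝ}
    (hφ : IsTestFunction Ω φ) (hχ : IsTestFunction Ω χ) (i j : Fin n) :
    pairing A (hφ.smul_single j).toW12 (hχ.smul_single i).toW12 =
      ∫ x in Ω, (φ x * χ x : ℝ) • A x i j := by
  refine integral_congr_ae (Eventually.of_forall fun x => ?_)
  change matForm (A x) (φ x • EuclideanSpace.single j 1) (χ x • EuclideanSpace.single i 1) = _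
  rw [matForm_eq_sum, Finset.sum_eq_single i, Finset.sum_eq_single j]
  · simp; ring
  · intro k _ hk; simp [hk]
  · simp
  · intro k _ hk; simp [hk]
  · simp

theorem norm_sq_smul_single {φ : Rd d → ℝ} (h : IsTestFunction Ω φ) (j : Fin n) :
    (h.smul_single j).toW12.norm ^ 2 =
      (∫ x in Ω, φ x ^ 2) + ∑ i, ∫ x in Ω, partialDeriv i φ x ^ 2 := by
  rw [W12.norm, Real.sq_sqrt (by positivity)]
  simp only [IsTestFunction.toW12, partialDeriv_smul_single h]
  simp [norm_smul]

/-- The supremum ignores functions of norm zero. For these the form vanishes by the `L²` bound,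
which is the only use of `K`. -/
theorem norm_pairing_le_multNorm {bc : BoundaryCondition} {A : Rd d → Matrix (Fin n) (Fin n) ℂ}
    {K : ℝ} (hK : 0 ≤ K) (hAK : ∀ᵐ x ∂volume.restrict Ω, matAbs (A x) ≤ K)
    (hfin : multNorm Ω bc A ≠ ⊤) {u v : W12 Ω n} (hu : u ∈ formDomain Ω n bc)
    (hv : v ∈ formDomain Ω n bc) :
    ‖pairing A u v‖ ≤ (multNorm Ω bc A).toReal * (u.norm * v.norm) := by
  by_cases h0 : u.norm ≠ 0 ∧ v.norm ≠ 0
  · have h1 : ENNReal.ofReal (‖pairing A u v‖ / (u.norm * v.norm)) ≤ multNorm Ω bc A := by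
      refine le_trans ?_ (le_iSup₂ u hu)
      refine le_trans ?_ (le_iSup₂ v hv)
      exact le_iSup₂ (f := fun (_ : u.norm ≠ 0) (_ : v.norm ≠ 0) =>
        ENNReal.ofReal (‖pairing A u v‖ / (u.norm * v.norm))) h0.1 h0.2
    have h2 : 0 < u.norm * v.norm := mul_pos (u.norm_nonneg.lt_of_ne' h0.1)
      (v.norm_nonneg.lt_of_ne' h0.2)
    rw [← div_le_iff₀ h2]
    exact (ENNReal.ofReal_le_iff_le_toReal hfin).1 h1
  · have h1 : ‖pairing A u v‖ ≤ K * (u.norm * v.norm) :=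
      norm_setIntegral_le_of_lintegral_le (by have := u.norm_nonneg; have := v.norm_nonneg; positivity)
        (lintegral_enorm_matForm_le hK hAK u.memLp_toFun.1 v.memLp_toFun.1 u.norm_nonneg
          v.norm_nonneg u.lintegral_toFun_sq_le v.lintegral_toFun_sq_le)
    have h2 : u.norm * v.norm = 0 := by
      rw [mul_eq_zero]; tauto
    rw [h2, mul_zero] at h1 ⊢
    exact h1

theorem multNorm_le {bc : BoundaryCondition} {A : Rd d → Matrix (Fin n) (Fin n) ℂ} {c : ℝ}
    (h : ∀ u v : W12 Ω n, ‖pairing A u v‖ ≤ c * (u.norm * v.norm)) :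
    multNorm Ω bc A ≤ ENNReal.ofReal c := by
  refine iSup₂_le fun u _ => iSup₂_le fun v _ => iSup₂_le fun hu hv => ?_
  refine ENNReal.ofReal_le_ofReal ?_
  have h2 : 0 < u.norm * v.norm := mul_pos (u.norm_nonneg.lt_of_ne' hu)
    (v.norm_nonneg.lt_of_ne' hv)
  rw [div_le_iff₀ h2]
  exact h u v

end TestFunctions

/-! ### Recovering the means from the multiplier norm -/

section Converse

variable {d n : ℕ} {b : Module.Basis (Fin d) ℝ (Rd d)} {a : Rd d} {η θ : ℝ} {γ : Rd d}

theorem measureReal_scaledCell (hη : 0 < η) : volume.real (scaledCell b a η γ) =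
    η ^ d * volume.real (ZSpan.fundamentalDomain b) := by
  rw [measureReal_def, volume_scaledCell hη, ENNReal.toReal_mul,
    ENNReal.toReal_ofReal (by positivity), measureReal_def]

theorem volume_scaledCell_lt_top (hη : 0 < η) : volume (scaledCell b a η γ) < ⊤ := by
  rw [volume_scaledCell hη]
  exact ENNReal.mul_lt_top ENNReal.ofReal_lt_top
    (ZSpan.fundamentalDomain_isBounded b).measure_lt_top

theorem norm_partialDeriv_le {F : Type*} [NormedAddCommGroup F] [NormedSpace ℝ F]
    (i : Fin d) (φ : Rd d → F) (x : Rd d) : ‖partialDeriv i φ x‖ ≤ ‖fderiv ℝ φ x‖ := by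
  have h := (fderiv ℝ φ x).le_opNorm (EuclideanSpace.single i 1)
  simpa [partialDeriv] using h

/-- The gradient lives in the layer between the two cells, of relative volume at most `2dθ`; the `d`
partial derivatives, each at most `M` there, give `2d² M² θ`. -/
theorem norm_sq_cutoff_le {Ω : Set (Rd d)} {φ : Rd d → ℝ} {M : ℝ} (hη : 0 < η) (hθ : 0 ≤ θ)
    (hθ' : θ < 1 / 2) (hsub : scaledCell b a η γ ⊆ Ω)
    (hφ : IsTestFunction (scaledCell b a η γ) φ) (h0 : ∀ x, 0 ≤ φ x) (h1 : ∀ x, φ x ≤ 1)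
    (hone : ∀ x ∈ shrunkCell b a η θ γ, φ x = 1) (hder : ∀ x, ‖fderiv ℝ φ x‖ ≤ M) (j : Fin n) :
    ((hφ.mono hsub).smul_single j).toW12.norm ^ 2 ≤
      (1 + 2 * d ^ 2 * M ^ 2 * θ) * (η ^ d * volume.real (ZSpan.fundamentalDomain b)) := by
  have hQ : volume (scaledCell b a η γ) < ⊤ := volume_scaledCell_lt_top hη
  have hD : volume (scaledCell b a η γ \ shrunkCell b a η θ γ) < ⊤ :=
    (measure_mono sdiff_subset).trans_lt hQ
  rw [norm_sq_smul_single (hφ.mono hsub)]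
  have e1 : ∫ x in Ω, φ x ^ 2 ≤ η ^ d * volume.real (ZSpan.fundamentalDomain b) := by
    have e : ∫ x in Ω, φ x ^ 2 = ∫ x in scaledCell b a η γ, φ x ^ 2 := by
      rw [setIntegral_eq_integral_of_forall_compl_eq_zero fun x hx => by
          rw [(hφ.mono hsub).eq_zero_of_notMem hx, zero_pow two_ne_zero],
        setIntegral_eq_integral_of_forall_compl_eq_zero fun x hx => by
          rw [hφ.eq_zero_of_notMem hx, zero_pow two_ne_zero]]
    have h := norm_setIntegral_le_of_norm_le_const (f := fun x => φ x ^ 2) (C := 1) hQ fun x _ => by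
      rw [Real.norm_of_nonneg (sq_nonneg _)]
      exact pow_le_one₀ (h0 x) (h1 x)
    rw [one_mul, measureReal_scaledCell hη] at h
    exact e ▸ (le_abs_self _).trans h
  have e2 : ∀ i, ∫ x in Ω, partialDeriv i φ x ^ 2 ≤
      M ^ 2 * (2 * d * θ * (η ^ d * volume.real (ZSpan.fundamentalDomain b))) := by
    intro i
    have hz : ∀ x ∉ scaledCell b a η γ \ shrunkCell b a η θ γ, partialDeriv i φ x = 0 := by
      intro x hx
      by_cases hxQ : x ∈ scaledCell b a η γ
      · have hxs : x ∈ shrunkCell b a η θ γ := by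
          by_contra h; exact hx ⟨hxQ, h⟩
        -- On the shrunk cell `φ` attains its global maximum 1, so its gradient vanishes.
        have : fderiv ℝ φ x = 0 := IsLocalMax.fderiv_eq_zero
          (Eventually.of_forall fun y => by rw [hone x hxs]; exact h1 y)
        rw [partialDeriv, this, zero_apply]
      · exact hφ.partialDeriv_eq_zero i hxQ
    have e : ∫ x in Ω, partialDeriv i φ x ^ 2 =
        ∫ x in scaledCell b a η γ \ shrunkCell b a η θ γ, partialDeriv i φ x ^ 2 := by
      rw [setIntegral_eq_integral_of_forall_compl_eq_zero fun x hx => by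
          rw [(hφ.mono hsub).partialDeriv_eq_zero i hx, zero_pow two_ne_zero],
        setIntegral_eq_integral_of_forall_compl_eq_zero fun x hx => by
          rw [hz x hx, zero_pow two_ne_zero]]
    have h := norm_setIntegral_le_of_norm_le_const (f := fun x => partialDeriv i φ x ^ 2)
      (C := M ^ 2) hD fun x _ => by
        rw [norm_pow]
        exact pow_le_pow_left₀ (norm_nonneg _) ((norm_partialDeriv_le i φ x).trans (hder x)) 2
    rw [e]
    exact (le_abs_self _).trans (h.trans (mul_le_mul_of_nonneg_left
      (measureReal_scaledCell_diff_le hη hθ hθ') (sq_nonneg M)))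
  have e3 := Finset.sum_le_sum fun i (_ : i ∈ Finset.univ) => e2 i
  rw [Finset.sum_const, Finset.card_univ, Fintype.card_fin, nsmul_eq_mul] at e3
  linarith

theorem exists_matAbs_cellMean_le (b : Module.Basis (Fin d) ℝ (Rd d)) (a : Rd d) (n : ℕ) {K : ℝ}
    (hK : 0 ≤ K) : ∃ C : ℝ, 0 < C ∧ ∀ (Ω : Set (Rd d)) (bc : BoundaryCondition)
      (A : Rd d → Matrix (Fin n) (Fin n) ℂ) (η : ℝ),
      (∀ i j, AEStronglyMeasurable (fun x => A x i j) (volume.restrict Ω)) →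
      (∀ᵐ x ∂volume.restrict Ω, matAbs (A x) ≤ K) → multNorm Ω bc A ≠ ⊤ → 0 < η →
      (multNorm Ω bc A).toReal = η ^ 4 → ∀ γ ∈ innerLattice b a Ω η,
      matAbs (cellMean b a η γ A) ≤ C * η := by
  obtain ⟨L, hL0, hL⟩ := exists_cell_cutoff b a
  set q := volume.real (ZSpan.fundamentalDomain b) with hq
  have hq0 : 0 ≤ q := measureReal_nonneg
  -- The summands come from the form tested on the cutoff, from replacing `φ²` by 1, and from the
  -- range `η ≥ 1/4`.
  set c : ℝ := (1 + 2 * d ^ 2 * L ^ 2 + 2 * d * K + 4 * K) * q with hc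
  have hc0 : 0 ≤ c := by positivity
  refine ⟨n * (n * c) + 1, by positivity, fun Ω bc A η hA hAK hfin hη hκ γ hγ => ?_⟩
  have hsub : scaledCell b a η γ ⊆ Ω := hγ.2
  have hQ : volume (scaledCell b a η γ) < ⊤ := volume_scaledCell_lt_top hη
  have hQK : ∀ i j, ∀ᵐ x ∂volume.restrict (scaledCell b a η γ), ‖A x i j‖ ≤ K := fun i j => by
    filter_upwards [ae_mono (Measure.restrict_mono hsub le_rfl) hAK] with x hx
    exact (norm_entry_le_matAbs _ i j).trans hx
  have hAQ : ∀ i j, AEStronglyMeasurable (fun x => A x i j)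
      (volume.restrict (scaledCell b a η γ)) := fun i j =>
    (hA i j).mono_measure (Measure.restrict_mono hsub le_rfl)
  have hηd : 0 < η ^ d := by positivity
  have main : ∀ i j, ‖∫ x in scaledCell b a η γ, A x i j‖ ≤ c * η * η ^ d := by
    intro i j
    -- For `η ≥ 1/4` the bound `K ≤ 4 * K * η` suffices; below, `θ = η` is an admissible width.
    rcases le_or_gt (1 / 4) η with h4 | h4
    · refine (norm_setIntegral_le_of_norm_le_const_ae hQ (hQK i j)).trans ?_
      rw [measureReal_scaledCell hη, ← hq]
      have : K * q ≤ c * η := by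
        have h5 : 4 * K * q ≤ c := by
          rw [hc]; gcongr
          have : 0 ≤ 1 + 2 * d ^ 2 * L ^ 2 + 2 * d * K := by positivity
          linarith
        nlinarith [mul_nonneg hK hq0]
      nlinarith
    -- With width `θ = η` the gradient is at most `L / η²`, so the squared norm is of order `η⁻³
    -- η^d`; the multiplier norm `η⁴` leaves one power of `η` over.
    obtain ⟨φ, hφ, h0, h1, hone, hder⟩ := hL η η γ hη hη
    have hφΩ := hφ.mono hsub
    have hN : ∀ j : Fin n, (hφΩ.smul_single j).toW12.norm ^ 2 ≤ _ := fun j =>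
      norm_sq_cutoff_le hη hη.le (by linarith) hsub hφ h0 h1 hone hder j
    have hN1 : (hφΩ.smul_single j).toW12.norm * (hφΩ.smul_single i).toW12.norm ≤
        (1 + 2 * d ^ 2 * (L / (η * η)) ^ 2 * η) * (η ^ d * q) := by
      nlinarith [hN i, hN j, sq_nonneg ((hφΩ.smul_single j).toW12.norm -
        (hφΩ.smul_single i).toW12.norm)]
    have p1 : ‖∫ x in scaledCell b a η γ, (φ x * φ x : ℝ) • A x i j‖ ≤
        (1 + 2 * d ^ 2 * L ^ 2) * q * η * η ^ d := by
      have h2 := norm_pairing_le_multNorm hK hAK hfin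
        ((hφΩ.smul_single j).toW12_mem_formDomain bc) ((hφΩ.smul_single i).toW12_mem_formDomain bc)
      have e : ∫ x in Ω, (φ x * φ x : ℝ) • A x i j =
          ∫ x in scaledCell b a η γ, (φ x * φ x : ℝ) • A x i j := by
        rw [setIntegral_eq_integral_of_forall_compl_eq_zero fun x hx => by
            rw [hφΩ.eq_zero_of_notMem hx, zero_mul, zero_smul],
          setIntegral_eq_integral_of_forall_compl_eq_zero fun x hx => by
            rw [hφ.eq_zero_of_notMem hx, zero_mul, zero_smul]]
      rw [pairing_smul_single A hφΩ hφΩ, hκ, e] at h2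
      refine h2.trans ((mul_le_mul_of_nonneg_left hN1 (by positivity)).trans ?_)
      have e4 : η ^ 4 * ((1 + 2 * d ^ 2 * (L / (η * η)) ^ 2 * η) * (η ^ d * q)) =
          (η ^ 4 + 2 * d ^ 2 * L ^ 2 * η) * (η ^ d * q) := by
        field_simp
      have e5 : η ^ 4 ≤ η := pow_le_of_le_one hη.le (by linarith) (by norm_num)
      calc _ = _ := e4
        _ ≤ (η + 2 * d ^ 2 * L ^ 2 * η) * (η ^ d * q) := by gcongr
        _ = _ := by ring
    have hint : Integrable (fun x => A x i j) (volume.restrict (scaledCell b a η γ)) :=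
      haveI : IsFiniteMeasure (volume.restrict (scaledCell b a η γ)) :=
        isFiniteMeasure_restrict.2 hQ.ne
      Integrable.of_bound (hAQ i j) K (hQK i j)
    have hφb : ∀ x, ‖φ x * φ x‖ ≤ 1 := fun x => by
      rw [Real.norm_of_nonneg (mul_self_nonneg _)]
      nlinarith [h0 x, h1 x]
    have hint2 : Integrable (fun x => (φ x * φ x : ℝ) • A x i j)
        (volume.restrict (scaledCell b a η γ)) :=
      hint.bdd_smul 1 (hφ.1.continuous.mul hφ.1.continuous).aestronglyMeasurable
        (Eventually.of_forall hφb)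
    have p2 : ‖∫ x in scaledCell b a η γ, (A x i j - (φ x * φ x : ℝ) • A x i j)‖ ≤
        2 * d * K * q * η * η ^ d := by
      rw [setIntegral_eq_of_subset_of_forall_sdiff_eq_zero isOpen_scaledCell.measurableSet
        (sdiff_subset (t := shrunkCell b a η η γ)) fun x hx => ?_]
      · refine (norm_setIntegral_le_of_norm_le_const_ae ((measure_mono sdiff_subset).trans_lt hQ)
          (C := K) ?_).trans ?_
        · filter_upwards [ae_mono (Measure.restrict_mono sdiff_subset le_rfl) (hQK i j)] with x hx
          have e : A x i j - (φ x * φ x : ℝ) • A x i j = (1 - φ x * φ x : ℝ) • A x i j := by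
            rw [sub_smul, one_smul]
          have h5 := hφb x
          rw [Real.norm_of_nonneg (mul_self_nonneg _)] at h5
          rw [e, norm_smul, Real.norm_of_nonneg (by linarith)]
          nlinarith [norm_nonneg (A x i j), mul_self_nonneg (φ x)]
        · refine (mul_le_mul_of_nonneg_left
            (measureReal_scaledCell_diff_le hη hη.le (by linarith)) hK).trans_eq ?_
          rw [← hq]; ring
      · have hxs : x ∈ shrunkCell b a η η γ := by
          by_contra h; exact hx.2 ⟨hx.1, h⟩
        rw [hone x hxs, mul_one, one_smul, sub_self]
    rw [integral_sub hint hint2] at p2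
    have p3 := norm_le_norm_sub_add (∫ x in scaledCell b a η γ, A x i j)
      (∫ x in scaledCell b a η γ, (φ x * φ x : ℝ) • A x i j)
    have p4 : 0 ≤ 4 * K * q * η * η ^ d := by positivity
    calc _ ≤ _ := p3
      _ ≤ _ := add_le_add p2 p1
      _ ≤ c * η * η ^ d := by rw [hc]; linarith
  have hentry : ∀ i j, ‖cellMean b a η γ A i j‖ ≤ c * η := by
    intro i j
    rw [cellMean, Matrix.of_apply, integral_const_mul, norm_mul, norm_inv, norm_pow,
      Complex.norm_real, Real.norm_of_nonneg hη.le, inv_mul_le_iff₀ hηd, mul_comm]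
    exact main i j
  calc matAbs (cellMean b a η γ A) ≤ ∑ _i : Fin n, ∑ _j : Fin n, c * η :=
        Finset.sum_le_sum fun i _ => Finset.sum_le_sum fun j _ => hentry i j
    _ = n * (n * c) * η := by simp; ring
    _ ≤ _ := by gcongr; linarith

/-- Testing on `g e_j` and `χ e_i`, with `χ = 1` on the support of `g`, turns the form into `∫ g
A_ij`; the fundamental lemma of the calculus of variations applies. -/
theorem ae_eq_zero_of_multNorm_eq_zero {Ω : Set (Rd d)} (hΩ : IsOpen Ω) {bc : BoundaryCondition}
    {A : Rd d → Matrix (Fin n) (Fin n) ℂ} {K : ℝ} (hK : 0 ≤ K)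
    (hA : ∀ i j, AEStronglyMeasurable (fun x => A x i j) (volume.restrict Ω))
    (hAK : ∀ᵐ x ∂volume.restrict Ω, matAbs (A x) ≤ K) (h : multNorm Ω bc A = 0) :
    A =ᵐ[volume.restrict Ω] 0 := by
  have key : ∀ i j, ∀ᵐ x ∂volume.restrict Ω, A x i j = 0 := by
    intro i j
    rw [ae_restrict_iff' hΩ.measurableSet]
    have hent : ∀ᵐ x ∂volume.restrict Ω, ‖A x i j‖ ≤ K := by
      filter_upwards [hAK] with x hx using (norm_entry_le_matAbs _ i j).trans hx
    have hmem : MemLp (fun x => A x i j) ∞ (volume.restrict Ω) :=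
      memLp_top_of_bound (hA i j) K hent
    refine hΩ.ae_eq_zero_of_integral_contDiff_smul_eq_zero ?_ fun g hg hgc hgs => ?_
    · exact locallyIntegrableOn_of_locallyIntegrable_restrict (hmem.locallyIntegrable le_top)
    obtain ⟨K', hK'c, hK'1, hK'2⟩ := exists_compact_between hgc hΩ hgs
    obtain ⟨χ, hχ, hχr, hχs, hχ1⟩ := exists_contMDiff_support_eq_eq_one_iff
      (modelWithCornersSelf ℝ (Rd d)) (n := (⊤ : ℕ∞)) (s := interior K') (t := tsupport g) isOpen_interior
      (isClosed_tsupport g) hK'1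
    have hχt : tsupport χ ⊆ K' := by
      rw [tsupport, hχs]
      exact closure_minimal interior_subset hK'c.isClosed
    have hχT : IsTestFunction Ω χ := ⟨hχ.contDiff, hK'c.of_isClosed_subset (isClosed_tsupport χ) hχt,
      hχt.trans hK'2⟩
    have hgT : IsTestFunction Ω g := ⟨hg, hgc, hgs⟩
    have h2 := norm_pairing_le_multNorm hK hAK (h ▸ ENNReal.zero_ne_top)
        ((hgT.smul_single j).toW12_mem_formDomain bc) ((hχT.smul_single i).toW12_mem_formDomain bc)
    rw [h, ENNReal.toReal_zero, zero_mul, norm_le_zero_iff, pairing_smul_single A hgT hχT] at h2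
    have e : ∀ x, g x * χ x = g x := fun x => by
      by_cases hx : x ∈ tsupport g
      · rw [(hχ1 x).1 hx, mul_one]
      · rw [image_eq_zero_of_notMem_tsupport hx, zero_mul]
    simp only [e] at h2
    rw [← h2]
    refine (setIntegral_eq_integral_of_forall_compl_eq_zero fun x hx => ?_).symm
    rw [hgT.eq_zero_of_notMem hx, zero_smul]
  filter_upwards [ae_all_iff.2 fun i => ae_all_iff.2 (key i)] with x hx
  ext i j
  exact hx i j

end Converse

/-! ### Uniform bounds for differences -/

theorem matAbs_sub_le {n : ℕ} (A B : Matrix (Fin n) (Fin n) ℂ) :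
    matAbs (A - B) ≤ matAbs A + matAbs B := by
  simp only [matAbs, ← Finset.sum_add_distrib]
  exact Finset.sum_le_sum fun i _ => Finset.sum_le_sum fun j _ => norm_sub_le _ _

theorem matAbs_nonneg {n : ℕ} (A : Matrix (Fin n) (Fin n) ℂ) : 0 ≤ matAbs A :=
  Finset.sum_nonneg fun _ _ => Finset.sum_nonneg fun _ _ => norm_nonneg _

theorem MemLinf.linfNorm_ne_top {d n : ℕ} {Ω : Set (Rd d)} {A : Rd d → Matrix (Fin n) (Fin n) ℂ}
    (h : MemLinf Ω A) : linfNorm Ω A ≠ ⊤ := by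
  have : MemLp (fun x => matAbs (A x)) ∞ (volume.restrict Ω) :=
    memLp_finsetSum _ fun i _ => memLp_finsetSum _ fun j _ => (h i j).norm
  exact this.2.ne

theorem ae_matAbs_le_of_linfNorm_le {d n : ℕ} {Ω : Set (Rd d)}
    {A : Rd d → Matrix (Fin n) (Fin n) ℂ} {K : ℝ} (hK : 0 ≤ K)
    (h : linfNorm Ω A ≤ ENNReal.ofReal K) : ∀ᵐ x ∂volume.restrict Ω, matAbs (A x) ≤ K := by
  rw [linfNorm, eLpNorm_exponent_top] at h
  filter_upwards [ae_le_eLpNormEssSup (f := fun x => matAbs (A x))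
    (μ := volume.restrict Ω)] with x hx
  have h1 := hx.trans h
  rw [Real.enorm_of_nonneg (matAbs_nonneg _)] at h1
  exact (ENNReal.ofReal_le_ofReal_iff hK).1 h1

/-! ### The equivalence of multiplier convergence and convergence of the means. -/

theorem theorem4 {d n m : ℕ} [NeZero d] [NeZero n] (Ω : Set (Rd d)) (hΩ : IsRegularDomain Ω)
    (bc : BoundaryCondition) (b : Module.Basis (Fin d) ℝ (Rd d)) (a : Rd d)
    (S : Set (Rd m)) (V : Rd m → Rd d → Matrix (Fin n) (Fin n) ℂ)
    (V₀ : Rd d → Matrix (Fin n) (Fin n) ℂ)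
    (hV : ∀ ε ∈ S, MemLinf Ω (V ε))
    (hVbdd : ∃ K : ℝ, ∀ ε ∈ S, linfNorm Ω (V ε) ≤ ENNReal.ofReal K)
    (hV₀ : MemLinf Ω V₀) :
    -- the condition on the means is sufficient, with a rate
    (∃ C : ℝ, 0 < C ∧ ∀ η ρ : Rd m → ℝ, (∀ ε ∈ S, 0 < η ε) → (∀ ε ∈ S, 0 ≤ ρ ε) →
      MeanCondition Ω b a S V V₀ η ρ →
        Tendsto (fun ε => multNorm Ω bc (V ε - V₀)) (𝓝[S] 0) (𝓝 0) ∧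
        ∀ ε ∈ S, multNorm Ω bc (V ε - V₀) ≤ ENNReal.ofReal (C * (ρ ε + η ε))) ∧
    -- and it is necessary
    (Tendsto (fun ε => multNorm Ω bc (V ε - V₀)) (𝓝[S] 0) (𝓝 0) →
      (∃ C : ℝ, 0 < C ∧ MeanCondition Ω b a S V V₀
        (fun ε => (multNorm Ω bc (V ε - V₀)).toReal ^ (1 / 4 : ℝ))
        (fun ε => C * (multNorm Ω bc (V ε - V₀)).toReal ^ (1 / 4 : ℝ))) ∧
      ∀ ε ∈ S, multNorm Ω bc (V ε - V₀) = 0 → V ε =ᵐ[volume.restrict Ω] V₀) := by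
  obtain ⟨K, hK, hVK⟩ : ∃ K : ℝ, 0 ≤ K ∧ ∀ ε ∈ S,
      ∀ᵐ x ∂volume.restrict Ω, matAbs ((V ε - V₀) x) ≤ K := by
    obtain ⟨K, hVbdd⟩ := hVbdd
    -- The given bound may be negative, in which case `ENNReal.ofReal K` is 0.
    refine ⟨max K 0 + (linfNorm Ω V₀).toReal, by positivity, fun ε hε => ?_⟩
    filter_upwards [ae_matAbs_le_of_linfNorm_le (le_max_right K 0)
        ((hVbdd ε hε).trans (ENNReal.ofReal_le_ofReal (le_max_left K 0))),
      ae_matAbs_le_of_linfNorm_le ENNReal.toReal_nonneg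
        (ENNReal.ofReal_toReal hV₀.linfNorm_ne_top).ge] with x h1 h2
    exact (matAbs_sub_le _ _).trans (add_le_add h1 h2)
  have hmeas : ∀ ε ∈ S, ∀ i j,
      AEStronglyMeasurable (fun x => (V ε - V₀) x i j) (volume.restrict Ω) := fun ε hε i j =>
    (hV ε hε i j).1.sub (hV₀ i j).1
  refine ⟨?_, fun hlim => ⟨?_, fun ε hε h0 => ?_⟩⟩
  · obtain ⟨C, hC, hbound⟩ := hΩ.exists_pairing_bound n b a hK
    refine ⟨C, hC, fun η ρ hη hρ ⟨hη0, hρ0, hmean⟩ => ?_⟩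
    have hle : ∀ ε ∈ S, multNorm Ω bc (V ε - V₀) ≤ ENNReal.ofReal (C * (ρ ε + η ε)) :=
      fun ε hε => multNorm_le (hbound _ _ _ (hη ε hε) (hρ ε hε) (hmeas ε hε) (hVK ε hε)
        (hmean ε hε (hη ε hε)))
    refine ⟨tendsto_of_tendsto_of_tendsto_of_le_of_le' tendsto_const_nhds ?_
      (Eventually.of_forall fun _ => zero_le)
      (eventually_of_mem self_mem_nhdsWithin hle), hle⟩
    have h := ENNReal.tendsto_ofReal ((hρ0.add hη0).const_mul C)
    simpa using h
  · obtain ⟨C, hC, hmean⟩ := exists_matAbs_cellMean_le b a n hK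
    have hη0 : Tendsto (fun ε => (multNorm Ω bc (V ε - V₀)).toReal ^ (1 / 4 : ℝ)) (𝓝[S] 0)
        (𝓝 0) := by
      have h := ((ENNReal.tendsto_toReal ENNReal.zero_ne_top).comp hlim).rpow_const
        (p := (1 / 4 : ℝ)) (Or.inr (by norm_num))
      simpa [Real.zero_rpow] using h
    refine ⟨C, hC, hη0, by simpa using hη0.const_mul C, fun ε hε hη γ hγ => ?_⟩
    -- An infinite norm has `toReal` equal to 0, which `η ε > 0` excludes; the remaining goal is
    -- that the fourth power of `η ε` is the norm.
    refine hmean Ω bc _ _ (hmeas ε hε) (hVK ε hε) (fun h => ?_) hη ?_ γ hγ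
    · simp [h] at hη
    · rw [← Real.rpow_natCast, ← Real.rpow_mul ENNReal.toReal_nonneg]
      norm_num
  · filter_upwards [ae_eq_zero_of_multNorm_eq_zero hΩ.isOpen hK (hmeas ε hε) (hVK ε hε) h0]
      with x hx
    exact sub_eq_zero.1 hx
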